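/- Let $T>0$, let $A\in\mathbb R^{d\times d}$, $B\in\mathbb R^{d\times m}$, $C\in\mathbb R^{p\times d}$ be constant matrices, and let $N$ be a continuous $d\times d$ matrix-valued function on $[0,T]$; let $y:[0,T]\to\mathbb R^p$ be a continuous reference signal. An asterisk denotes transposition and the norms are Euclidean. For $\tau\in[0,T]$ let $M^2_\tau=\mathbb R^d\times L^2(0,\tau;\mathbb R^d)$ (with $M^2_0=\mathbb R^d$). For $\Xi=(\hat\xi,\tilde\xi)\in M^2_\tau$ and $u\in L^2(\tau,T;\mathbb R^m)$ let $w$ be the solution on $[\tau,T]$ of $$w'(t)=Aw(t)+\int_\tau^tN(t-s)w(s)\,ds+Bu(t)+\int_0^\tau N(t-s)\tilde\xi(s)\,ds,\qquad w(\tau)=\hat\xi,$$ put $J_\tau(\Xi;u)=\int_\tau^T\left[\|Cw(t)-y(t)\|^2+\|u(t)\|^2\right]dt$, and let $W_\tau(\Xi)$ be the minimum of $J_\tau(\Xi;\cdot)$ over $L^2(\tau,T;\mathbb R^m)$. (i) The minimum exists, and for all $\tau\in[0,T]$ and $\Xi\in M^2_\tau$ $$\begin{aligned}W_\tau(\Xi)={}&\langle\hat\xi,P_0(\tau)\hat\xi\rangle+2\Big\langle\hat\xi,\int_0^\tau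 P_1(s,\tau)\tilde\xi(s)\,ds\Big\rangle+\int_0^\tau\!\!\int_0^\tau\langle\tilde\xi(s),P_2(s,\nu,\tau)\tilde\xi(\nu)\rangle\,d\nu\,ds\\&+2\langle\hat\xi,d_1(\tau)\rangle+2\int_0^\tau\langle\tilde\xi(s),d_2(s,\tau)\rangle\,ds+M(\tau),\end{aligned}\qquad(1)$$ where $P_0,P_1,P_2$ are matrix-valued functions that do not depend on $y$ (nor on $\Xi$), $d_1,d_2$ are vector-valued and $M$ is scalar (depending on $y$, not on $\Xi$). The functions $P_0,d_1,M$ are of class $C^1$ on $[0,T]$; $P_1(s,\tau)$, $d_2(s,\tau)$ are continuous, with continuous derivative in $\tau$, on $\{0\le s\le\tau\le T\}$; $P_2(s,\nu,\tau)$ is continuous, with continuous derivative in $\tau$, on $\{0\le s,\nu\le\tau\le T\}$; and $P_0(\tau)=P_0^*(\tau)$, $P_2(s,\nu,\tau)=P_2^*(\nu,s,\tau)$. (ii) Let $P_0,P_1,P_2,d_1,d_2,M$ be any functions, continuous on these domains and with the above symmetry, for which (1) holds for the signal $y$. Then the following statements hold. - For every $\tau\in[0,T)$ and $\Xi\in M^2_\tau$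 the optimal control is unique in $L^2(\tau,T;\mathbb R^m)$, has a continuous representative $u^+$ on $[\tau,T]$, and, with $w^+$ the corresponding solution, extended by $\tilde\xi$ to $(0,\tau)$, $$u^+(t)=-B^*\Big[P_0(t)w^+(t)+\int_0^tP_1(s,t)w^+(s)\,ds+d_1(t)\Big],\qquad t\in[\tau,T].$$ - The signal-dependent terms $d_1,d_2$ solve the linear backward system $$\begin{cases}\dot d_1(\tau)+\big(A^*-P_0(\tau)BB^*\big)d_1(\tau)+d_2(\tau,\tau)-C^*y(\tau)=0,& d_1(T)=0,\\ \dot d_2(s,\tau)+N^*(\tau-s)d_1(\tau)-P_1^*(s,\tau)BB^*d_1(\tau)=0,& d_2(s,T)=0,\end{cases}$$ for $0\le s\le\tau\le T$, where the dot is the derivative with respect to $\tau$ (one-sided at the end points). - The scalar $M$ satisfies $\dot M(\tau)=\|B^*d_1(\tau)\|^2-\|y(\tau)\|^2$ on $[0,T]$, and $M(T)=0$. -/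

import Mathlib

open MeasureTheory Set
open scoped InnerProduct

/-- `Vec n` is `ℝⁿ` with its Euclidean norm and inner product. Real `k × n` matrices are represented
by the (continuous) linear maps `Vec n →L[ℝ] Vec k`; the transpose is then the adjoint `L†`. -/
abbrev Vec (n : ℕ) : Type := EuclideanSpace ℝ (Fin n)

namespace MemoryTracking

section

variable {d m p : ℕ}

/-- The initial datum `(ξ, η)` at time `τ` lies in `M²_τ = ℝᵈ × L²(0, τ; ℝᵈ)`: a condition on the
memory component `η` only (and no condition at all when `τ = 0`). -/
def IsMemory (τ : ℝ) (η : ℝ → Vec d) : Prop :=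
  MemLp η 2 (volume.restrict (Ioo 0 τ))

/-- `u ∈ L²(τ, T; ℝᵐ)`, and `w` is the corresponding solution on `[τ, T]` of
`w'(t) = A w(t) + ∫_τ^t N(t-s) w(s) ds + B u(t) + ∫_0^τ N(t-s) η(s) ds`, `w(τ) = ξ`.
Since `u` is only square integrable, the equation is understood in integrated form. -/
structure IsAdmissible (T : ℝ) (A : Vec d →L[ℝ] Vec d) (N : ℝ → Vec d →L[ℝ] Vec d)
    (B : Vec m →L[ℝ] Vec d) (τ : ℝ) (ξ : Vec d) (η : ℝ → Vec d)
    (u : ℝ → Vec m) (w : ℝ → Vec d) : Prop where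
  control : MemLp u 2 (volume.restrict (Ioc τ T))
  state_continuousOn : ContinuousOn w (Icc τ T)
  state_eq : ∀ t ∈ Icc τ T, w t = ξ + ∫ r in τ..t,
    (A (w r) + (∫ s in τ..r, N (r - s) (w s)) + B (u r) + ∫ s in (0 : ℝ)..τ, N (r - s) (η s))

/-- The cost `∫_τ^T (‖C w(t) - y(t)‖² + ‖u(t)‖²) dt`. -/
noncomputable def cost (T : ℝ) (C : Vec d →L[ℝ] Vec p) (y : ℝ → Vec p) (τ : ℝ)
    (u : ℝ → Vec m) (w : ℝ → Vec d) : ℝ :=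
  ∫ t in τ..T, (‖C (w t) - y t‖ ^ 2 + ‖u t‖ ^ 2)

/-- All values of the cost when the control ranges over `L²(τ, T; ℝᵐ)`. The value function
`W_τ(ξ, η)` is the minimum of this set. -/
def costValues (T : ℝ) (A : Vec d →L[ℝ] Vec d) (N : ℝ → Vec d →L[ℝ] Vec d)
    (B : Vec m →L[ℝ] Vec d) (C : Vec d →L[ℝ] Vec p) (y : ℝ → Vec p)
    (τ : ℝ) (ξ : Vec d) (η : ℝ → Vec d) : Set ℝ :=
  {c | ∃ (u : ℝ → Vec m) (w : ℝ → Vec d),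
    IsAdmissible T A N B τ ξ η u w ∧ c = cost T C y τ u w}

/-- The triangle `{(s, t) : 0 ≤ s ≤ t ≤ T}`. -/
def triangle (T : ℝ) : Set (ℝ × ℝ) := {q | 0 ≤ q.1 ∧ q.1 ≤ q.2 ∧ q.2 ≤ T}

/-- The pyramid `{(s, ν, t) : 0 ≤ s ≤ t, 0 ≤ ν ≤ t, t ≤ T}`. -/
def pyramid (T : ℝ) : Set (ℝ × ℝ × ℝ) :=
  {q | 0 ≤ q.1 ∧ q.1 ≤ q.2.2 ∧ 0 ≤ q.2.1 ∧ q.2.1 ≤ q.2.2 ∧ q.2.2 ≤ T}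

/-- The quadratic polynomial in `(ξ, η) ∈ M²_τ` with coefficients `P₀, P₁, P₂, d₁, d₂, M`. -/
noncomputable def quadraticForm (P₀ : ℝ → Vec d →L[ℝ] Vec d) (P₁ : ℝ → ℝ → Vec d →L[ℝ] Vec d)
    (P₂ : ℝ → ℝ → ℝ → Vec d →L[ℝ] Vec d) (d₁ : ℝ → Vec d) (d₂ : ℝ → ℝ → Vec d) (M : ℝ → ℝ)
    (τ : ℝ) (ξ : Vec d) (η : ℝ → Vec d) : ℝ :=
  inner ℝ ξ (P₀ τ ξ) + 2 * inner ℝ ξ (∫ s in (0 : ℝ)..τ, P₁ s τ (η s))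
    + (∫ s in (0 : ℝ)..τ, ∫ ν in (0 : ℝ)..τ, inner ℝ (η s) (P₂ s ν τ (η ν)))
    + 2 * inner ℝ ξ (d₁ τ) + 2 * (∫ s in (0 : ℝ)..τ, inner ℝ (η s) (d₂ s τ)) + M τ

/-- The functions `P₀, P₁, P₂, d₁, d₂, M` are the coefficients of the value function of the tracking
problem with reference signal `y`: they are continuous on their domains, `P₀` and `P₂` have
the usual symmetry, and for every `τ ∈ [0, T]` and every initial datum in `M²_τ` the minimum
of the cost exists and is the quadratic polynomial with these coefficients. -/
structure IsValueRepresentation (T : ℝ) (A : Vec d →L[ℝ] Vec d) (N : ℝ → Vec d →L[ℝ] Vec d)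
    (B : Vec m →L[ℝ] Vec d) (C : Vec d →L[ℝ] Vec p) (y : ℝ → Vec p)
    (P₀ : ℝ → Vec d →L[ℝ] Vec d) (P₁ : ℝ → ℝ → Vec d →L[ℝ] Vec d)
    (P₂ : ℝ → ℝ → ℝ → Vec d →L[ℝ] Vec d) (d₁ : ℝ → Vec d) (d₂ : ℝ → ℝ → Vec d) (M : ℝ → ℝ) :
    Prop where
  P₀_continuousOn : ContinuousOn P₀ (Icc 0 T)
  P₁_continuousOn : ContinuousOn (fun q : ℝ × ℝ => P₁ q.1 q.2) (triangle T)
  P₂_continuousOn : ContinuousOn (fun q : ℝ × ℝ × ℝ => P₂ q.1 q.2.1 q.2.2) (pyramid T)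
  d₁_continuousOn : ContinuousOn d₁ (Icc 0 T)
  d₂_continuousOn : ContinuousOn (fun q : ℝ × ℝ => d₂ q.1 q.2) (triangle T)
  M_continuousOn : ContinuousOn M (Icc 0 T)
  P₀_symm : ∀ τ ∈ Icc 0 T, (P₀ τ)† = P₀ τ
  P₂_symm : ∀ s ν τ, (s, ν, τ) ∈ pyramid T → (P₂ ν s τ)† = P₂ s ν τ
  value_eq : ∀ τ ∈ Icc 0 T, ∀ (ξ : Vec d) (η : ℝ → Vec d), IsMemory τ η →
    IsLeast (costValues T A N B C y τ ξ η) (quadraticForm P₀ P₁ P₂ d₁ d₂ M τ ξ η)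

/-- `f(s, t)` has a derivative in `t` which is continuous on the triangle. -/
def HasContTimeDeriv {F : Type*} [NormedAddCommGroup F] [NormedSpace ℝ F] (T : ℝ)
    (f : ℝ → ℝ → F) : Prop :=
  ∃ f' : ℝ → ℝ → F, ContinuousOn (fun q : ℝ × ℝ => f' q.1 q.2) (triangle T) ∧
    ∀ s t, (s, t) ∈ triangle T → HasDerivWithinAt (fun r => f s r) (f' s t) (Icc s T) t

/-- `f(s, ν, t)` has a derivative in `t` which is continuous on the pyramid. -/
def HasContTimeDeriv₂ {F : Type*} [NormedAddCommGroup F] [NormedSpace ℝ F] (T : ℝ)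
    (f : ℝ → ℝ → ℝ → F) : Prop :=
  ∃ f' : ℝ → ℝ → ℝ → F,
    ContinuousOn (fun q : ℝ × ℝ × ℝ => f' q.1 q.2.1 q.2.2) (pyramid T) ∧
    ∀ s ν t, (s, ν, t) ∈ pyramid T →
      HasDerivWithinAt (fun r => f s ν r) (f' s ν t) (Icc (max s ν) T) t

/-- For every `τ ∈ [0, T)` and every initial datum in `M²_τ` there is an optimal control, unique up
to null sets and continuous on `[τ, T]`, which is given by
`u(t) = -B* [P₀(t) w(t) + ∫_0^t P₁(s, t) w(s) ds + d₁(t)]` on `[τ, T]`, where `w` is the optimal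
trajectory, extended to `(0, τ)` by the memory `η`. -/
def IsOptimalFeedback (T : ℝ) (A : Vec d →L[ℝ] Vec d) (N : ℝ → Vec d →L[ℝ] Vec d)
    (B : Vec m →L[ℝ] Vec d) (C : Vec d →L[ℝ] Vec p) (y : ℝ → Vec p)
    (P₀ : ℝ → Vec d →L[ℝ] Vec d) (P₁ : ℝ → ℝ → Vec d →L[ℝ] Vec d) (d₁ : ℝ → Vec d) : Prop :=
  ∀ τ ∈ Ico 0 T, ∀ (ξ : Vec d) (η : ℝ → Vec d), IsMemory τ η →
    ∃ (u : ℝ → Vec m) (w : ℝ → Vec d), ContinuousOn u (Icc τ T) ∧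
      IsAdmissible T A N B τ ξ η u w ∧
      IsLeast (costValues T A N B C y τ ξ η) (cost T C y τ u w) ∧
      (∀ (v : ℝ → Vec m) (z : ℝ → Vec d), IsAdmissible T A N B τ ξ η v z →
        IsLeast (costValues T A N B C y τ ξ η) (cost T C y τ v z) →
        v =ᵐ[volume.restrict (Ioc τ T)] u) ∧
      ∀ t ∈ Icc τ T, u t = -((B†) (P₀ t (w t) + (∫ s in (0 : ℝ)..τ, P₁ s t (η s))
        + (∫ s in τ..t, P₁ s t (w s)) + d₁ t))

/-- The linear backward system for `d₁, d₂`; dots are derivatives with respect to `τ`, one-sided at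
the end points. -/
structure SolvesSignalSystem (T : ℝ) (A : Vec d →L[ℝ] Vec d) (N : ℝ → Vec d →L[ℝ] Vec d)
    (B : Vec m →L[ℝ] Vec d) (C : Vec d →L[ℝ] Vec p) (y : ℝ → Vec p)
    (P₀ : ℝ → Vec d →L[ℝ] Vec d) (P₁ : ℝ → ℝ → Vec d →L[ℝ] Vec d)
    (d₁ : ℝ → Vec d) (d₂ : ℝ → ℝ → Vec d) : Prop where
  d₁_eq : ∀ τ ∈ Icc 0 T, ∃ v : Vec d, HasDerivWithinAt d₁ v (Icc 0 T) τ ∧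
    v + (A† - P₀ τ ∘L B ∘L B†) (d₁ τ) + d₂ τ τ - (C†) (y τ) = 0
  d₁_final : d₁ T = 0
  d₂_eq : ∀ s τ, (s, τ) ∈ triangle T →
    ∃ v : Vec d, HasDerivWithinAt (fun r => d₂ s r) v (Icc s T) τ ∧
      v + ((N (τ - s))†) (d₁ τ) - ((P₁ s τ)† ∘L B ∘L B†) (d₁ τ) = 0
  d₂_final : ∀ s ∈ Icc 0 T, d₂ s T = 0

/-- The equation `Ṁ = ‖B* d₁‖² - ‖y‖²`, `M(T) = 0`. -/
structure SolvesScalarEquation (T : ℝ) (B : Vec m →L[ℝ] Vec d) (y : ℝ → Vec p)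
    (d₁ : ℝ → Vec d) (M : ℝ → ℝ) : Prop where
  M_eq : ∀ τ ∈ Icc 0 T,
    HasDerivWithinAt M (‖(B†) (d₁ τ)‖ ^ 2 - ‖y τ‖ ^ 2) (Icc 0 T) τ
  M_final : M T = 0

end

end MemoryTracking

/-! A state at time t consists of a present vector and a memory on [0, t]. Both are recorded over
one index set, the disjoint union of a point `present` and the interval [0, T]. Then P₀, P₁, P₂ are
blocks of a single operator kernel P(t) on pairs of indices, and d₁, d₂ are blocks of a single
vector kernel d(t). Memory is indexed by absolute time over all of [0, T], and N is extended by its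
end values. This turns the Riccati system on a moving domain into an ordinary differential equation
in a fixed Banach space of continuous kernels. Blocks at past times later than t are never paired
with a state of the tracking problem at time t.

Solvability (`exists_solvesRiccati`). The Riccati field is quadratic, hence Lipschitz on balls, so
an a priori bound is enough. A solution on [τ, T] gives the value of the problem with zero signal.
Its quadratic form therefore lies between 0 and the cost of the zero control, which Grönwall bounds
independently of τ (`dataValue_mem_Icc`). Testing with states concentrated on two indices and
changing a sign bounds each P(k, l) (`SolvesRiccati.norm_apply_le`). This is why memories are vector
measures here and not only L² functions. The equation for d is affine, and M is a primitive.

Verification (`exists_optimal`). Let the costate p be P applied to the state, plus d, and close the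
loop with u = -B* p(present). The equations for P and d say exactly that p solves the adjoint system
with p(T) = 0 (`hasDerivWithinAt_costate`), and the quadratic polynomial in the state decreases at
the rate of the running cost (`hasDerivWithinAt_stateValue`). Pairing the adjoint system with the
difference of two trajectories removes the cross term in the cost (`integral_inner_control_eq`).
Hence, if z is the trajectory of v and w that of u, the cost of v exceeds that of u by ∫‖C(z - w)‖²
+ ∫‖v - u‖². Minimality, the value, and uniqueness of the control all follow.

Arbitrary coefficients. The value function determines P₀, P₁, d₁, d₂, M on their domains: compare
the parts of each degree in ξ and η and use continuity (`IsValueRepresentation.unique`). So any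
coefficients inherit the feedback law and the equations from the constructed ones. -/

namespace MemoryTracking

/-! ### Global solutions of differential equations in Banach spaces -/

section ODE

open scoped NNReal

variable {E : Type*} [NormedAddCommGroup E] [NormedSpace ℝ E]

/-- The radial retraction onto the closed ball of radius `R`. -/
noncomputable def radialClip (R : ℝ) (x : E) : E := (R / max R ‖x‖) • x

theorem radialClip_of_norm_le {R : ℝ} (hR : 0 < R) {x : E} (hx : ‖x‖ ≤ R) :
    radialClip R x = x := by
  rw [radialClip, max_eq_left hx, div_self hR.ne', one_smul]

theorem norm_radialClip_le {R : ℝ} (hR : 0 < R) (x : E) : ‖radialClip R x‖ ≤ R := by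
  have hm : 0 < max R ‖x‖ := lt_max_of_lt_left hR
  rw [radialClip, norm_smul, Real.norm_of_nonneg (by positivity), div_mul_eq_mul_div,
    div_le_iff₀ hm]
  gcongr
  exact le_max_right _ _

theorem norm_radialClip_le_norm {R : ℝ} (hR : 0 < R) (x : E) : ‖radialClip R x‖ ≤ ‖x‖ := by
  have hm : 0 < max R ‖x‖ := lt_max_of_lt_left hR
  rw [radialClip, norm_smul, Real.norm_of_nonneg (by positivity)]
  exact mul_le_of_le_one_left (norm_nonneg _) ((div_le_one hm).2 (le_max_left _ _))

/-- The difference splits into a scaled copy of x - y and a change of the scaling factor applied to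
y. Each is at most ‖x - y‖, whence the constant 2. -/
theorem lipschitzWith_radialClip {R : ℝ} (hR : 0 < R) :
    LipschitzWith 2 (radialClip R : E → E) := by
  refine LipschitzWith.of_dist_le_mul fun x y => ?_
  rw [dist_eq_norm, dist_eq_norm]
  have hx : 0 < max R ‖x‖ := lt_max_of_lt_left hR
  have hy : 0 < max R ‖y‖ := lt_max_of_lt_left hR
  have h1 : radialClip R x - radialClip R y
      = (R / max R ‖x‖) • (x - y) + (R / max R ‖x‖ - R / max R ‖y‖) • y := by
    simp only [radialClip]; module
  have hle : R / max R ‖x‖ ≤ 1 := (div_le_one hx).2 (le_max_left _ _)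
  have h2 : ‖(R / max R ‖x‖) • (x - y)‖ ≤ ‖x - y‖ := by
    rw [norm_smul, Real.norm_of_nonneg (by positivity)]
    exact mul_le_of_le_one_left (norm_nonneg _) hle
  have h3 : ‖(R / max R ‖x‖ - R / max R ‖y‖) • y‖ ≤ ‖x - y‖ := by
    have e : R / max R ‖x‖ - R / max R ‖y‖
        = (R / max R ‖x‖) * ((max R ‖y‖ - max R ‖x‖) / max R ‖y‖) := by
      field_simp
    have h4 : |max R ‖y‖ - max R ‖x‖| ≤ ‖x - y‖ := by
      rw [norm_sub_rev]
      refine le_trans ?_ (abs_norm_sub_norm_le y x)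
      have := abs_max_sub_max_le_abs ‖y‖ ‖x‖ R
      rwa [max_comm R, max_comm R]
    rw [norm_smul, Real.norm_eq_abs, e, abs_mul, abs_of_nonneg (by positivity : 0 ≤ R / max R ‖x‖),
      abs_div, abs_of_pos hy, mul_assoc]
    calc R / max R ‖x‖ * (|max R ‖y‖ - max R ‖x‖| / max R ‖y‖ * ‖y‖)
        ≤ 1 * (‖x - y‖ / max R ‖y‖ * max R ‖y‖) := by
          gcongr
          exact le_max_right _ _
      _ = ‖x - y‖ := by field_simp
  rw [h1]
  calc _ ≤ _ := norm_add_le _ _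
    _ ≤ ‖x - y‖ + ‖x - y‖ := add_le_add h2 h3
    _ = _ := by push_cast; ring

variable [CompleteSpace E]

/-- A globally Lipschitz differential equation has a solution on the whole interval, which obeys the
Grönwall bound. -/
theorem exists_hasDerivWithinAt_Icc_of_lipschitzWith {F : ℝ → E → E} {a b c : ℝ} {K : ℝ≥0}
    (hab : a ≤ b) (hF : ∀ t ∈ Icc a b, LipschitzWith K (F t))
    (hcont : ∀ x, ContinuousOn (fun t => F t x) (Icc a b))
    (hc : ∀ t ∈ Icc a b, ‖F t 0‖ ≤ c) (x₀ : E) :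
    ∃ x : ℝ → E, x a = x₀ ∧ (∀ t ∈ Icc a b, HasDerivWithinAt x (F t (x t)) (Icc a b) t) ∧
      ∀ t ∈ Icc a b, ‖x t‖ ≤ gronwallBound ‖x₀‖ K c (b - a) := by
  have hc0 : 0 ≤ c := (norm_nonneg _).trans (hc a (left_mem_Icc.2 hab))
  -- Clipping at a radius above the Grönwall bound makes the field bounded without affecting the
  -- solution; the extra 1 keeps R positive.
  set R : ℝ := gronwallBound ‖x₀‖ K c (b - a) + 1 with hR
  have hmono := gronwallBound_mono (norm_nonneg x₀) hc0 K.coe_nonneg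
  have hR0 : 0 < R := by
    have h1 := hmono (sub_nonneg.2 hab)
    rw [gronwallBound_x0] at h1
    have := norm_nonneg x₀
    linarith
  have hgrow : ∀ t ∈ Icc a b, ∀ x, ‖F t x‖ ≤ K * ‖x‖ + c := fun t ht x => by
    have h1 := (hF t ht).dist_le_mul x 0
    rw [dist_eq_norm, dist_zero_right] at h1
    calc ‖F t x‖ = ‖(F t x - F t 0) + F t 0‖ := by rw [sub_add_cancel]
      _ ≤ _ := norm_add_le _ _
      _ ≤ _ := add_le_add h1 (hc t ht)
  have hL : 0 ≤ K * R + c := by positivity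
  have hba : 0 ≤ b - a := sub_nonneg.2 hab
  -- The clipped field is bounded by K R + c, so a ball of radius (K R + c)(b - a) cannot be left in
  -- time b - a, and Picard–Lindelöf covers the whole interval.
  have hPL : IsPicardLindelof (fun t x => F t (radialClip R x))
      (⟨a, left_mem_Icc.2 hab⟩ : Icc a b) x₀ (⟨(K * R + c) * (b - a), by positivity⟩) 0
      ⟨K * R + c, hL⟩ (K * 2) := by
    refine ⟨fun t ht => ?_, fun x _ => hcont _, fun t ht x _ => ?_, ?_⟩
    · exact ((hF t ht).comp (lipschitzWith_radialClip hR0)).lipschitzOnWith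
    · refine (hgrow t ht _).trans ?_
      show _ ≤ K * R + c
      gcongr
      exact norm_radialClip_le hR0 x
    · simp only [sub_self, NNReal.coe_zero, sub_zero]
      rw [max_eq_left hba]
      exact le_rfl
  obtain ⟨x, hx0, hx⟩ := hPL.exists_eq_forall_mem_Icc_hasDerivWithinAt₀
  -- Clipping does not increase norms, so the clipped equation obeys the same Grönwall bound and the
  -- clip is inactive along its solution.
  have hbd : ∀ t ∈ Icc a b, ‖x t‖ ≤ gronwallBound ‖x₀‖ K c (b - a) := fun t ht => by
    refine le_trans (norm_le_gronwallBound_of_norm_deriv_right_le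
      (f' := fun t => F t (radialClip R (x t))) (δ := ‖x₀‖) (K := K) (ε := c)
      (fun s hs => (hx s hs).continuousWithinAt) (fun s hs => ?_) (by rw [← hx0])
      (fun s hs => ?_) t ht) (hmono (by linarith [ht.2]))
    · exact (hx s (Ico_subset_Icc_self hs)).mono_of_mem_nhdsWithin (Icc_mem_nhdsGE_of_mem hs)
    · refine (hgrow s (Ico_subset_Icc_self hs) _).trans ?_
      gcongr
      exact norm_radialClip_le_norm hR0 _
  refine ⟨x, hx0, fun t ht => ?_, hbd⟩
  have := hx t ht
  rwa [radialClip_of_norm_le hR0 (by linarith [hbd t ht])] at this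

/-- A globally Lipschitz differential equation has a solution with prescribed final value. -/
theorem exists_hasDerivWithinAt_Icc_of_lipschitzWith_final {F : ℝ → E → E} {a b : ℝ} {K : ℝ≥0}
    (hab : a ≤ b) (hF : ∀ t ∈ Icc a b, LipschitzWith K (F t))
    (hcont : ∀ x, ContinuousOn (fun t => F t x) (Icc a b)) (x₀ : E) :
    ∃ x : ℝ → E, x b = x₀ ∧ ∀ t ∈ Icc a b, HasDerivWithinAt x (F t (x t)) (Icc a b) t := by
  have hmaps : MapsTo (fun t => a + b - t) (Icc a b) (Icc a b) := fun t ht =>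
    ⟨by linarith [ht.2], by linarith [ht.1]⟩
  obtain ⟨c, hc⟩ := isCompact_Icc.exists_bound_of_continuousOn (hcont 0)
  obtain ⟨x, hx0, hx, -⟩ := exists_hasDerivWithinAt_Icc_of_lipschitzWith
    (F := fun t x => -F (a + b - t) x) (K := K) (c := c) hab
    (fun t ht => (hF _ (hmaps ht)).neg)
    (fun x => ((hcont x).comp (by fun_prop) hmaps).neg)
    (fun t ht => by rw [norm_neg]; exact hc _ (hmaps ht)) x₀
  refine ⟨fun t => x (a + b - t), by simp [hx0], fun t ht => ?_⟩
  have h1 := (hx _ (hmaps ht)).scomp t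
    (((hasDerivAt_id t).const_sub (a + b)).hasDerivWithinAt (s := Icc a b)) hmaps
  simpa [Function.comp_def] using h1

/-- A differential equation which is Lipschitz on balls and whose solutions with final value `0`
are bounded a priori has such a solution on the whole interval. -/
theorem exists_hasDerivWithinAt_Icc_of_apriori_bound {F : ℝ → E → E} {a b R : ℝ} {K : ℝ≥0}
    (hab : a ≤ b) (hR : 0 ≤ R)
    (hF : ∀ t ∈ Icc a b, ∀ x y, ‖x‖ ≤ R + 1 → ‖y‖ ≤ R + 1 → ‖F t x - F t y‖ ≤ K * ‖x - y‖)
    (hcont : ∀ x, ContinuousOn (fun t => F t x) (Icc a b))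
    (hap : ∀ (x : ℝ → E) (c : ℝ), c ∈ Icc a b → x b = 0 →
      (∀ t ∈ Icc c b, HasDerivWithinAt x (F t (x t)) (Icc c b) t) → ‖x c‖ ≤ R) :
    ∃ x : ℝ → E, x b = 0 ∧ ∀ t ∈ Icc a b, HasDerivWithinAt x (F t (x t)) (Icc a b) t := by
  have hR1 : 0 < R + 1 := by linarith
  obtain ⟨x, hxb, hx⟩ := exists_hasDerivWithinAt_Icc_of_lipschitzWith_final
    (F := fun t x => F t (radialClip (R + 1) x)) (K := K * 2) hab (fun t ht => by
      refine LipschitzWith.of_dist_le_mul fun x y => ?_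
      have h1 := (lipschitzWith_radialClip (E := E) hR1).dist_le_mul x y
      rw [dist_eq_norm, dist_eq_norm] at h1 ⊢
      refine (hF t ht _ _ (norm_radialClip_le hR1 x) (norm_radialClip_le hR1 y)).trans ?_
      rw [NNReal.coe_mul, mul_assoc]
      gcongr) (fun x => hcont _) 0
  have hxc : ContinuousOn (fun t => ‖x t‖) (Icc a b) := fun t ht =>
    (hx t ht).continuousWithinAt.norm
  have hbd : ∀ t ∈ Icc a b, ‖x t‖ ≤ R + 1 := by
    by_contra! hcon
    obtain ⟨t₀, ht₀, hlt⟩ := hcon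
    -- Let c be the last time at which the norm is at least R + 1. On [c, b] the clip is inactive,
    -- so the a priori bound gives ‖x c‖ ≤ R, a contradiction.
    set S := Icc a b ∩ (fun t => ‖x t‖) ⁻¹' Ici (R + 1) with hS
    have hSc : IsCompact S := isCompact_Icc.of_isClosed_subset
      (hxc.preimage_isClosed_of_isClosed isClosed_Icc isClosed_Ici) inter_subset_left
    obtain ⟨c, hcS, hcmax⟩ := hSc.exists_isGreatest ⟨t₀, ht₀, hlt.le⟩
    have hcb : c < b := lt_of_le_of_ne hcS.1.2 fun h => by
      have := hcS.2
      simp only [h, mem_preimage, hxb, norm_zero, mem_Ici] at this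
      linarith
    have hlt' : ∀ t ∈ Ioc c b, ‖x t‖ < R + 1 := fun t ht => by
      by_contra! h
      exact absurd (hcmax ⟨⟨hcS.1.1.trans ht.1.le, ht.2⟩, h⟩) (not_le.2 ht.1)
    have hsub : Icc c b ⊆ Icc a b := Icc_subset_Icc_left hcS.1.1
    have hle : ∀ t ∈ Icc c b, ‖x t‖ ≤ R + 1 := by
      have hcl : closure (Ioc c b) = Icc c b := closure_Ioc hcb.ne
      intro t ht
      rw [← hcl] at ht
      refine (isClosed_Iic (a := R + 1)).closure_subset_iff.2 ?_
        (ContinuousWithinAt.mem_closure_image (f := fun t => ‖x t‖) (s := Ioc c b) ?_ ht)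
      · rintro _ ⟨s, hs, rfl⟩
        exact (hlt' s hs).le
      · exact (hxc t (hsub (hcl ▸ ht))).mono (Ioc_subset_Icc_self.trans hsub)
    have := hap x c hcS.1 hxb fun t ht => by
      have h1 := (hx t (hsub ht)).mono hsub
      rwa [radialClip_of_norm_le hR1 (hle t ht)] at h1
    have h2 : R + 1 ≤ ‖x c‖ := hcS.2
    linarith
  refine ⟨x, hxb, fun t ht => ?_⟩
  have h1 := hx t ht
  rwa [radialClip_of_norm_le hR1 (hbd t ht)] at h1

end ODE

/-! ### Calculus on a compact interval -/

section Calculus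

open scoped NNReal

variable {E : Type*} [NormedAddCommGroup E]

theorem integral_eq_sub_of_hasDerivWithinAt_Icc [NormedSpace ℝ E] [CompleteSpace E]
    {f f' : ℝ → E} {a b : ℝ} (hab : a ≤ b)
    (hf : ∀ t ∈ Icc a b, HasDerivWithinAt f (f' t) (Icc a b) t) (hf' : ContinuousOn f' (Icc a b)) :
    ∫ t in a..b, f' t = f b - f a := by
  refine intervalIntegral.integral_eq_sub_of_hasDeriv_right_of_le hab
    (fun t ht => (hf t ht).continuousWithinAt) (fun t ht => ?_)
    (ContinuousOn.intervalIntegrable_of_Icc hab hf')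
  have h := hf t (Ioo_subset_Icc_self ht)
  exact (h.hasDerivAt (Icc_mem_nhds ht.1 ht.2)).hasDerivWithinAt

/-- The fundamental theorem of calculus within a compact interval. -/
theorem hasDerivWithinAt_integral_Icc [NormedSpace ℝ E] [CompleteSpace E] {f : ℝ → E} {a b t : ℝ}
    (hf : ContinuousOn f (Icc a b)) (ht : t ∈ Icc a b) :
    HasDerivWithinAt (fun r => ∫ s in a..r, f s) (f t) (Icc a b) t := by
  have hab : a ≤ b := ht.1.trans ht.2
  set g := IccExtend hab ((Icc a b).domRestrict f) with hg
  have hgc : Continuous g := (continuousOn_iff_continuous_domRestrict.1 hf).Icc_extend'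
  have hgf : ∀ s ∈ Icc a b, g s = f s := fun s hs => by
    simp [hg, IccExtend_of_mem _ _ hs, domRestrict_apply]
  have h := (hgc.integral_hasStrictDerivAt a t).hasDerivAt.hasDerivWithinAt (s := Icc a b)
  rw [hgf t ht] at h
  refine h.congr_of_mem (fun r hr => intervalIntegral.integral_congr fun s hs => ?_) ht
  rw [uIcc_of_le hr.1] at hs
  exact (hgf s ⟨hs.1, hs.2.trans hr.2⟩).symm

/-- A linear Volterra integro-differential equation with continuous coefficients has a solution,
which obeys a bound in terms of bounds for the coefficients. -/
theorem exists_hasDerivWithinAt_volterra [NormedSpace ℝ E] [CompleteSpace E] {a b c : ℝ}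
    {α β : ℝ≥0} (hab : a ≤ b) {A : ℝ → E →L[ℝ] E} {k : ℝ → ℝ → E →L[ℝ] E} {h : ℝ → E}
    (hA : ContinuousOn A (Icc a b)) (hk : Continuous fun q : ℝ × ℝ => k q.1 q.2)
    (hh : ContinuousOn h (Icc a b)) (hAα : ∀ t ∈ Icc a b, ‖A t‖ ≤ α)
    (hkβ : ∀ r ∈ Icc a b, ∀ s ∈ Icc a b, ‖k r s‖ ≤ β) (hhc : ∀ t ∈ Icc a b, ‖h t‖ ≤ c) (ξ : E) :
    ∃ w : ℝ → E, Continuous w ∧ w a = ξ ∧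
      (∀ t ∈ Icc a b, HasDerivWithinAt w (A t (w t) + (∫ s in a..t, k t s (w s)) + h t)
        (Icc a b) t) ∧
      ∀ t, ‖w t‖ ≤ gronwallBound ‖ξ‖ (α + 1 + β) c (b - a) := by
  -- The memory term becomes an unknown of its own: the function r ↦ ∫ k(r, s) w(s) ds over s from a
  -- to t has time derivative r ↦ k(r, t) w(t). The integral in the equation is its value at r = t,
  -- so the pair solves a differential equation without memory.
  let G : ℝ → E → C(Icc a b, E) := fun t w =>
    ⟨fun r => k r t w, by
      have : Continuous fun r : Icc a b => k r t := hk.comp (by fun_prop : Continuous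
        fun r : Icc a b => ((r : ℝ), t))
      fun_prop⟩
  let F : ℝ → E × C(Icc a b, E) → E × C(Icc a b, E) := fun t x =>
    (A t x.1 + x.2 (projIcc a b hab t) + h t, G t x.1)
  have hc0 : 0 ≤ c := (norm_nonneg _).trans (hhc a (left_mem_Icc.2 hab))
  -- The summands come from A, from evaluation of the second component, and from k.
  have hlip : ∀ t ∈ Icc a b, LipschitzWith (α + 1 + β) (F t) := by
    intro t ht
    refine LipschitzWith.of_dist_le_mul fun x y => ?_
    rw [dist_eq_norm, dist_eq_norm]
    have hfst := norm_fst_le (x - y)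
    have hsnd := norm_snd_le (x - y)
    have e : F t x - F t y = (A t (x - y).1 + (x - y).2 (projIcc a b hab t), G t (x - y).1) := by
      refine Prod.ext ?_ ?_
      · simp only [F, Prod.fst_sub, Prod.snd_sub, map_sub, ContinuousMap.sub_apply]
        abel
      · ext r
        simp [F, G]
    rw [e, Prod.norm_def]
    refine max_le ?_ ?_
    · calc ‖A t (x - y).1 + (x - y).2 (projIcc a b hab t)‖
          ≤ ‖A t (x - y).1‖ + ‖(x - y).2 (projIcc a b hab t)‖ := norm_add_le _ _
        _ ≤ α * ‖x - y‖ + ‖x - y‖ := by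
          gcongr
          · exact (A t).le_of_opNorm_le_of_le (hAα t ht) hfst
          · exact ((x - y).2.norm_coe_le_norm _).trans hsnd
        _ ≤ ((α + 1 + β : ℝ≥0) : ℝ) * ‖x - y‖ := by
          push_cast
          nlinarith [norm_nonneg (x - y), β.coe_nonneg, mul_nonneg β.coe_nonneg (norm_nonneg (x - y))]
    · refine (ContinuousMap.norm_le _ (by positivity)).2 fun r => ?_
      calc ‖k r t (x - y).1‖ ≤ β * ‖x - y‖ := (k r t).le_of_opNorm_le_of_le (hkβ r r.2 t ht) hfst
        _ ≤ ((α + 1 + β : ℝ≥0) : ℝ) * ‖x - y‖ := by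
          push_cast
          nlinarith [norm_nonneg (x - y), mul_nonneg α.coe_nonneg (norm_nonneg (x - y))]
  have hcts : ∀ x, ContinuousOn (fun t => F t x) (Icc a b) := by
    intro x
    refine ContinuousOn.prodMk ?_ ?_
    · refine ((hA.clm_apply continuousOn_const).add ?_).add hh
      exact (x.2.continuous.comp continuous_projIcc).continuousOn
    · refine (ContinuousMap.continuous_of_continuous_uncurry _ ?_).continuousOn
      have h1 : Continuous fun q : ℝ × Icc a b => k q.2 q.1 :=
        hk.comp (by fun_prop : Continuous fun q : ℝ × Icc a b => ((q.2 : ℝ), q.1))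
      exact h1.clm_apply continuous_const
  have hzero : ∀ t ∈ Icc a b, ‖F t 0‖ ≤ c := by
    intro t ht
    rw [Prod.norm_def]
    refine max_le ?_ ?_
    · simpa [F] using hhc t ht
    · have : G t 0 = 0 := by ext r; simp [G]
      simpa [F, this] using hc0
  obtain ⟨x, hx0, hx, hbd⟩ := exists_hasDerivWithinAt_Icc_of_lipschitzWith hab hlip hcts hzero (ξ, 0)
  have hx1 : ∀ t ∈ Icc a b, HasDerivWithinAt (fun t => (x t).1) (F t (x t)).1 (Icc a b) t :=
    fun t ht => (hx t ht).fst
  have hc1 : ContinuousOn (fun t => (x t).1) (Icc a b) := fun t ht =>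
    (hx1 t ht).continuousWithinAt
  have hx2 : ∀ t ∈ Icc a b, (x t).2 (projIcc a b hab t) = ∫ s in a..t, k t s (x s).1 := by
    intro t ht
    have hsub : Icc a t ⊆ Icc a b := Icc_subset_Icc_right ht.2
    have h2 : ∀ s ∈ Icc a t, HasDerivWithinAt (fun s => (x s).2 (projIcc a b hab t))
        (k t s (x s).1) (Icc a t) s := fun s hs => by
      have h3 := ((ContinuousMap.evalCLM ℝ (projIcc a b hab t)).hasFDerivAt
        (x := (x s).2)).comp_hasDerivWithinAt s (hx s (hsub hs)).snd
      have h4 := h3.mono hsub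
      simpa [Function.comp_def, F, G, projIcc_of_mem hab ht] using h4
    rw [integral_eq_sub_of_hasDerivWithinAt_Icc ht.1 h2]
    · simp [hx0]
    · have h5 : ContinuousOn (fun s => k t s) (Icc a t) :=
        (hk.comp (by fun_prop : Continuous fun s : ℝ => (t, s))).continuousOn
      exact h5.clm_apply (hc1.mono hsub)
  have hext : ∀ t ∈ Icc a b, IccExtend hab ((Icc a b).domRestrict fun t => (x t).1) t = (x t).1 :=
    fun t ht => by simp [IccExtend_of_mem _ _ ht, domRestrict_apply]
  refine ⟨IccExtend hab ((Icc a b).domRestrict fun t => (x t).1),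
    (continuousOn_iff_continuous_domRestrict.1 hc1).Icc_extend', ?_, fun t ht => ?_, fun t => ?_⟩
  · rw [hext a (left_mem_Icc.2 hab), hx0]
  · refine ((hx1 t ht).congr_of_mem hext ht).congr_deriv ?_
    rw [hext t ht]
    simp only [F]
    rw [hx2 t ht]
    congr 2
    refine intervalIntegral.integral_congr fun s hs => ?_
    rw [uIcc_of_le ht.1] at hs
    rw [hext s ⟨hs.1, hs.2.trans ht.2⟩]
  · have h1 := hbd _ (projIcc a b hab t).2
    have h2 : ‖((ξ, 0) : E × C(Icc a b, E))‖ = ‖ξ‖ := by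
      rw [Prod.norm_mk, norm_zero, max_eq_left (norm_nonneg _)]
    rw [h2] at h1
    simp only [IccExtend, Function.comp_apply, domRestrict_apply]
    exact (norm_fst_le _).trans (by simpa using h1)

theorem intervalIntegrable_inner_of_continuousOn [InnerProductSpace ℝ E] {a b : ℝ} (hab : a ≤ b)
    {g p : ℝ → E} (hg : IntervalIntegrable g volume a b) (hp : ContinuousOn p (Icc a b)) :
    IntervalIntegrable (fun t => (inner ℝ (g t) (p t) : ℝ)) volume a b := by
  refine (intervalIntegrable_iff_integrableOn_Ioc_of_le hab).2 ?_
  obtain ⟨c, hc⟩ := isCompact_Icc.exists_bound_of_continuousOn hp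
  refine (hg.1.norm.mul_const c).mono
    (hg.1.aestronglyMeasurable.inner ((hp.mono Ioc_subset_Icc_self).aestronglyMeasurable
      measurableSet_Ioc)) ?_
  filter_upwards [ae_restrict_mem measurableSet_Ioc] with t ht
  have hct := hc t (Ioc_subset_Icc_self ht)
  calc ‖(inner ℝ (g t) (p t) : ℝ)‖ ≤ ‖g t‖ * ‖p t‖ := norm_inner_le_norm _ _
    _ ≤ ‖g t‖ * c := by gcongr
    _ ≤ ‖‖g t‖ * c‖ := le_abs_self _

/-- Integration by parts for a `C¹` function and a primitive of an integrable function. -/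
theorem integral_inner_add_inner_primitive [InnerProductSpace ℝ E] [CompleteSpace E]
    {a b : ℝ} (hab : a ≤ b) {p p' g : ℝ → E}
    (hp : ∀ t ∈ Icc a b, HasDerivWithinAt p (p' t) (Icc a b) t)
    (hp' : ContinuousOn p' (Icc a b)) (hg : IntervalIntegrable g volume a b) :
    ∫ t in a..b, (inner ℝ (g t) (p t) + inner ℝ (∫ s in a..t, g s) (p' t))
      = inner ℝ (∫ t in a..b, g t) (p b) := by
  have hpc : ContinuousOn p (Icc a b) := fun t ht => (hp t ht).continuousWithinAt
  have hgi : Integrable g (volume.restrict (Ioc a b)) := hg.1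
  have hp'i : Integrable p' (volume.restrict (Ioc a b)) :=
    (ContinuousOn.intervalIntegrable_of_Icc hab hp').1
  have hprod : Integrable (fun q : ℝ × ℝ => inner ℝ (g q.1) (p' q.2))
      ((volume.restrict (Ioc a b)).prod (volume.restrict (Ioc a b))) :=
    hgi.op_fst_snd (op := fun x y => inner ℝ x y) continuous_inner
      ⟨1, fun x y => by simpa using norm_inner_le_norm (𝕜 := ℝ) x y⟩ hp'i
  have hmeas : MeasurableSet {q : ℝ × ℝ | q.1 ≤ q.2} := measurableSet_le measurable_fst measurable_snd
  -- Since g is merely integrable, the product rule is replaced by Fubini on the triangle s ≤ t.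
  have hswap := integral_integral_swap
    (f := fun s t => {q : ℝ × ℝ | q.1 ≤ q.2}.indicator
      (fun q : ℝ × ℝ => inner ℝ (g q.1) (p' q.2)) (s, t)) (hprod.indicator hmeas)
  have h1 : ∀ t ∈ Ioc a b, ∫ s in Ioc a b, {q : ℝ × ℝ | q.1 ≤ q.2}.indicator
      (fun q : ℝ × ℝ => (inner ℝ (g q.1) (p' q.2) : ℝ)) (s, t)
        = inner ℝ (∫ s in a..t, g s) (p' t) := by
    intro t ht
    have e : (fun s => {q : ℝ × ℝ | q.1 ≤ q.2}.indicator
        (fun q : ℝ × ℝ => (inner ℝ (g q.1) (p' q.2) : ℝ)) (s, t))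
        = (Iic t).indicator (fun s => inner ℝ (g s) (p' t)) := by
      funext s; simp [indicator]
    rw [e, setIntegral_indicator measurableSet_Iic, Ioc_inter_Iic, min_eq_right ht.2,
      intervalIntegral.integral_of_le ht.1.le]
    simp_rw [real_inner_comm (p' t)]
    rw [integral_inner]
    exact hgi.mono_measure (Measure.restrict_mono (Ioc_subset_Ioc_right ht.2) le_rfl)
  have h2 : ∀ s ∈ Ioc a b, ∫ t in Ioc a b, {q : ℝ × ℝ | q.1 ≤ q.2}.indicator
      (fun q : ℝ × ℝ => (inner ℝ (g q.1) (p' q.2) : ℝ)) (s, t)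
        = inner ℝ (g s) (p b) - inner ℝ (g s) (p s) := by
    intro s hs
    have e : (fun t => {q : ℝ × ℝ | q.1 ≤ q.2}.indicator
        (fun q : ℝ × ℝ => (inner ℝ (g q.1) (p' q.2) : ℝ)) (s, t))
        = (Ici s).indicator (fun t => inner ℝ (g s) (p' t)) := by
      funext t; simp [indicator]
    have hsub : Icc s b ⊆ Icc a b := Icc_subset_Icc_left hs.1.le
    have e2 : Ioc a b ∩ Ici s = Icc s b := by
      ext t; simp only [mem_inter_iff, mem_Ioc, mem_Ici, mem_Icc]
      exact ⟨fun h => ⟨h.2, h.1.2⟩, fun h => ⟨⟨hs.1.trans_le h.1, h.2⟩, h.1⟩⟩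
    rw [e, setIntegral_indicator measurableSet_Ici, e2, integral_Icc_eq_integral_Ioc, integral_inner,
      ← intervalIntegral.integral_of_le hs.2,
      integral_eq_sub_of_hasDerivWithinAt_Icc hs.2 (fun t ht => (hp t (hsub ht)).mono hsub)
        (hp'.mono hsub), inner_sub_right]
    exact ((hp'.mono hsub).integrableOn_Icc).mono_set Ioc_subset_Icc_self
  have hi1 : IntervalIntegrable (fun t => (inner ℝ (g t) (p t) : ℝ)) volume a b :=
    intervalIntegrable_inner_of_continuousOn hab hg hpc
  have hi2 : IntervalIntegrable (fun t => (inner ℝ (∫ s in a..t, g s) (p' t) : ℝ)) volume a b := by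
    refine ContinuousOn.intervalIntegrable_of_Icc hab (ContinuousOn.inner ?_ hp')
    have := intervalIntegral.continuousOn_primitive_interval' (a := a) hg left_mem_uIcc
    rwa [uIcc_of_le hab] at this
  have hi3 : IntervalIntegrable (fun t => (inner ℝ (g t) (p b) : ℝ)) volume a b :=
    (intervalIntegrable_iff_integrableOn_Ioc_of_le hab).2 (hgi.inner_const (p b))
  rw [intervalIntegral.integral_add hi1 hi2]
  have e1 : ∫ t in a..b, (inner ℝ (∫ s in a..t, g s) (p' t) : ℝ)
      = ∫ t in a..b, ((inner ℝ (g t) (p b) : ℝ) - inner ℝ (g t) (p t)) := by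
    rw [intervalIntegral.integral_of_le hab, intervalIntegral.integral_of_le hab,
      ← setIntegral_congr_fun measurableSet_Ioc h1, ← setIntegral_congr_fun measurableSet_Ioc h2,
      hswap]
  rw [e1, intervalIntegral.integral_sub hi3 hi1, add_sub_cancel]
  simp_rw [real_inner_comm (p b)]
  rw [intervalIntegral.integral_of_le hab, integral_inner hgi, ← intervalIntegral.integral_of_le hab]

end Calculus

/-! ### States with memory and their pairing with kernels -/

section Pairing

open Filter Topology

variable {T : ℝ} {E F F' : Type*} [NormedAddCommGroup E] [NormedSpace ℝ E]
  [NormedAddCommGroup F] [NormedSpace ℝ F] [NormedAddCommGroup F'] [NormedSpace ℝ F']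

/-- `HasDerivWithinAt` for functions with values in a normed space, such as a space of continuous
functions with its supremum norm. -/
abbrev HasNormDerivWithinAt {G : Type*} [NormedAddCommGroup G] [NormedSpace ℝ G] (f : ℝ → G)
    (f' : G) (s : Set ℝ) (t : ℝ) : Prop :=
  HasDerivWithinAt f f' s t

/-- The index set of the components of a state: the present and the times in `[0, T]`. -/
abbrev KernelIndex (T : ℝ) : Type := Unit ⊕ Icc (0 : ℝ) T

/-- The index of the present component of a state. -/
abbrev present : KernelIndex T := Sum.inl ()

/-- The index of the memory at time `s`, where `s` is projected to `[0, T]`. -/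
noncomputable def past (hT : 0 ≤ T) (s : ℝ) : KernelIndex T := Sum.inr (projIcc 0 T hT s)

theorem continuous_past (hT : 0 ≤ T) : Continuous (past hT) :=
  continuous_inr.comp continuous_projIcc

/-- A memory: a vector measure of the form `η ν`, transported to `[0, T]` by `κ`. -/
structure Memory (T : ℝ) (E : Type*) [NormedAddCommGroup E] where
  Ω : Type
  [measurableSpace : MeasurableSpace Ω]
  ν : Measure Ω
  κ : Ω → Icc (0 : ℝ) T
  η : Ω → E
  κ_measurable : Measurable κ
  η_integrable : Integrable η ν

attribute [instance] Memory.measurableSpace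

/-- The memory as a functional on kernels. -/
noncomputable def Memory.pair (m : Memory T E) (X : KernelIndex T → E →L[ℝ] F) : F :=
  ∫ ω, X (Sum.inr (m.κ ω)) (m.η ω) ∂m.ν

theorem Memory.integrable_pair (m : Memory T E) {X : KernelIndex T → E →L[ℝ] F}
    (hX : Continuous X) : Integrable (fun ω => X (Sum.inr (m.κ ω)) (m.η ω)) m.ν := by
  have hXr : Continuous fun s : Icc (0 : ℝ) T => X (Sum.inr s) := hX.comp continuous_inr
  obtain ⟨c, hc⟩ := isCompact_univ.exists_bound_of_continuousOn hXr.continuousOn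
  have hmeas : AEStronglyMeasurable (fun ω => X (Sum.inr (m.κ ω))) m.ν :=
    hXr.comp_aestronglyMeasurable m.κ_measurable.aestronglyMeasurable
  refine (m.η_integrable.norm.const_mul c).mono
    (isBoundedBilinearMap_apply.continuous.comp_aestronglyMeasurable
      (hmeas.prodMk m.η_integrable.aestronglyMeasurable)) (ae_of_all _ fun ω => ?_)
  calc ‖X (Sum.inr (m.κ ω)) (m.η ω)‖ ≤ c * ‖m.η ω‖ :=
        (X _).le_of_opNorm_le (hc _ (mem_univ _)) _
    _ ≤ ‖c * ‖m.η ω‖‖ := le_abs_self _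

theorem Memory.norm_pair_le (m : Memory T E) {X : KernelIndex T → E →L[ℝ] F} {c : ℝ}
    (hc : ∀ k, ‖X k‖ ≤ c) : ‖m.pair X‖ ≤ c * ∫ ω, ‖m.η ω‖ ∂m.ν := by
  rw [← integral_const_mul]
  exact norm_integral_le_of_norm_le (m.η_integrable.norm.const_mul c)
    (ae_of_all _ fun ω => (X _).le_of_opNorm_le (hc _) _)

theorem Memory.pair_add (m : Memory T E) {X Y : KernelIndex T → E →L[ℝ] F} (hX : Continuous X)
    (hY : Continuous Y) : m.pair (fun k => X k + Y k) = m.pair X + m.pair Y := by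
  simp only [Memory.pair, add_apply]
  exact integral_add (m.integrable_pair hX) (m.integrable_pair hY)

theorem Memory.pair_smul (m : Memory T E) (c : ℝ) (X : KernelIndex T → E →L[ℝ] F) :
    m.pair (fun k => c • X k) = c • m.pair X := by
  simp only [Memory.pair, smul_apply]
  exact integral_smul _ _

/-- `Memory.pair` as a bounded functional on continuous kernels. -/
noncomputable def Memory.pairCLM (m : Memory T E) : C(KernelIndex T, E →L[ℝ] F) →L[ℝ] F :=
  LinearMap.mkContinuous
    { toFun := fun Y : C(KernelIndex T, E →L[ℝ] F) => m.pair Y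
      map_add' := fun Y Z => m.pair_add Y.continuous Z.continuous
      map_smul' := fun c Y => m.pair_smul c Y } (∫ ω, ‖m.η ω‖ ∂m.ν) fun Y => by
        rw [mul_comm]
        exact m.norm_pair_le Y.norm_coe_le_norm

/-- The pairing of a kernel with the state at time `t` which consists of the present value `w t`,
the memory `m`, and the trajectory `w` on `[τ, t]`. -/
noncomputable def statePairing (hT : 0 ≤ T) (m : Memory T E) (w : ℝ → E) (τ t : ℝ)
    (X : KernelIndex T → E →L[ℝ] F) : F :=
  X present (w t) + m.pair X + ∫ s in τ..t, X (past hT s) (w s)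

variable {hT : 0 ≤ T} {m : Memory T E} {w : ℝ → E} {τ t : ℝ}

theorem continuous_apply_past (hw : Continuous w) {X : KernelIndex T → E →L[ℝ] F}
    (hX : Continuous X) : Continuous fun s => X (past hT s) (w s) :=
  (hX.comp (continuous_past hT)).clm_apply hw

theorem statePairing_add (hw : Continuous w) {X Y : KernelIndex T → E →L[ℝ] F} (hX : Continuous X)
    (hY : Continuous Y) : statePairing hT m w τ t (fun k => X k + Y k)
      = statePairing hT m w τ t X + statePairing hT m w τ t Y := by
  simp only [statePairing]
  rw [m.pair_add hX hY]
  simp only [add_apply]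
  rw [intervalIntegral.integral_add ((continuous_apply_past hw hX).intervalIntegrable _ _)
    ((continuous_apply_past hw hY).intervalIntegrable _ _)]
  abel

theorem statePairing_smul (c : ℝ) (X : KernelIndex T → E →L[ℝ] F) :
    statePairing hT m w τ t (fun k => c • X k) = c • statePairing hT m w τ t X := by
  simp only [statePairing]
  rw [m.pair_smul]
  simp only [smul_apply]
  rw [intervalIntegral.integral_smul]
  module

theorem statePairing_neg (X : KernelIndex T → E →L[ℝ] F) :
    statePairing hT m w τ t (fun k => -X k) = -statePairing hT m w τ t X := by
  simpa using statePairing_smul (hT := hT) (m := m) (w := w) (τ := τ) (t := t) (-1) X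

theorem statePairing_sub (hw : Continuous w) {X Y : KernelIndex T → E →L[ℝ] F} (hX : Continuous X)
    (hY : Continuous Y) : statePairing hT m w τ t (fun k => X k - Y k)
      = statePairing hT m w τ t X - statePairing hT m w τ t Y := by
  simp only [sub_eq_add_neg]
  rw [statePairing_add (Y := fun k => -Y k) hw hX hY.neg, statePairing_neg]

theorem statePairing_comp [CompleteSpace F] [CompleteSpace F'] (hw : Continuous w)
    {X : KernelIndex T → E →L[ℝ] F} (hX : Continuous X) (L : F →L[ℝ] F') :
    statePairing hT m w τ t (fun k => L ∘L X k) = L (statePairing hT m w τ t X) := by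
  simp only [statePairing, Memory.pair, ContinuousLinearMap.comp_apply, map_add]
  rw [L.integral_comp_comm (m.integrable_pair hX),
    L.intervalIntegral_comp_comm ((continuous_apply_past hw hX).intervalIntegrable _ _)]

/-- A kernel which is supported in the present. -/
theorem statePairing_eq_of_past_eq_zero {X : KernelIndex T → E →L[ℝ] F}
    (hX : ∀ s, X (Sum.inr s) = 0) : statePairing hT m w τ t X = X present (w t) := by
  simp [statePairing, Memory.pair, past, hX]

/-- Time enters through the kernel and through the upper limit. Writing X r as X t + (X r - X t)
separates the two: the first part falls under the fundamental theorem of calculus, the second uses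
differentiability of X in the supremum norm. The boundary term arises because the present value at
time t enters the memory. -/
theorem hasDerivWithinAt_integral_past [CompleteSpace F] (hw : Continuous w) {a b : ℝ}
    (ht : t ∈ Icc a b) {X : ℝ → C(KernelIndex T, E →L[ℝ] F)} {X' : C(KernelIndex T, E →L[ℝ] F)}
    (hX : HasNormDerivWithinAt X X' (Icc a b) t) :
    HasDerivWithinAt (fun r => ∫ s in a..r, X r (past hT s) (w s))
      ((∫ s in a..t, X' (past hT s) (w s)) + X t (past hT t) (w t)) (Icc a b) t := by
  have hint : ∀ (Y : C(KernelIndex T, E →L[ℝ] F)) (r : ℝ),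
      IntervalIntegrable (fun s => Y (past hT s) (w s)) volume a r := fun Y r =>
    (continuous_apply_past hw Y.continuous).intervalIntegrable _ _
  have h1 : HasDerivWithinAt (fun r => ∫ s in a..r, X t (past hT s) (w s))
      (X t (past hT t) (w t)) (Icc a b) t :=
    hasDerivWithinAt_integral_Icc (continuous_apply_past hw (X t).continuous).continuousOn ht
  obtain ⟨c, hc⟩ := isCompact_Icc.exists_bound_of_continuousOn (hw.continuousOn (s := Icc a b))
  have hbd : ∀ (Y : C(KernelIndex T, E →L[ℝ] F)), ∀ r ∈ Icc a b,
      ‖∫ s in a..r, Y (past hT s) (w s)‖ ≤ ‖Y‖ * c * (b - a) := fun Y r hr => by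
    have hc0 : 0 ≤ c := (norm_nonneg _).trans (hc t ht)
    refine (intervalIntegral.norm_integral_le_of_norm_le_const (C := ‖Y‖ * c) fun s hs => ?_).trans ?_
    · rw [uIoc_of_le hr.1] at hs
      exact (Y _).le_of_opNorm_le_of_le (Y.norm_coe_le_norm _) (hc s ⟨hs.1.le, hs.2.trans hr.2⟩)
    · rw [abs_of_nonneg (by linarith [hr.1])]
      gcongr
      exact hr.2
  have h2 : HasDerivWithinAt (fun r => ∫ s in a..r, (X r - X t) (past hT s) (w s))
      (∫ s in a..t, X' (past hT s) (w s)) (Icc a b) t := by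
    rw [HasNormDerivWithinAt, hasDerivWithinAt_iff_tendsto_slope] at hX
    rw [hasDerivWithinAt_iff_tendsto_slope]
    -- The integrand vanishes identically at r = t, so the slope of the integral is the integral of
    -- the slope despite the moving limit.
    have e : ∀ r, slope (fun r => ∫ s in a..r, (X r - X t) (past hT s) (w s)) t r
        = ∫ s in a..r, (slope X t r) (past hT s) (w s) := fun r => by
      simp only [slope, vsub_eq_sub, sub_self, ContinuousMap.zero_apply,
        zero_apply, intervalIntegral.integral_zero, sub_zero,
        ContinuousMap.smul_apply, smul_apply]
      rw [intervalIntegral.integral_smul]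
    refine Tendsto.congr (fun r => (e r).symm) ?_
    have h3 : ∀ r, ∫ s in a..r, (slope X t r) (past hT s) (w s)
        = (∫ s in a..r, (slope X t r - X') (past hT s) (w s))
          + ∫ s in a..r, X' (past hT s) (w s) := fun r => by
      rw [← intervalIntegral.integral_add (hint _ _) (hint _ _)]
      simp
    simp_rw [h3]
    rw [← zero_add (∫ s in a..t, X' (past hT s) (w s))]
    refine Tendsto.add ?_ ?_
    · rw [tendsto_zero_iff_norm_tendsto_zero]
      refine squeeze_zero' (Eventually.of_forall fun _ => norm_nonneg _)
        (g := fun r => ‖slope X t r - X'‖ * c * (b - a)) ?_ ?_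
      · filter_upwards [self_mem_nhdsWithin] with r hr using hbd _ r hr.1
      · have h4 : Tendsto (fun r => ‖slope X t r - X'‖) (𝓝[Icc a b \ {t}] t) (𝓝 0) :=
          tendsto_iff_norm_sub_tendsto_zero.1 hX
        simpa using (h4.mul_const c).mul_const (b - a)
    · have h5 := (hasDerivWithinAt_integral_Icc (continuous_apply_past (hT := hT) hw
        X'.continuous).continuousOn ht).continuousWithinAt
      exact h5.mono sdiff_subset
  refine (h2.add h1).congr_of_mem (fun r _ => ?_) ht
  simp only [Pi.add_apply]
  rw [← intervalIntegral.integral_add (hint _ _) (hint _ _)]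
  simp

/-- The derivative of the pairing of a time-dependent kernel with the state. -/
theorem hasDerivWithinAt_statePairing [CompleteSpace F] (hw : Continuous w) {b : ℝ}
    (ht : t ∈ Icc τ b) {w' : E} (hw' : HasDerivWithinAt w w' (Icc τ b) t)
    {X : ℝ → C(KernelIndex T, E →L[ℝ] F)} {X' : C(KernelIndex T, E →L[ℝ] F)}
    (hX : HasNormDerivWithinAt X X' (Icc τ b) t) :
    HasDerivWithinAt (fun r => statePairing hT m w τ r (X r))
      (statePairing hT m w τ t X' + X t present w' + X t (past hT t) (w t)) (Icc τ b) t := by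
  have h1 : HasDerivWithinAt (fun r => X r present) (X' present) (Icc τ b) t := by
    simpa [Function.comp_def] using ((ContinuousMap.evalCLM ℝ (present : KernelIndex T)).hasFDerivAt
      (x := X t)).comp_hasDerivWithinAt t hX
  have h2 : HasDerivWithinAt (fun r => m.pair (X r)) (m.pair X') (Icc τ b) t := by
    have h := (m.pairCLM.hasFDerivAt (x := X t)).comp_hasDerivWithinAt t hX
    exact h
  refine (((h1.clm_apply hw').add h2).add (hasDerivWithinAt_integral_past hw ht hX)).congr_deriv ?_
  simp only [statePairing]
  abel

end Pairing

/-! ### The Riccati equation for kernels -/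

section Drift

variable {T : ℝ} {E : Type*} [NormedAddCommGroup E] [NormedSpace ℝ E]

/-- The drift at time `t`, as a kernel: the present value is transformed by `A` and the value at the
past time `s` by `N (t - s)`. -/
def drift (A : E →L[ℝ] E) (N : ℝ → E →L[ℝ] E) (t : ℝ) : KernelIndex T → E →L[ℝ] E :=
  Sum.elim (fun _ => A) fun s => N (t - s)

/-- The indicator function of the present. -/
def presence : KernelIndex T → ℝ := Sum.elim (fun _ => 1) fun _ => 0

theorem continuous_drift {A : E →L[ℝ] E} {N : ℝ → E →L[ℝ] E} (hN : Continuous N) :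
    Continuous fun q : ℝ × KernelIndex T => drift A N q.1 q.2 := by
  -- The case distinction is on the second factor only; distributing the product over the sum allows
  -- continuity to be checked on each piece.
  have e : (fun q : ℝ × KernelIndex T => drift A N q.1 q.2) = Sum.elim (fun _ => A)
      (fun q : ℝ × Icc (0 : ℝ) T => N (q.1 - q.2)) ∘ Homeomorph.prodSumDistrib := by
    funext q
    rcases q with ⟨t, k | k⟩ <;> rfl
  rw [e]
  exact (continuous_const.sumElim (by fun_prop)).comp (Homeomorph.continuous _)

theorem continuous_drift_apply {A : E →L[ℝ] E} {N : ℝ → E →L[ℝ] E} (hN : Continuous N) (t : ℝ) :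
    Continuous (drift A N t : KernelIndex T → E →L[ℝ] E) :=
  (continuous_drift hN).comp (by fun_prop : Continuous fun k : KernelIndex T => (t, k))

theorem continuous_presence : Continuous (presence : KernelIndex T → ℝ) :=
  continuous_const.sumElim continuous_const

theorem abs_presence_le (k : KernelIndex T) : |presence k| ≤ 1 := by
  rcases k with k | k <;> simp [presence]

end Drift

section Riccati

variable {T : ℝ} {E U Y : Type*} [NormedAddCommGroup E] [InnerProductSpace ℝ E] [CompleteSpace E]
  [NormedAddCommGroup U] [InnerProductSpace ℝ U] [CompleteSpace U]
  [NormedAddCommGroup Y] [InnerProductSpace ℝ Y] [CompleteSpace Y]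

/-- One half of the right-hand side of the Riccati equation; the other half is its transpose. -/
noncomputable def riccatiHalf (hT : 0 ≤ T) (A : E →L[ℝ] E) (N : ℝ → E →L[ℝ] E) (B : U →L[ℝ] E)
    (C : E →L[ℝ] Y) (t : ℝ) (P : KernelIndex T × KernelIndex T → E →L[ℝ] E)
    (k l : KernelIndex T) : E →L[ℝ] E :=
  -(P (k, present) ∘L drift A N t l + presence l • P (k, past hT t))
    - (presence k * presence l / 2) • (C† ∘L C)
    + (1 / 2 : ℝ) • (P (k, present) ∘L (B ∘L B†) ∘L (P (l, present))†)

variable {hT : 0 ≤ T} {A : E →L[ℝ] E} {N : ℝ → E →L[ℝ] E} {B : U →L[ℝ] E} {C : E →L[ℝ] Y}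

theorem continuous_riccatiHalf (hN : Continuous N) {Z : Type*} [TopologicalSpace Z]
    {P : Z → C(KernelIndex T × KernelIndex T, E →L[ℝ] E)} {t : Z → ℝ} {k l : Z → KernelIndex T}
    (hP : Continuous P) (ht : Continuous t) (hk : Continuous k) (hl : Continuous l) :
    Continuous fun z => riccatiHalf hT A N B C (t z) (P z) (k z) (l z) := by
  have h1 : Continuous fun z => drift A N (t z) (l z) := (continuous_drift hN).comp (ht.prodMk hl)
  have h0 : ∀ {i j : Z → KernelIndex T}, Continuous i → Continuous j →
      Continuous fun z => P z (i z, j z) := fun hi hj =>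
    (continuous_eval : Continuous fun q : C(KernelIndex T × KernelIndex T, E →L[ℝ] E)
      × (KernelIndex T × KernelIndex T) => q.1 q.2).comp (hP.prodMk (hi.prodMk hj))
  have h2 : Continuous fun z => P z (k z, past hT (t z)) := h0 hk ((continuous_past hT).comp ht)
  have h3 : Continuous fun z => presence (k z) := continuous_presence.comp hk
  have h4 : Continuous fun z => presence (l z) := continuous_presence.comp hl
  have h5 : Continuous fun z => P z (k z, present) := h0 hk continuous_const
  have h6 : Continuous fun z => (P z (l z, present))† :=
    ContinuousLinearMap.adjoint.continuous.comp (h0 hl continuous_const)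
  have h7 : Continuous fun z => P z (k z, present) ∘L (B ∘L B†) ∘L (P z (l z, present))† :=
    h5.clm_comp (continuous_const.clm_comp h6)
  unfold riccatiHalf
  exact (((h5.clm_comp h1).add (h4.smul h2)).neg.sub
    (((h3.mul h4).div_const 2).smul continuous_const)).add
      (h7.const_smul (1 / 2 : ℝ))

/-- With D = BB*, the quadratic term is treated by PDP* - QDQ* = (P - Q)DP* + QD(P - Q)*, which is
where the radius R of the ball enters; the remaining terms are affine in the kernel. -/
theorem norm_riccatiHalf_sub_le {P Q : C(KernelIndex T × KernelIndex T, E →L[ℝ] E)} {t g R : ℝ}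
    (hg : ∀ k : KernelIndex T, ‖drift A N t k‖ ≤ g) (hP : ‖P‖ ≤ R) (hQ : ‖Q‖ ≤ R)
    (k l : KernelIndex T) :
    ‖riccatiHalf hT A N B C t P k l - riccatiHalf hT A N B C t Q k l‖
      ≤ (g + 1 + R * ‖B ∘L B†‖) * ‖P - Q‖ := by
  set D := B ∘L B† with hD
  have hR : 0 ≤ R := (norm_nonneg P).trans hP
  have hg0 : 0 ≤ g := (norm_nonneg _).trans (hg present)
  have hPQ : ∀ q, ‖P q - Q q‖ ≤ ‖P - Q‖ := fun q => (P - Q).norm_coe_le_norm q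
  have e : riccatiHalf hT A N B C t P k l - riccatiHalf hT A N B C t Q k l
      = -((P (k, present) - Q (k, present)) ∘L drift A N t l)
        - presence l • (P (k, past hT t) - Q (k, past hT t))
        + ((1 / 2 : ℝ) • ((P (k, present) - Q (k, present)) ∘L D ∘L (P (l, present))†)
        + (1 / 2 : ℝ) • (Q (k, present) ∘L D ∘L (P (l, present) - Q (l, present))†)) := by
    ext x
    simp only [riccatiHalf, ← hD, map_sub, sub_apply, add_apply, neg_apply, smul_apply,
      ContinuousLinearMap.comp_apply]
    module
  have h1 : ‖(P (k, present) - Q (k, present)) ∘L drift A N t l‖ ≤ ‖P - Q‖ * g :=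
    (ContinuousLinearMap.opNorm_comp_le _ _).trans
      (mul_le_mul (hPQ _) (hg _) (norm_nonneg _) (norm_nonneg (P - Q)))
  have h2 : ‖presence l • (P (k, past hT t) - Q (k, past hT t))‖ ≤ ‖P - Q‖ := by
    rw [norm_smul, Real.norm_eq_abs]
    exact (mul_le_of_le_one_left (norm_nonneg _) (abs_presence_le l)).trans (hPQ _)
  have h3 : ‖(P (k, present) - Q (k, present)) ∘L D ∘L (P (l, present))†‖
      ≤ ‖P - Q‖ * (‖D‖ * R) := by
    refine (ContinuousLinearMap.opNorm_comp_le _ _).trans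
      (mul_le_mul (hPQ _) ?_ (norm_nonneg _) (norm_nonneg (P - Q)))
    refine (ContinuousLinearMap.opNorm_comp_le _ _).trans
      (mul_le_mul_of_nonneg_left ?_ (norm_nonneg _))
    rw [LinearIsometryEquiv.norm_map]
    exact (P.norm_coe_le_norm _).trans hP
  have h4 : ‖Q (k, present) ∘L D ∘L (P (l, present) - Q (l, present))†‖
      ≤ R * (‖D‖ * ‖P - Q‖) := by
    refine (ContinuousLinearMap.opNorm_comp_le _ _).trans
      (mul_le_mul ((Q.norm_coe_le_norm _).trans hQ) ?_ (norm_nonneg _) hR)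
    refine (ContinuousLinearMap.opNorm_comp_le _ _).trans
      (mul_le_mul_of_nonneg_left ?_ (norm_nonneg _))
    rw [LinearIsometryEquiv.norm_map]
    exact hPQ _
  rw [e]
  refine (norm_add_le _ _).trans ?_
  have h5 := norm_add_le
    ((1 / 2 : ℝ) • ((P (k, present) - Q (k, present)) ∘L D ∘L (P (l, present))†))
    ((1 / 2 : ℝ) • (Q (k, present) ∘L D ∘L (P (l, present) - Q (l, present))†))
  rw [norm_smul, norm_smul, Real.norm_of_nonneg (by norm_num : (0 : ℝ) ≤ 1 / 2)] at h5
  have h6 := norm_sub_le (-((P (k, present) - Q (k, present)) ∘L drift A N t l))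
    (presence l • (P (k, past hT t) - Q (k, past hT t)))
  rw [norm_neg] at h6
  have h7 : 1 / 2 * (‖P - Q‖ * (‖D‖ * R)) + 1 / 2 * (R * (‖D‖ * ‖P - Q‖))
      = R * ‖D‖ * ‖P - Q‖ := by ring
  linarith

/-- The right-hand side of the Riccati equation for kernels. -/
noncomputable def riccatiField (hT : 0 ≤ T) (A : E →L[ℝ] E) {N : ℝ → E →L[ℝ] E}
    (hN : Continuous N) (B : U →L[ℝ] E) (C : E →L[ℝ] Y) (t : ℝ)
    (P : C(KernelIndex T × KernelIndex T, E →L[ℝ] E)) :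
    C(KernelIndex T × KernelIndex T, E →L[ℝ] E) :=
  ⟨fun q => riccatiHalf hT A N B C t P q.1 q.2 + (riccatiHalf hT A N B C t P q.2 q.1)†,
    (continuous_riccatiHalf hN continuous_const continuous_const continuous_fst continuous_snd).add
      (ContinuousLinearMap.adjoint.continuous.comp (continuous_riccatiHalf hN continuous_const
        continuous_const continuous_snd continuous_fst))⟩

theorem riccatiField_apply (hN : Continuous N) (t : ℝ)
    (P : C(KernelIndex T × KernelIndex T, E →L[ℝ] E)) (k l : KernelIndex T) :
    riccatiField hT A hN B C t P (k, l)
      = riccatiHalf hT A N B C t P k l + (riccatiHalf hT A N B C t P l k)† := rfl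

/-- The field is a half plus its transpose, so it is symmetric even when P is not yet known to be.
Symmetry of solutions is then a consequence and need not be built into the Banach space. -/
theorem adjoint_riccatiField (hN : Continuous N) (t : ℝ)
    (P : C(KernelIndex T × KernelIndex T, E →L[ℝ] E)) (k l : KernelIndex T) :
    (riccatiField hT A hN B C t P (k, l))† = riccatiField hT A hN B C t P (l, k) := by
  simp only [riccatiField_apply, map_add, ContinuousLinearMap.adjoint_adjoint]
  rw [add_comm]

theorem continuous_riccatiField (hN : Continuous N) {Z : Type*} [TopologicalSpace Z]
    {P : Z → C(KernelIndex T × KernelIndex T, E →L[ℝ] E)} {t : Z → ℝ} (hP : Continuous P)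
    (ht : Continuous t) : Continuous fun z => riccatiField hT A hN B C (t z) (P z) := by
  refine ContinuousMap.continuous_of_continuous_uncurry _ ?_
  have hP1 : Continuous fun q : Z × KernelIndex T × KernelIndex T => P q.1 := hP.comp continuous_fst
  have ht1 : Continuous fun q : Z × KernelIndex T × KernelIndex T => t q.1 := ht.comp continuous_fst
  have hk : Continuous fun q : Z × KernelIndex T × KernelIndex T => q.2.1 :=
    continuous_fst.comp continuous_snd
  have hl : Continuous fun q : Z × KernelIndex T × KernelIndex T => q.2.2 :=
    continuous_snd.comp continuous_snd
  exact (continuous_riccatiHalf hN hP1 ht1 hk hl).add (ContinuousLinearMap.adjoint.continuous.comp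
    (continuous_riccatiHalf hN hP1 ht1 hl hk))

theorem norm_riccatiField_sub_le (hN : Continuous N) {t g R : ℝ}
    (hg : ∀ k : KernelIndex T, ‖drift A N t k‖ ≤ g)
    {P Q : C(KernelIndex T × KernelIndex T, E →L[ℝ] E)} (hP : ‖P‖ ≤ R) (hQ : ‖Q‖ ≤ R) :
    ‖riccatiField hT A hN B C t P - riccatiField hT A hN B C t Q‖
      ≤ 2 * (g + 1 + R * ‖B ∘L B†‖) * ‖P - Q‖ := by
  have hg0 : 0 ≤ g := (norm_nonneg _).trans (hg present)
  have hR : 0 ≤ R := (norm_nonneg P).trans hP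
  have hPQ : 0 ≤ ‖P - Q‖ := norm_nonneg (P - Q)
  refine (ContinuousMap.norm_le _ (by positivity)).2 fun q => ?_
  obtain ⟨k, l⟩ := q
  have e : (riccatiField hT A hN B C t P - riccatiField hT A hN B C t Q) (k, l)
      = (riccatiHalf hT A N B C t P k l - riccatiHalf hT A N B C t Q k l)
        + (riccatiHalf hT A N B C t P l k - riccatiHalf hT A N B C t Q l k)† := by
    simp only [ContinuousMap.sub_apply, riccatiField_apply, map_sub]
    abel
  rw [e]
  refine (norm_add_le _ _).trans ?_
  rw [LinearIsometryEquiv.norm_map]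
  have h1 := norm_riccatiHalf_sub_le (hT := hT) (B := B) (C := C) hg hP hQ k l
  have h2 := norm_riccatiHalf_sub_le (hT := hT) (B := B) (C := C) hg hP hQ l k
  linarith

/-- For symmetric P the two halves of the quadratic term and of the C*C term coincide and add up,
and the familiar Riccati equation appears. The terms with `past hT t` record that the present is
absorbed into the memory at time t. -/
theorem riccatiField_apply_of_symm (hN : Continuous N) (t : ℝ)
    {P : C(KernelIndex T × KernelIndex T, E →L[ℝ] E)} (hP : ∀ k l, (P (k, l))† = P (l, k))
    (k l : KernelIndex T) :
    riccatiField hT A hN B C t P (k, l)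
      = P (k, present) ∘L (B ∘L B†) ∘L P (present, l) - P (k, present) ∘L drift A N t l
        - presence l • P (k, past hT t) - (drift A N t k)† ∘L P (present, l)
        - presence k • P (past hT t, l) - presence l • presence k • (C† ∘L C) := by
  ext x
  simp only [riccatiField_apply, riccatiHalf, map_add, map_sub, map_neg,
    ContinuousLinearMap.adjoint_comp, ContinuousLinearMap.adjoint_adjoint, hP,
    LinearIsometryEquiv.map_smulₛₗ, conj_trivial, sub_apply, add_apply, neg_apply, smul_apply,
    ContinuousLinearMap.comp_apply]
  module

/-- `P` solves the Riccati equation on `[a, T]`, with final value `0`. -/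
structure SolvesRiccati (hT : 0 ≤ T) (A : E →L[ℝ] E) {N : ℝ → E →L[ℝ] E} (hN : Continuous N)
    (B : U →L[ℝ] E) (C : E →L[ℝ] Y) (a : ℝ)
    (P : ℝ → C(KernelIndex T × KernelIndex T, E →L[ℝ] E)) : Prop where
  final : P T = 0
  deriv : ∀ t ∈ Icc a T, HasNormDerivWithinAt P (riccatiField hT A hN B C t (P t)) (Icc a T) t

theorem HasNormDerivWithinAt.eval {K G : Type*} [TopologicalSpace K] [CompactSpace K]
    [NormedAddCommGroup G] [NormedSpace ℝ G] {f : ℝ → C(K, G)} {f' : C(K, G)} {s : Set ℝ} {t : ℝ}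
    (h : HasNormDerivWithinAt f f' s t) (k : K) :
    HasNormDerivWithinAt (fun r => f r k) (f' k) s t := by
  have h1 := ((ContinuousMap.evalCLM ℝ k).hasFDerivAt (x := f t)).comp_hasDerivWithinAt t h
  exact h1

/-- The defect of symmetry has derivative zero, because the field is symmetric, and it vanishes at
T. -/
theorem SolvesRiccati.adjoint_apply {hN : Continuous N} {a : ℝ}
    {P : ℝ → C(KernelIndex T × KernelIndex T, E →L[ℝ] E)} (hP : SolvesRiccati hT A hN B C a P)
    {t : ℝ} (ht : t ∈ Icc a T) (k l : KernelIndex T) : (P t (k, l))† = P t (l, k) := by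
  symm
  rw [ContinuousLinearMap.eq_adjoint_iff]
  intro x y
  have hsub : Icc t T ⊆ Icc a T := Icc_subset_Icc_left ht.1
  have hd : ∀ r ∈ Icc t T, HasDerivWithinAt (fun r => (inner ℝ (P r (l, k) x) y : ℝ)
      - inner ℝ x (P r (k, l) y)) 0 (Icc t T) r := fun r hr => by
    have h1 := (((hP.deriv r (hsub hr)).eval (l, k)).clm_apply
      (hasDerivWithinAt_const r (Icc a T) x)).inner ℝ (hasDerivWithinAt_const r (Icc a T) y)
    have h2 := (hasDerivWithinAt_const r (Icc a T) x).inner ℝ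
      (((hP.deriv r (hsub hr)).eval (k, l)).clm_apply (hasDerivWithinAt_const r (Icc a T) y))
    refine ((h1.sub h2).mono hsub).congr_deriv ?_
    rw [← adjoint_riccatiField hN r (P r) k l]
    simp [ContinuousLinearMap.adjoint_inner_left]
  have h := integral_eq_sub_of_hasDerivWithinAt_Icc ht.2 hd continuousOn_const
  simp only [intervalIntegral.integral_zero, hP.final, ContinuousMap.zero_apply, zero_apply,
    inner_zero_left, inner_zero_right, sub_zero, zero_sub] at h
  linarith

end Riccati

/-! ### The costate -/

section Costate

variable {T : ℝ} {E U Y : Type*} [NormedAddCommGroup E] [InnerProductSpace ℝ E]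
  [NormedAddCommGroup U] [InnerProductSpace ℝ U]
  [NormedAddCommGroup Y] [InnerProductSpace ℝ Y]

/-- Continuous linear maps between normed spaces, such as spaces of continuous functions with their
supremum norms. -/
abbrev NormCLM (G H : Type*) [NormedAddCommGroup G] [NormedSpace ℝ G] [NormedAddCommGroup H]
    [NormedSpace ℝ H] : Type _ :=
  G →L[ℝ] H

theorem HasNormDerivWithinAt.clm {G H : Type*} [NormedAddCommGroup G] [NormedSpace ℝ G]
    [NormedAddCommGroup H] [NormedSpace ℝ H] {f : ℝ → G} {f' : G} {s : Set ℝ} {t : ℝ}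
    (h : HasNormDerivWithinAt f f' s t) (L : G →L[ℝ] H) :
    HasNormDerivWithinAt (fun r => L (f r)) (L f') s t := by
  have h1 := (L.hasFDerivAt (x := f t)).comp_hasDerivWithinAt t h
  exact h1

/-- The real inner product as a continuous bilinear map. -/
noncomputable def realInnerCLM (E : Type*) [NormedAddCommGroup E] [InnerProductSpace ℝ E] :
    E →L[ℝ] E →L[ℝ] ℝ :=
  (innerₗ E).mkContinuous₂ 1 fun x y => by simpa using norm_inner_le_norm (𝕜 := ℝ) x y

@[simp]
theorem realInnerCLM_apply (x y : E) : realInnerCLM E x y = inner ℝ x y := rfl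

/-- Continuous vector-valued functions on the index set, with the supremum norm. -/
def VecKernel (T : ℝ) (E : Type*) [NormedAddCommGroup E] : Type _ := C(KernelIndex T, E)

namespace VecKernel

variable {T : ℝ} {E : Type*} [NormedAddCommGroup E]

noncomputable instance : NormedAddCommGroup (VecKernel T E) :=
  inferInstanceAs (NormedAddCommGroup C(KernelIndex T, E))

noncomputable instance [NormedSpace ℝ E] : NormedSpace ℝ (VecKernel T E) :=
  inferInstanceAs (NormedSpace ℝ C(KernelIndex T, E))

instance [CompleteSpace E] : CompleteSpace (VecKernel T E) :=
  inferInstanceAs (CompleteSpace C(KernelIndex T, E))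

instance : CoeFun (VecKernel T E) fun _ => KernelIndex T → E :=
  ⟨fun f => DFunLike.coe (F := C(KernelIndex T, E)) f⟩

/-- The vector kernel given by a continuous function. -/
def mk (f : KernelIndex T → E) (hf : Continuous f) : VecKernel T E := (⟨f, hf⟩ : C(_, _))

@[simp]
theorem mk_apply (f : KernelIndex T → E) (hf : Continuous f) (k : KernelIndex T) :
    mk f hf k = f k := rfl

theorem continuous (f : VecKernel T E) : Continuous f := ContinuousMap.continuous f

@[ext]
theorem ext {f g : VecKernel T E} (h : ∀ k, f k = g k) : f = g := ContinuousMap.ext h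

@[simp]
theorem add_apply (f g : VecKernel T E) (k : KernelIndex T) : (f + g) k = f k + g k := rfl

@[simp]
theorem sub_apply (f g : VecKernel T E) (k : KernelIndex T) : (f - g) k = f k - g k := rfl

@[simp]
theorem zero_apply (k : KernelIndex T) : (0 : VecKernel T E) k = 0 := rfl

@[simp]
theorem smul_apply [NormedSpace ℝ E] (c : ℝ) (f : VecKernel T E) (k : KernelIndex T) :
    (c • f) k = c • f k := rfl

theorem norm_apply_le (f : VecKernel T E) (k : KernelIndex T) : ‖f k‖ ≤ ‖f‖ :=
  ContinuousMap.norm_coe_le_norm f k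

theorem norm_le {f : VecKernel T E} {c : ℝ} (hc : 0 ≤ c) (h : ∀ k, ‖f k‖ ≤ c) : ‖f‖ ≤ c :=
  (ContinuousMap.norm_le f hc).2 h

/-- The evaluation at an index. -/
noncomputable def evalCLM [NormedSpace ℝ E] (k : KernelIndex T) : VecKernel T E →L[ℝ] E :=
  LinearMap.mkContinuous
    { toFun := fun f : VecKernel T E => f k
      map_add' := fun _ _ => rfl
      map_smul' := fun _ _ => rfl } 1 fun f => by rw [one_mul]; exact f.norm_apply_le k

end VecKernel

/-- The columns of a kernel of operators, as operators into vector kernels. -/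
noncomputable def kernelColumn (P : C(KernelIndex T × KernelIndex T, E →L[ℝ] E))
    (l : KernelIndex T) : E →L[ℝ] VecKernel T E :=
  LinearMap.mkContinuous
    { toFun := fun e => VecKernel.mk (fun k => P (k, l) e)
        ((P.continuous.comp (continuous_id.prodMk continuous_const)).clm_apply continuous_const)
      map_add' := fun e e' => by ext k; simp
      map_smul' := fun c e => by ext k; simp } ‖P‖ fun e =>
    VecKernel.norm_le (by positivity) fun k => (P (k, l)).le_of_opNorm_le (P.norm_coe_le_norm _) e

/-- By compactness of the index set, P(k, l') tends to P(k, l) uniformly in k as l' tends to l; this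
is convergence of the columns in operator norm. -/
theorem continuous_kernelColumn (P : C(KernelIndex T × KernelIndex T, E →L[ℝ] E)) :
    Continuous (kernelColumn P) := by
  have h : Continuous fun l => (P.comp ContinuousMap.prodSwap).curry l := ContinuousMap.continuous _
  refine continuous_iff_continuousAt.2 fun l => Metric.tendsto_nhds.2 fun ε hε => ?_
  have hl := ContinuousMap.tendsto_iff_tendstoUniformly.1 (h.tendsto l)
  filter_upwards [Metric.tendstoUniformly_iff.1 hl (ε / 2) (half_pos hε)] with l' hl'
  rw [dist_eq_norm]
  refine lt_of_le_of_lt (ContinuousLinearMap.opNorm_le_bound _ (half_pos hε).le fun e =>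
    VecKernel.norm_le (by positivity) fun k => ?_) (half_lt_self hε)
  have h2 : ‖P (k, l') - P (k, l)‖ ≤ ε / 2 := by
    rw [← dist_eq_norm, dist_comm]
    exact (hl' k).le
  exact (P (k, l') - P (k, l)).le_of_opNorm_le h2 e

/-- A kernel of operators as a kernel with values in operators into vector kernels. -/
noncomputable def kernelCurry (T : ℝ) (E : Type*) [NormedAddCommGroup E] [InnerProductSpace ℝ E] :
    NormCLM C(KernelIndex T × KernelIndex T, E →L[ℝ] E) C(KernelIndex T, E →L[ℝ] VecKernel T E) :=
  LinearMap.mkContinuous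
    { toFun := fun P : C(KernelIndex T × KernelIndex T, E →L[ℝ] E) =>
        (⟨kernelColumn P, continuous_kernelColumn P⟩ : C(KernelIndex T, E →L[ℝ] VecKernel T E))
      map_add' := fun _ _ => rfl
      map_smul' := fun _ _ => rfl } 1 fun P => by
    refine (ContinuousMap.norm_le _ (mul_nonneg zero_le_one (norm_nonneg P))).2 fun l => ?_
    rw [one_mul]
    exact ContinuousLinearMap.opNorm_le_bound _ (norm_nonneg P) fun e =>
      VecKernel.norm_le (mul_nonneg (norm_nonneg P) (norm_nonneg e)) fun k =>
        (P (k, l)).le_of_opNorm_le (P.norm_coe_le_norm _) e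

theorem kernelCurry_apply (P : C(KernelIndex T × KernelIndex T, E →L[ℝ] E)) (k l : KernelIndex T)
    (e : E) : kernelCurry T E P l e k = P (k, l) e := rfl

theorem continuous_row (P : C(KernelIndex T × KernelIndex T, E →L[ℝ] E)) (k : KernelIndex T) :
    Continuous fun l => P (k, l) :=
  P.continuous.comp (continuous_const.prodMk continuous_id)

theorem continuous_column (P : C(KernelIndex T × KernelIndex T, E →L[ℝ] E)) (l : KernelIndex T) :
    Continuous fun k => P (k, l) :=
  P.continuous.comp (continuous_id.prodMk continuous_const)

variable {hT : 0 ≤ T} {m : Memory T E} {w : ℝ → E} {τ t : ℝ}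

theorem statePairing_presence_smul {F : Type*} [NormedAddCommGroup F] [NormedSpace ℝ F]
    (L : E →L[ℝ] F) :
    statePairing hT m w τ t (fun l => presence l • L) = L (w t) := by
  rw [statePairing_eq_of_past_eq_zero fun s => by simp [presence]]
  simp [presence]

variable [CompleteSpace E] [CompleteSpace U] [CompleteSpace Y] {A : E →L[ℝ] E}
  {N : ℝ → E →L[ℝ] E} {B : U →L[ℝ] E} {C : E →L[ℝ] Y}
  {P : C(KernelIndex T × KernelIndex T, E →L[ℝ] E)}

/-- The right-hand side of the equation for the terms which depend on the signal. -/
noncomputable def signalField (hT : 0 ≤ T) (A : E →L[ℝ] E) {N : ℝ → E →L[ℝ] E} (hN : Continuous N)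
    (B : U →L[ℝ] E) (C : E →L[ℝ] Y) (t : ℝ) (y : Y)
    (P : C(KernelIndex T × KernelIndex T, E →L[ℝ] E)) (d : VecKernel T E) :
    VecKernel T E :=
  VecKernel.mk (fun k => P (k, present) (B ((B†) (d present))) - ((drift A N t k)†) (d present)
    - presence k • (d (past hT t) - (C†) y))
    ((((continuous_column P present).clm_apply continuous_const).sub
      ((ContinuousLinearMap.adjoint.continuous.comp (continuous_drift_apply hN t)).clm_apply
        continuous_const)).sub (continuous_presence.smul continuous_const))

theorem signalField_apply (hN : Continuous N) (t : ℝ) (y : Y) (d : VecKernel T E)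
    (k : KernelIndex T) : signalField hT A hN B C t y P d k
      = P (k, present) (B ((B†) (d present))) - ((drift A N t k)†) (d present)
        - presence k • (d (past hT t) - (C†) y) := rfl

/-- The adjoint system: the right-hand side of the equation for the costate. -/
noncomputable def costateField (hT : 0 ≤ T) (A : E →L[ℝ] E) {N : ℝ → E →L[ℝ] E} (hN : Continuous N)
    (C : E →L[ℝ] Y) (t : ℝ) (z : Y) (p : VecKernel T E) : VecKernel T E :=
  VecKernel.mk (fun k => -((drift A N t k)†) (p present) - presence k • (p (past hT t) + (C†) z))
    (((ContinuousLinearMap.adjoint.continuous.comp (continuous_drift_apply hN t)).clm_apply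
        continuous_const).neg.sub (continuous_presence.smul continuous_const))

theorem costateField_apply (hN : Continuous N) (t : ℝ) (z : Y) (p : VecKernel T E)
    (k : KernelIndex T) : costateField hT A hN C t z p k
      = -((drift A N t k)†) (p present) - presence k • (p (past hT t) + (C†) z) := rfl

/-- The costate of a trajectory. -/
noncomputable def costate (hT : 0 ≤ T) (m : Memory T E) (w : ℝ → E) (τ t : ℝ)
    (P : C(KernelIndex T × KernelIndex T, E →L[ℝ] E)) (d : VecKernel T E) :
    VecKernel T E :=
  statePairing hT m w τ t (kernelCurry T E P) + d

/-- Evaluation at an index is a bounded operator, so it passes through the pairing. Thus a vector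
kernel can be differentiated as one element of a Banach space and then read off index by index. -/
theorem statePairing_kernelCurry (hw : Continuous w)
    (P : C(KernelIndex T × KernelIndex T, E →L[ℝ] E)) (k : KernelIndex T) :
    statePairing hT m w τ t (kernelCurry T E P) k
      = statePairing hT m w τ t fun l => P (k, l) :=
  (statePairing_comp hw (kernelCurry T E P).continuous (VecKernel.evalCLM k)).symm

theorem costate_apply (hw : Continuous w) (d : VecKernel T E) (k : KernelIndex T) :
    costate hT m w τ t P d k = statePairing hT m w τ t (fun l => P (k, l)) + d k := by
  rw [costate, VecKernel.add_apply, statePairing_kernelCurry hw]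

theorem statePairing_riccatiField (hN : Continuous N) (hw : Continuous w)
    (hP : ∀ k l, (P (k, l))† = P (l, k)) (k : KernelIndex T) :
    statePairing hT m w τ t (fun l => riccatiField hT A hN B C t P (k, l))
      = P (k, present) (B ((B†) (statePairing hT m w τ t fun l => P (present, l))))
        - P (k, present) (statePairing hT m w τ t (drift A N t)) - P (k, past hT t) (w t)
        - ((drift A N t k)†) (statePairing hT m w τ t fun l => P (present, l))
        - presence k • (statePairing hT m w τ t fun l => P (past hT t, l))
        - presence k • (C†) (C (w t)) := by
  have hG := continuous_drift_apply (T := T) (A := A) hN t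
  have hR := continuous_row P
  have hχ := continuous_presence (T := T)
  simp_rw [riccatiField_apply_of_symm hN t hP]
  have c1 : Continuous fun l => P (k, present) ∘L (B ∘L B†) ∘L P (present, l) :=
    continuous_const.clm_comp (continuous_const.clm_comp (hR present))
  have c2 : Continuous fun l => P (k, present) ∘L drift A N t l := continuous_const.clm_comp hG
  have c3 : Continuous fun l => presence l • P (k, past hT t) := hχ.smul continuous_const
  have c4 : Continuous fun l => (drift A N t k)† ∘L P (present, l) :=
    continuous_const.clm_comp (hR present)
  have c5 : Continuous fun l => presence k • P (past hT t, l) :=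
    (hR (past hT t)).const_smul (presence k)
  have c6 : Continuous fun l : KernelIndex T => presence l • presence k • (C† ∘L C) :=
    hχ.smul continuous_const
  have c12 : Continuous fun l => P (k, present) ∘L (B ∘L B†) ∘L P (present, l)
    - P (k, present) ∘L drift A N t l := c1.sub c2
  have c13 : Continuous fun l => P (k, present) ∘L (B ∘L B†) ∘L P (present, l)
    - P (k, present) ∘L drift A N t l - presence l • P (k, past hT t) := c12.sub c3
  have c14 : Continuous fun l => P (k, present) ∘L (B ∘L B†) ∘L P (present, l)
    - P (k, present) ∘L drift A N t l - presence l • P (k, past hT t)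
    - (drift A N t k)† ∘L P (present, l) := c13.sub c4
  have c15 : Continuous fun l => P (k, present) ∘L (B ∘L B†) ∘L P (present, l)
    - P (k, present) ∘L drift A N t l - presence l • P (k, past hT t)
    - (drift A N t k)† ∘L P (present, l) - presence k • P (past hT t, l) := c14.sub c5
  rw [statePairing_sub hw c15 c6, statePairing_sub hw c14 c5, statePairing_sub hw c13 c4,
    statePairing_sub hw c12 c3, statePairing_sub hw c1 c2, statePairing_presence_smul,
    statePairing_presence_smul, statePairing_smul, statePairing_comp hw hG,
    statePairing_comp hw (hR present) ((drift A N t k)†)]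
  have e : (fun l => P (k, present) ∘L (B ∘L B†) ∘L P (present, l))
      = fun l => (P (k, present) ∘L (B ∘L B†)) ∘L P (present, l) := rfl
  rw [e, statePairing_comp hw (hR present) (P (k, present) ∘L (B ∘L B†))]
  simp

/-- Under the optimal feedback, the costate solves the adjoint system. -/
theorem hasDerivWithinAt_costate (hN : Continuous N) (hw : Continuous w)
    {P : ℝ → C(KernelIndex T × KernelIndex T, E →L[ℝ] E)} {d : ℝ → VecKernel T E} {y : Y}
    (ht : t ∈ Icc τ T) (hsymm : ∀ k l, (P t (k, l))† = P t (l, k))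
    (hP : HasNormDerivWithinAt P (riccatiField hT A hN B C t (P t)) (Icc τ T) t)
    (hd : HasDerivWithinAt d (signalField hT A hN B C t y (P t) (d t)) (Icc τ T) t)
    (hw' : HasDerivWithinAt w (statePairing hT m w τ t (drift A N t)
      - B ((B†) (costate hT m w τ t (P t) (d t) present))) (Icc τ T) t) :
    HasDerivWithinAt (fun r => costate hT m w τ r (P r) (d r))
      (costateField hT A hN C t (C (w t) - y) (costate hT m w τ t (P t) (d t))) (Icc τ T) t := by
  have h1 : HasNormDerivWithinAt (fun r => kernelCurry T E (P r))
      (kernelCurry T E (riccatiField hT A hN B C t (P t))) (Icc τ T) t := by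
    exact hP.clm (kernelCurry T E)
  have h2 := (hasDerivWithinAt_statePairing (hT := hT) (m := m) hw ht hw' h1).add hd
  -- Differentiating the pairing produces P(k, present) w' and P(k, past t) w. The drift part of the
  -- former and the latter cancel against the Riccati field, and the BB* terms cancel against those
  -- of the Riccati and signal fields; the adjoint system is left.
  refine h2.congr_deriv ?_
  ext1 k
  rw [costateField_apply]
  simp only [VecKernel.add_apply]
  rw [statePairing_kernelCurry hw, kernelCurry_apply, kernelCurry_apply, signalField_apply,
    statePairing_riccatiField hN hw hsymm, costate_apply hw, costate_apply hw]
  simp only [map_add, map_sub]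
  module

end Costate

/-! ### The optimal feedback -/

section ClosedLoop

theorem VecKernel.continuousOn_apply {T : ℝ} {E : Type*} [NormedAddCommGroup E]
    {p : ℝ → VecKernel T E} {s : Set ℝ} {k : ℝ → KernelIndex T}
    (hp : ContinuousOn p s) (hk : ContinuousOn k s) : ContinuousOn (fun t => p t (k t)) s := by
  have h : Continuous fun q : C(KernelIndex T, E) × KernelIndex T => q.1 q.2 := continuous_eval
  exact h.comp_continuousOn (hp.prodMk hk)

variable {T : ℝ} {E U Y : Type*} [NormedAddCommGroup E] [InnerProductSpace ℝ E]
  [NormedAddCommGroup U] [InnerProductSpace ℝ U]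
  [NormedAddCommGroup Y] [InnerProductSpace ℝ Y]

theorem HasNormDerivWithinAt.continuous_projIcc_eval {K G : Type*} [TopologicalSpace K]
    [CompactSpace K] [T2Space K] [NormedAddCommGroup G] [NormedSpace ℝ G] {a b : ℝ} (hab : a ≤ b)
    {P P' : ℝ → C(K, G)} (hP : ∀ t ∈ Icc a b, HasNormDerivWithinAt P (P' t) (Icc a b) t) :
    Continuous fun q : ℝ × K => P (projIcc a b hab q.1) q.2 := by
  have h1 : ContinuousOn P (Icc a b) := fun t ht => (hP t ht).continuousWithinAt
  have h2 : Continuous fun t => P (projIcc a b hab t) :=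
    (continuousOn_iff_continuous_domRestrict.1 h1).comp continuous_projIcc
  exact ContinuousMap.continuous_uncurry_of_continuous ⟨_, h2⟩

theorem Memory.continuous_pair {F Z : Type*} [NormedAddCommGroup F] [NormedSpace ℝ F]
    [TopologicalSpace Z] (m : Memory T E) {X : Z → KernelIndex T → E →L[ℝ] F}
    (hX : Continuous fun q : Z × KernelIndex T => X q.1 q.2) : Continuous fun z => m.pair (X z) := by
  let X' : Z → C(KernelIndex T, E →L[ℝ] F) := fun z =>
    ⟨X z, hX.comp (continuous_const.prodMk continuous_id : Continuous fun k => (z, k))⟩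
  have h : Continuous X' := ContinuousMap.continuous_of_continuous_uncurry _ hX
  exact m.pairCLM.continuous.comp h

theorem statePairing_zero {hT : 0 ≤ T} {m : Memory T E} {w : ℝ → E} {τ t : ℝ} {F : Type*}
    [NormedAddCommGroup F] [NormedSpace ℝ F] :
    statePairing hT m w τ t (fun _ => (0 : E →L[ℝ] F)) = 0 := by
  simp [statePairing, Memory.pair]

theorem costate_zero {hT : 0 ≤ T} {m : Memory T E} {w : ℝ → E} {τ t : ℝ} :
    costate hT m w τ t 0 0 = 0 := by
  have e : ((kernelCurry T E 0 : C(KernelIndex T, E →L[ℝ] VecKernel T E)) :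
      KernelIndex T → E →L[ℝ] VecKernel T E) = fun _ => 0 := by
    funext l
    ext1 e
    exact VecKernel.ext fun k => rfl
  rw [costate, e, statePairing_zero, add_zero]

/-- Vector kernels as kernels of functionals. -/
noncomputable def innerKernel (T : ℝ) (E : Type*) [NormedAddCommGroup E] [InnerProductSpace ℝ E] :
    NormCLM (VecKernel T E) C(KernelIndex T, E →L[ℝ] ℝ) :=
  LinearMap.mkContinuous
    { toFun := fun f : VecKernel T E =>
        (⟨fun k => realInnerCLM E (f k), (realInnerCLM E).continuous.comp f.continuous⟩ :
          C(KernelIndex T, E →L[ℝ] ℝ))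
      map_add' := fun f g => by ext k; simp
      map_smul' := fun c f => by ext k; simp } 1 fun f => by
    refine (ContinuousMap.norm_le _ (by positivity)).2 fun k => ?_
    refine ContinuousLinearMap.opNorm_le_bound _ (by positivity) fun e => ?_
    calc ‖(inner ℝ (f k) e : ℝ)‖ ≤ ‖f k‖ * ‖e‖ := norm_inner_le_norm _ _
      _ ≤ 1 * ‖f‖ * ‖e‖ := by
        rw [one_mul]
        exact mul_le_mul_of_nonneg_right (f.norm_apply_le k) (norm_nonneg _)

theorem innerKernel_apply (f : VecKernel T E) (k : KernelIndex T) :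
    innerKernel T E f k = realInnerCLM E (f k) := rfl

variable [CompleteSpace E] [CompleteSpace U] [CompleteSpace Y] {hT : 0 ≤ T} {m : Memory T E}
  {w : ℝ → E} {τ : ℝ} {A : E →L[ℝ] E} {N : ℝ → E →L[ℝ] E} {B : U →L[ℝ] E} {C : E →L[ℝ] Y}
  {P : ℝ → C(KernelIndex T × KernelIndex T, E →L[ℝ] E)} {d : ℝ → VecKernel T E}

/-- The closed-loop system of the optimal feedback has a solution. -/
theorem exists_closedLoop (hτ : τ ≤ T) (hN : Continuous N)
    {P' : ℝ → C(KernelIndex T × KernelIndex T, E →L[ℝ] E)}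
    (hP : ∀ t ∈ Icc τ T, HasNormDerivWithinAt P (P' t) (Icc τ T) t)
    (hd : ContinuousOn d (Icc τ T)) (m : Memory T E) (ξ : E) :
    ∃ w : ℝ → E, Continuous w ∧ w τ = ξ ∧ ∀ t ∈ Icc τ T,
      HasDerivWithinAt w (statePairing hT m w τ t (drift A N t)
        - B ((B†) (costate hT m w τ t (P t) (d t) present))) (Icc τ T) t := by
  have hPc := HasNormDerivWithinAt.continuous_projIcc_eval hτ hP
  set D := B ∘L B† with hD
  -- Inserting the feedback keeps the Volterra form: BB* times the first row of P modifies A and the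
  -- memory kernel, while the initial memory and d give the forcing. Time is clamped to obtain a
  -- globally continuous kernel.
  let Q : ℝ → KernelIndex T → E →L[ℝ] E := fun t l => P (projIcc τ T hτ t) (present, l)
  have hQ : Continuous fun q : ℝ × KernelIndex T => Q q.1 q.2 :=
    hPc.comp (continuous_fst.prodMk (continuous_const.prodMk continuous_snd))
  have hG := continuous_drift (T := T) (A := A) hN
  have hA : Continuous fun t => A - D ∘L Q t present :=
    continuous_const.sub (continuous_const.clm_comp
      (hQ.comp (continuous_id.prodMk continuous_const)))
  have hs : Continuous fun q : ℝ × ℝ => (q.1, past hT q.2) :=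
    continuous_fst.prodMk ((continuous_past hT).comp continuous_snd)
  have hk : Continuous fun q : ℝ × ℝ => drift A N q.1 (past hT q.2) - D ∘L Q q.1 (past hT q.2) :=
    (hG.comp hs).sub (continuous_const.clm_comp (hQ.comp hs))
  have hh : ContinuousOn (fun t => m.pair (drift A N t) - D (m.pair (Q t) + d t present))
      (Icc τ T) :=
    (m.continuous_pair hG).continuousOn.sub (D.continuous.comp_continuousOn
      ((m.continuous_pair hQ).continuousOn.add
        (VecKernel.continuousOn_apply hd continuousOn_const)))
  obtain ⟨α, hα⟩ := isCompact_Icc.exists_bound_of_continuousOn (hA.continuousOn (s := Icc τ T))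
  obtain ⟨β, hβ⟩ := (isCompact_Icc.prod isCompact_Icc).exists_bound_of_continuousOn
    (hk.continuousOn (s := Icc τ T ×ˢ Icc τ T))
  obtain ⟨c, hc⟩ := isCompact_Icc.exists_bound_of_continuousOn hh
  obtain ⟨w, hw, hw0, hw', -⟩ := exists_hasDerivWithinAt_volterra (α := α.toNNReal)
    (β := β.toNNReal) hτ hA.continuousOn hk hh (fun t ht => (hα t ht).trans (Real.le_coe_toNNReal _))
    (fun r hr s hs => (hβ (r, s) ⟨hr, hs⟩).trans (Real.le_coe_toNNReal _)) hc ξ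
  refine ⟨w, hw, hw0, fun t ht => (hw' t ht).congr_deriv ?_⟩
  have hQt : Q t = fun l => P t (present, l) := by
    funext l
    simp only [Q, projIcc_of_mem hτ ht]
  have i1 : IntervalIntegrable (fun s => drift A N t (past hT s) (w s)) volume τ t :=
    (continuous_apply_past hw (continuous_drift_apply hN t)).intervalIntegrable _ _
  have i2 : IntervalIntegrable (fun s => P t (present, past hT s) (w s)) volume τ t :=
    (continuous_apply_past hw (continuous_row (P t) present)).intervalIntegrable _ _
  have e1 : ∫ s in τ..t, (drift A N t (past hT s) - D ∘L P t (present, past hT s)) (w s)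
      = (∫ s in τ..t, drift A N t (past hT s) (w s))
        - D (∫ s in τ..t, P t (present, past hT s) (w s)) := by
    rw [← D.intervalIntegral_comp_comm i2, ← intervalIntegral.integral_sub i1]
    · rfl
    · exact (D.continuous.comp (continuous_apply_past hw
        (continuous_row (P t) present))).intervalIntegrable _ _
  rw [costate_apply hw]
  simp only [hQt]
  rw [e1]
  simp only [statePairing, map_add, drift, present, Sum.elim_inl, hD, sub_apply,
    ContinuousLinearMap.comp_apply]
  abel

theorem statePairing_realInnerCLM_comp {t : ℝ} (hw : Continuous w) {X : KernelIndex T → E →L[ℝ] E}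
    (hX : Continuous X) (x : E) :
    statePairing hT m w τ t (fun k => realInnerCLM E x ∘L X k)
      = inner ℝ x (statePairing hT m w τ t X) :=
  statePairing_comp hw hX (realInnerCLM E x)

/-- Transposing the drift from the costate to the state recovers the actual drift of the trajectory,
ready to cancel against w' in the derivative of the value. -/
theorem statePairing_innerKernel_costateField {t : ℝ} (hN : Continuous N) (hw : Continuous w) (z : Y)
    (p : VecKernel T E) :
    statePairing hT m w τ t (innerKernel T E (costateField hT A hN C t z p))
      = -inner ℝ (p present) (statePairing hT m w τ t (drift A N t))
        - inner ℝ (p (past hT t) + (C†) z) (w t) := by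
  have e : (innerKernel T E (costateField hT A hN C t z p) : KernelIndex T → E →L[ℝ] ℝ)
      = fun k => -(realInnerCLM E (p present) ∘L drift A N t k)
        - presence k • (realInnerCLM E (p (past hT t) + (C†) z)) := by
    funext k
    ext x
    simp [innerKernel_apply, costateField_apply, ContinuousLinearMap.adjoint_inner_left]
  have hG := continuous_drift_apply (T := T) (A := A) hN t
  have c1 : Continuous fun k => -(realInnerCLM E (p present) ∘L drift A N t k) :=
    (continuous_const.clm_comp hG).neg
  have c2 : Continuous fun k : KernelIndex T =>
    presence k • (realInnerCLM E (p (past hT t) + (C†) z)) :=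
    continuous_presence.smul continuous_const
  rw [e, statePairing_sub hw c1 c2, statePairing_neg, statePairing_realInnerCLM_comp hw hG,
    statePairing_presence_smul]
  simp only [realInnerCLM_apply]

theorem statePairing_innerKernel_signalField {t : ℝ} (hN : Continuous N) (hw : Continuous w) (y : Y)
    {P : C(KernelIndex T × KernelIndex T, E →L[ℝ] E)} (hP : ∀ k l, (P (k, l))† = P (l, k))
    (d : VecKernel T E) :
    statePairing hT m w τ t (innerKernel T E (signalField hT A hN B C t y P d))
      = inner ℝ (B ((B†) (d present))) (statePairing hT m w τ t fun l => P (present, l))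
        - inner ℝ (d present) (statePairing hT m w τ t (drift A N t))
        - inner ℝ (d (past hT t) - (C†) y) (w t) := by
  have e : (innerKernel T E (signalField hT A hN B C t y P d) : KernelIndex T → E →L[ℝ] ℝ)
      = fun k => realInnerCLM E (B ((B†) (d present))) ∘L P (present, k)
        - realInnerCLM E (d present) ∘L drift A N t k
        - presence k • (realInnerCLM E (d (past hT t) - (C†) y)) := by
    funext k
    ext x
    have h : inner ℝ (P (k, present) (B ((B†) (d present)))) x
        = inner ℝ (B ((B†) (d present))) (P (present, k) x) := by
      rw [← hP present k, ContinuousLinearMap.adjoint_inner_left]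
    simp [innerKernel_apply, signalField_apply, h, ContinuousLinearMap.adjoint_inner_left]
  have hG := continuous_drift_apply (T := T) (A := A) hN t
  have hR := continuous_row P present
  have c1 : Continuous fun k => realInnerCLM E (B ((B†) (d present))) ∘L P (present, k) :=
    continuous_const.clm_comp hR
  have c2 : Continuous fun k => realInnerCLM E (d present) ∘L drift A N t k :=
    continuous_const.clm_comp hG
  have c3 : Continuous fun k => realInnerCLM E (B ((B†) (d present))) ∘L P (present, k)
      - realInnerCLM E (d present) ∘L drift A N t k := c1.sub c2
  have c4 : Continuous fun k : KernelIndex T =>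
    presence k • (realInnerCLM E (d (past hT t) - (C†) y)) :=
    continuous_presence.smul continuous_const
  rw [e, statePairing_sub hw c3 c4, statePairing_sub hw c1 c2,
    statePairing_realInnerCLM_comp hw hG, statePairing_realInnerCLM_comp hw hR,
    statePairing_presence_smul]
  simp only [realInnerCLM_apply]

/-- The value of the quadratic polynomial with the coefficients `P`, `d` and `M` in the state at time
`t`. -/
noncomputable def stateValue (hT : 0 ≤ T) (m : Memory T E) (w : ℝ → E) (τ t : ℝ)
    (P : C(KernelIndex T × KernelIndex T, E →L[ℝ] E)) (d : VecKernel T E) (M : ℝ) : ℝ :=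
  statePairing hT m w τ t (innerKernel T E (costate hT m w τ t P d + d)) + M

/-- `d` solves the equation for the terms which depend on the signal on `[a, T]`, with final value
`0`. -/
structure SolvesSignalKernel (hT : 0 ≤ T) (A : E →L[ℝ] E) {N : ℝ → E →L[ℝ] E} (hN : Continuous N)
    (B : U →L[ℝ] E) (C : E →L[ℝ] Y) (y : ℝ → Y) (a : ℝ)
    (P : ℝ → C(KernelIndex T × KernelIndex T, E →L[ℝ] E)) (d : ℝ → VecKernel T E) : Prop where
  final : d T = 0
  deriv : ∀ t ∈ Icc a T,
    HasDerivWithinAt d (signalField hT A hN B C t (y t) (P t) (d t)) (Icc a T) t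

/-- The quadratic polynomial is the pairing of p + d with the state, plus M. In its derivative the
drift and the boundary terms cancel. In what remains, ‖B* d₁‖² from M removes the terms in d, and
-‖y‖² completes the square ‖C w - y‖². -/
theorem hasDerivWithinAt_stateValue {hN : Continuous N} {y : ℝ → Y} {M : ℝ → ℝ} {t : ℝ}
    (hP : SolvesRiccati hT A hN B C τ P) (hd : SolvesSignalKernel hT A hN B C y τ P d)
    (hw : Continuous w) (ht : t ∈ Icc τ T)
    (hM : HasDerivWithinAt M (‖(B†) (d t present)‖ ^ 2 - ‖y t‖ ^ 2) (Icc τ T) t)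
    (hw' : HasDerivWithinAt w (statePairing hT m w τ t (drift A N t)
      - B ((B†) (costate hT m w τ t (P t) (d t) present))) (Icc τ T) t) :
    HasDerivWithinAt (fun r => stateValue hT m w τ r (P r) (d r) (M r))
      (-(‖C (w t) - y t‖ ^ 2 + ‖(B†) (costate hT m w τ t (P t) (d t) present)‖ ^ 2))
      (Icc τ T) t := by
  have hsymm := hP.adjoint_apply ht
  have h1 := (hasDerivWithinAt_costate hN hw ht hsymm (hP.deriv t ht) (hd.deriv t ht) hw').add
    (hd.deriv t ht)
  have h2 := HasNormDerivWithinAt.clm h1 (innerKernel T E)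
  have h3 := (hasDerivWithinAt_statePairing (hT := hT) (m := m) hw ht hw' h2).add hM
  refine h3.congr_deriv ?_
  have e : ∀ f g : VecKernel T E, (innerKernel T E (f + g) : KernelIndex T → E →L[ℝ] ℝ)
      = fun k => innerKernel T E f k + innerKernel T E g k := fun f g => by
    rw [map_add]; rfl
  rw [e, statePairing_add hw (innerKernel T E _).continuous (innerKernel T E _).continuous,
    statePairing_innerKernel_costateField hN hw, statePairing_innerKernel_signalField hN hw _ hsymm]
  simp only [Pi.add_apply, innerKernel_apply, realInnerCLM_apply, VecKernel.add_apply]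
  have hp := costate_apply (hT := hT) (m := m) (τ := τ) (t := t) (P := P t) hw (d t) present
  rw [← sub_eq_iff_eq_add] at hp
  rw [← hp]
  set p := costate hT m w τ t (P t) (d t)
  set g := statePairing hT m w τ t (drift A N t)
  have f1 : ∀ a b : E, inner ℝ a (B ((B†) b)) = inner ℝ ((B†) a) ((B†) b) := fun a b => by
    rw [ContinuousLinearMap.adjoint_inner_left]
  have f2 : ∀ a b : E, inner ℝ (B ((B†) a)) b = inner ℝ ((B†) a) ((B†) b) := fun a b => by
    rw [ContinuousLinearMap.adjoint_inner_right]
  have f3 : ∀ z : Y, inner ℝ ((C†) z) (w t) = inner ℝ z (C (w t)) := fun z =>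
    ContinuousLinearMap.adjoint_inner_left _ _ _
  simp only [inner_add_left, inner_sub_left, inner_sub_right, f1, f2, f3, map_sub, map_add]
  rw [norm_sub_sq_real, ← real_inner_self_eq_norm_sq, ← real_inner_self_eq_norm_sq (C (w t)),
    ← real_inner_self_eq_norm_sq ((B†) (p present)), real_inner_comm (y t)]
  ring

/-- The cost of the optimal feedback. -/
theorem integral_cost_eq_stateValue {hN : Continuous N} {y : ℝ → Y} {M : ℝ → ℝ}
    (hτ : τ ≤ T) (hy : ContinuousOn y (Icc τ T))
    (hP : SolvesRiccati hT A hN B C τ P) (hd : SolvesSignalKernel hT A hN B C y τ P d)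
    (hw : Continuous w)
    (hM : ∀ t ∈ Icc τ T, HasDerivWithinAt M (‖(B†) (d t present)‖ ^ 2 - ‖y t‖ ^ 2) (Icc τ T) t)
    (hMT : M T = 0)
    (hw' : ∀ t ∈ Icc τ T, HasDerivWithinAt w (statePairing hT m w τ t (drift A N t)
      - B ((B†) (costate hT m w τ t (P t) (d t) present))) (Icc τ T) t) :
    ∫ t in τ..T, (‖C (w t) - y t‖ ^ 2 + ‖(B†) (costate hT m w τ t (P t) (d t) present)‖ ^ 2)
      = stateValue hT m w τ τ (P τ) (d τ) (M τ) := by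
  have hp : ContinuousOn (fun t => costate hT m w τ t (P t) (d t)) (Icc τ T) := fun t ht =>
    (hasDerivWithinAt_costate hN hw ht (hP.adjoint_apply ht) (hP.deriv t ht) (hd.deriv t ht)
      (hw' t ht)).continuousWithinAt
  have hp0 := VecKernel.continuousOn_apply hp (continuousOn_const (c := present))
  have h := integral_eq_sub_of_hasDerivWithinAt_Icc hτ
    (fun t ht => hasDerivWithinAt_stateValue hP hd hw ht (hM t ht) (hw' t ht))
    (((((C.continuous.comp hw).continuousOn.sub hy).norm.pow 2).add
      (((B†).continuous.comp_continuousOn hp0).norm.pow 2)).neg)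
  rw [intervalIntegral.integral_neg] at h
  have hfin : stateValue hT m w τ T (P T) (d T) (M T) = 0 := by
    have e : (innerKernel T E 0 : KernelIndex T → E →L[ℝ] ℝ) = fun _ => 0 := by
      funext k
      exact map_zero (realInnerCLM E)
    rw [hP.final, hd.final, hMT, stateValue, costate_zero, add_zero, add_zero, e, statePairing_zero]
  rw [hfin] at h
  linarith

end ClosedLoop

/-! ### Comparison of a control with the optimal feedback -/

section Comparison

variable {T : ℝ} {E U Y : Type*} [NormedAddCommGroup E] [InnerProductSpace ℝ E]
  [NormedAddCommGroup U] [InnerProductSpace ℝ U]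
  [NormedAddCommGroup Y] [InnerProductSpace ℝ Y]

theorem memLp_two_of_continuousOn {F : Type*} [NormedAddCommGroup F] {f : ℝ → F} {a b : ℝ}
    (hf : ContinuousOn f (Icc a b)) : MemLp f 2 (volume.restrict (Ioc a b)) := by
  obtain ⟨c, hc⟩ := isCompact_Icc.exists_bound_of_continuousOn hf
  refine MemLp.of_bound ((hf.mono Ioc_subset_Icc_self).aestronglyMeasurable measurableSet_Ioc) c ?_
  filter_upwards [ae_restrict_mem measurableSet_Ioc] with t ht
  exact hc t (Ioc_subset_Icc_self ht)

/-- `z` is the trajectory of the control `v` with the initial value `ξ` and the initial memory `m`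
at time `τ`. -/
def SolvesState (hT : 0 ≤ T) (A : E →L[ℝ] E) (N : ℝ → E →L[ℝ] E) (B : U →L[ℝ] E) (m : Memory T E)
    (τ : ℝ) (ξ : E) (v : ℝ → U) (z : ℝ → E) : Prop :=
  ∀ t ∈ Icc τ T, z t = ξ + ∫ r in τ..t, (statePairing hT m z τ r (drift A N r) + B (v r))

theorem continuous_statePairing {F Z : Type*} [NormedAddCommGroup F] [NormedSpace ℝ F]
    [TopologicalSpace Z] [FirstCountableTopology Z] (hT : 0 ≤ T) (m : Memory T E) {w : ℝ → E}
    (hw : Continuous w) {τ : ℝ} {X : Z → KernelIndex T → E →L[ℝ] F}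
    (hX : Continuous fun q : Z × KernelIndex T => X q.1 q.2) {t : Z → ℝ} (ht : Continuous t) :
    Continuous fun z => statePairing hT m w τ (t z) (X z) := by
  have h1 : Continuous fun z => X z present (w (t z)) :=
    (hX.comp (continuous_id.prodMk continuous_const)).clm_apply (hw.comp ht)
  have h2 : Continuous fun q : Z × ℝ => X q.1 (past hT q.2) (w q.2) :=
    (hX.comp (continuous_fst.prodMk ((continuous_past hT).comp continuous_snd))).clm_apply
      (hw.comp continuous_snd)
  exact (h1.add (m.continuous_pair hX)).add
    (intervalIntegral.continuous_parametric_intervalIntegral_of_continuous h2 ht)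

/-- Both trajectories carry the same initial memory, which drops out of the difference. -/
theorem statePairing_sub_statePairing {F : Type*} [NormedAddCommGroup F] [NormedSpace ℝ F]
    {hT : 0 ≤ T} {m : Memory T E} {w z : ℝ → E} (hw : Continuous w) (hz : Continuous z) {τ t : ℝ}
    {X : KernelIndex T → E →L[ℝ] F} (hX : Continuous X) :
    statePairing hT m z τ t X - statePairing hT m w τ t X
      = X present (z t - w t) + ∫ s in τ..t, X (past hT s) (z s - w s) := by
  simp only [statePairing, map_sub]
  rw [intervalIntegral.integral_sub ((continuous_apply_past hz hX).intervalIntegrable _ _)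
    ((continuous_apply_past hw hX).intervalIntegrable _ _)]
  abel

variable [CompleteSpace E] [CompleteSpace U] [CompleteSpace Y] {hT : 0 ≤ T} {m : Memory T E}
  {w z : ℝ → E} {v : ℝ → U} {y : ℝ → Y} {τ : ℝ} {ξ : E} {A : E →L[ℝ] E} {N : ℝ → E →L[ℝ] E}
  {B : U →L[ℝ] E} {C : E →L[ℝ] Y} {p : ℝ → VecKernel T E}

/-- The first-order condition for the control which is given by a costate. -/
theorem integral_inner_control_eq (hτ : τ ≤ T) (hN : Continuous N) (hy : ContinuousOn y (Icc τ T))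
    (hp : ∀ t ∈ Icc τ T,
      HasDerivWithinAt p (costateField hT A hN C t (C (w t) - y t) (p t)) (Icc τ T) t)
    (hpT : p T = 0) (hw : Continuous w)
    (hw' : SolvesState hT A N B m τ ξ (fun t => -(B†) (p t present)) w)
    (hv : MemLp v 2 (volume.restrict (Ioc τ T))) (hz : Continuous z)
    (hz' : SolvesState hT A N B m τ ξ v z) :
    ∫ t in τ..T, (inner ℝ (v t + (B†) (p t present)) ((B†) (p t present))
      - inner ℝ (C (z t - w t)) (C (w t) - y t)) = 0 := by
  have hpc : ContinuousOn p (Icc τ T) := fun t ht => (hp t ht).continuousWithinAt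
  have hp0 := VecKernel.continuousOn_apply hpc (continuousOn_const (c := present))
  have hpp := VecKernel.continuousOn_apply hpc (continuous_past hT).continuousOn
  have hδ : Continuous fun t => z t - w t := hz.sub hw
  have hG := continuous_drift (T := T) (A := A) hN
  have hGz := continuous_statePairing hT m hz (τ := τ) hG continuous_id
  have hGw := continuous_statePairing hT m hw (τ := τ) hG continuous_id
  have hvi : IntervalIntegrable v volume τ T := by
    rw [intervalIntegrable_iff_integrableOn_Ioc_of_le hτ]
    exact hv.integrable one_le_two
  have hui : IntervalIntegrable (fun t => (B†) (p t present)) volume τ T :=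
    ((B†).continuous.comp_continuousOn hp0).intervalIntegrable_of_Icc hτ
  set g : ℝ → E := fun r => (statePairing hT m z τ r (drift A N r)
    - statePairing hT m w τ r (drift A N r)) + B (v r + (B†) (p r present)) with hg
  have hBi : ∀ {f : ℝ → U} {a b : ℝ}, IntervalIntegrable f volume a b →
      IntervalIntegrable (fun t => B (f t)) volume a b := fun hf =>
    ⟨B.integrable_comp hf.1, B.integrable_comp hf.2⟩
  have hgi : IntervalIntegrable g volume τ T :=
    ((hGz.sub hGw).intervalIntegrable _ _).add (hBi (hvi.add hui))
  have hgδ : ∀ t ∈ Icc τ T, ∫ r in τ..t, g r = z t - w t := fun t ht => by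
    have hsub : uIcc τ t ⊆ uIcc τ T := by
      rw [uIcc_of_le hτ, uIcc_of_le ht.1]
      exact Icc_subset_Icc_right ht.2
    have i1 : IntervalIntegrable (fun r => statePairing hT m z τ r (drift A N r) + B (v r))
        volume τ t := (hGz.intervalIntegrable _ _).add (hBi (hvi.mono_set hsub))
    have i2 : IntervalIntegrable (fun r => statePairing hT m w τ r (drift A N r)
        + B (-(B†) (p r present))) volume τ t :=
      (hGw.intervalIntegrable _ _).add (hBi (hui.neg.mono_set hsub))
    rw [hz' t ht, hw' t ht, add_sub_add_left_eq_sub, ← intervalIntegral.integral_sub i1 i2]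
    refine intervalIntegral.integral_congr fun r _ => ?_
    simp only [hg, map_add, map_neg]
    abel
  have hp0' : ∀ t ∈ Icc τ T, HasDerivWithinAt (fun r => p r present)
      (costateField hT A hN C t (C (w t) - y t) (p t) present) (Icc τ T) t := fun t ht => by
    have h := HasNormDerivWithinAt.clm (hp t ht) (VecKernel.evalCLM (present : KernelIndex T))
    exact h
  have hCw : ContinuousOn (fun t => C (w t) - y t) (Icc τ T) :=
    (C.continuous.comp hw).continuousOn.sub hy
  have hp0c : ContinuousOn (fun t => costateField hT A hN C t (C (w t) - y t) (p t) present)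
      (Icc τ T) := by
    have e : ∀ t, costateField hT A hN C t (C (w t) - y t) (p t) present
        = -(A†) (p t present) - (p t (past hT t) + (C†) (C (w t) - y t)) := fun t => by
      simp [costateField_apply, drift, presence]
    simp only [e]
    exact ((A†).continuous.comp_continuousOn hp0).neg.sub
      (hpp.add ((C†).continuous.comp_continuousOn hCw))
  -- First identity: the product of z - w with the present component of p vanishes at τ and at T.
  -- Since v is only square integrable, z - w is treated as a primitive.
  have ibp := integral_inner_add_inner_primitive hτ hp0' hp0c hgi
  rw [hpT, VecKernel.zero_apply, inner_zero_right] at ibp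
  -- Second identity: the pairing of the past components of p with z - w on [τ, t] also vanishes at
  -- both ends. Its derivative supplies the memory terms that cancel those of the first identity.
  have hS : ∀ t ∈ Icc τ T, HasDerivWithinAt
      (fun r => ∫ s in τ..r, innerKernel T E (p r) (past hT s) (z s - w s))
      (-inner ℝ (p t present) (∫ s in τ..t, drift A N t (past hT s) (z s - w s))
        + inner ℝ (p t (past hT t)) (z t - w t)) (Icc τ T) t := fun t ht => by
    have h1 := HasNormDerivWithinAt.clm (hp t ht) (innerKernel T E)
    refine (hasDerivWithinAt_integral_past (hT := hT) hδ ht h1).congr_deriv ?_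
    have i : IntervalIntegrable (fun s => drift A N t (past hT s) (z s - w s)) volume τ t :=
      (continuous_apply_past hδ (continuous_drift_apply hN t)).intervalIntegrable _ _
    rw [innerKernel_apply, realInnerCLM_apply]
    congr 1
    rw [← realInnerCLM_apply, ← (realInnerCLM E (p t present)).intervalIntegral_comp_comm i,
      ← intervalIntegral.integral_neg]
    refine intervalIntegral.integral_congr fun s _ => ?_
    simp [innerKernel_apply, costateField_apply, past, presence,
      ContinuousLinearMap.adjoint_inner_left]
  have hS0 : ContinuousOn (fun t => -inner ℝ (p t present)
      (∫ s in τ..t, drift A N t (past hT s) (z s - w s))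
        + inner ℝ (p t (past hT t)) (z t - w t)) (Icc τ T) := by
    have h2 : Continuous fun q : ℝ × ℝ => drift A N q.1 (past hT q.2) (z q.2 - w q.2) :=
      (hG.comp (continuous_fst.prodMk ((continuous_past hT).comp continuous_snd))).clm_apply
        (hδ.comp continuous_snd)
    exact (hp0.inner (𝕜 := ℝ) (intervalIntegral.continuous_parametric_intervalIntegral_of_continuous
      h2 continuous_id).continuousOn).neg.add (hpp.inner (𝕜 := ℝ) hδ.continuousOn)
  have hSint := integral_eq_sub_of_hasDerivWithinAt_Icc hτ hS hS0
  have hST : ∫ s in τ..T, innerKernel T E (p T) (past hT s) (z s - w s) = 0 := by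
    simp [hpT]
  rw [hST, intervalIntegral.integral_same, sub_zero] at hSint
  have i1 : IntervalIntegrable (fun t => inner ℝ (g t) (p t present)
      + inner ℝ (∫ s in τ..t, g s) (costateField hT A hN C t (C (w t) - y t) (p t) present))
      volume τ T := by
    refine (intervalIntegrable_inner_of_continuousOn hτ hgi hp0).add
      (ContinuousOn.intervalIntegrable_of_Icc hτ (ContinuousOn.inner (𝕜 := ℝ) ?_ hp0c))
    exact hδ.continuousOn.congr hgδ
  have hsum := intervalIntegral.integral_add i1 (hS0.intervalIntegrable_of_Icc hτ)
  rw [ibp, hSint, add_zero] at hsum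
  refine Eq.trans (intervalIntegral.integral_congr fun t ht => ?_) hsum
  rw [uIcc_of_le hτ] at ht
  have hgt : g t = A (z t - w t) + (∫ s in τ..t, drift A N t (past hT s) (z s - w s))
      + B (v t + (B†) (p t present)) := by
    simp only [hg, statePairing_sub_statePairing hw hz (continuous_drift_apply hN t)]
    rfl
  simp only [hgδ t ht, hgt]
  simp only [costateField_apply, drift, presence, present, Sum.elim_inl, one_smul, inner_add_left,
    inner_sub_right, inner_neg_right, inner_add_right, map_add,
    ContinuousLinearMap.adjoint_inner_right]
  rw [real_inner_comm (p t (past hT t)) (z t - w t), real_inner_comm (p t (Sum.inl ()))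
    (∫ s in τ..t, _)]
  simp only [inner_sub_right]
  ring

/-- The cost of an arbitrary control in terms of the cost of the control which is given by a
costate. -/
theorem integral_cost_eq_add (hτ : τ ≤ T) (hN : Continuous N) (hy : ContinuousOn y (Icc τ T))
    (hp : ∀ t ∈ Icc τ T,
      HasDerivWithinAt p (costateField hT A hN C t (C (w t) - y t) (p t)) (Icc τ T) t)
    (hpT : p T = 0) (hw : Continuous w)
    (hw' : SolvesState hT A N B m τ ξ (fun t => -(B†) (p t present)) w)
    (hv : MemLp v 2 (volume.restrict (Ioc τ T))) (hz : Continuous z)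
    (hz' : SolvesState hT A N B m τ ξ v z) :
    ∫ t in τ..T, (‖C (z t) - y t‖ ^ 2 + ‖v t‖ ^ 2)
      = (∫ t in τ..T, (‖C (w t) - y t‖ ^ 2 + ‖(B†) (p t present)‖ ^ 2))
        + ((∫ t in τ..T, ‖C (z t - w t)‖ ^ 2) + ∫ t in τ..T, ‖v t + (B†) (p t present)‖ ^ 2) := by
  have hpc : ContinuousOn p (Icc τ T) := fun t ht => (hp t ht).continuousWithinAt
  have hu : ContinuousOn (fun t => (B†) (p t present)) (Icc τ T) :=
    (B†).continuous.comp_continuousOn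
      (VecKernel.continuousOn_apply hpc (continuousOn_const (c := present)))
  have hδ : Continuous fun t => z t - w t := hz.sub hw
  have hCw : ContinuousOn (fun t => C (w t) - y t) (Icc τ T) :=
    (C.continuous.comp hw).continuousOn.sub hy
  have huL : MemLp (fun t => (B†) (p t present)) 2 (volume.restrict (Ioc τ T)) :=
    memLp_two_of_continuousOn hu
  have hvu : MemLp (fun t => v t + (B†) (p t present)) 2 (volume.restrict (Ioc τ T)) := hv.add huL
  have i1 : IntervalIntegrable (fun t => ‖C (w t) - y t‖ ^ 2 + ‖(B†) (p t present)‖ ^ 2)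
      volume τ T := ((hCw.norm.pow 2).add (hu.norm.pow 2)).intervalIntegrable_of_Icc hτ
  have i2 : IntervalIntegrable (fun t => ‖C (z t - w t)‖ ^ 2) volume τ T :=
    ((C.continuous.comp hδ).norm.pow 2).intervalIntegrable _ _
  have i3 : IntervalIntegrable (fun t => ‖v t + (B†) (p t present)‖ ^ 2) volume τ T := by
    rw [intervalIntegrable_iff_integrableOn_Ioc_of_le hτ]
    exact (memLp_two_iff_integrable_sq_norm hvu.1).1 hvu
  have i4 : IntervalIntegrable (fun t => inner ℝ (v t + (B†) (p t present)) ((B†) (p t present))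
      - inner ℝ (C (z t - w t)) (C (w t) - y t)) volume τ T := by
    refine (intervalIntegrable_inner_of_continuousOn hτ ?_ hu).sub
      (ContinuousOn.intervalIntegrable_of_Icc hτ
        (ContinuousOn.inner (𝕜 := ℝ) (C.continuous.comp hδ).continuousOn hCw))
    rw [intervalIntegrable_iff_integrableOn_Ioc_of_le hτ]
    exact hvu.integrable one_le_two
  have h0 := integral_inner_control_eq hτ hN hy hp hpT hw hw' hv hz hz'
  rw [← intervalIntegral.integral_add i2 i3, ← intervalIntegral.integral_add i1 (i2.add i3)]
  -- Expanding the squares around w and u leaves twice the integral which vanishes by the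
  -- first-order condition.
  have h1 : ∫ t in τ..T, (‖C (z t) - y t‖ ^ 2 + ‖v t‖ ^ 2)
      = (∫ t in τ..T, (‖C (z t) - y t‖ ^ 2 + ‖v t‖ ^ 2))
        + 2 * ∫ t in τ..T, (inner ℝ (v t + (B†) (p t present)) ((B†) (p t present))
          - inner ℝ (C (z t - w t)) (C (w t) - y t)) := by rw [h0]; ring
  have e : ∀ t, ‖C (z t) - y t‖ ^ 2 + ‖v t‖ ^ 2
      = (‖C (w t) - y t‖ ^ 2 + ‖(B†) (p t present)‖ ^ 2
        + (‖C (z t - w t)‖ ^ 2 + ‖v t + (B†) (p t present)‖ ^ 2))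
        - 2 * (inner ℝ (v t + (B†) (p t present)) ((B†) (p t present))
          - inner ℝ (C (z t - w t)) (C (w t) - y t)) := fun t => by
    have e1 : C (z t) - y t = C (z t - w t) + (C (w t) - y t) := by rw [map_sub]; abel
    have e2 := norm_sub_sq_real (v t + (B†) (p t present)) ((B†) (p t present))
    rw [add_sub_cancel_right] at e2
    rw [e1, norm_add_sq_real, e2]
    ring
  simp only [e]
  rw [intervalIntegral.integral_sub (i1.add (i2.add i3)) (i4.const_mul 2),
    intervalIntegral.integral_const_mul, h0, mul_zero, sub_zero]

end Comparison

/-! ### The value function in terms of a solution of the Riccati equation -/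

section Optimality

variable {T : ℝ} {E U Y : Type*} [NormedAddCommGroup E] [InnerProductSpace ℝ E]
  [NormedAddCommGroup U] [InnerProductSpace ℝ U]
  [NormedAddCommGroup Y] [InnerProductSpace ℝ Y]
  {hT : 0 ≤ T} {m : Memory T E} {w z : ℝ → E} {τ : ℝ} {ξ : E} {A : E →L[ℝ] E} {N : ℝ → E →L[ℝ] E}
  {B : U →L[ℝ] E} {C : E →L[ℝ] Y}

theorem solvesState_of_hasDerivWithinAt [CompleteSpace E] {v : ℝ → U} (hN : Continuous N)
    (hv : ContinuousOn v (Icc τ T)) (hz : Continuous z) (hzτ : z τ = ξ)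
    (hz' : ∀ t ∈ Icc τ T, HasDerivWithinAt z (statePairing hT m z τ t (drift A N t) + B (v t))
      (Icc τ T) t) :
    SolvesState hT A N B m τ ξ v z := fun t ht => by
  have hsub : Icc τ t ⊆ Icc τ T := Icc_subset_Icc_right ht.2
  have h := integral_eq_sub_of_hasDerivWithinAt_Icc ht.1
    (fun r hr => (hz' r (hsub hr)).mono hsub)
    ((continuous_statePairing hT m hz (continuous_drift hN) continuous_id).continuousOn.add
      (B.continuous.comp_continuousOn (hv.mono hsub)))
  rw [← sub_eq_iff_eq_add', ← hzτ]
  exact h.symm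

/-- The value of the quadratic polynomial with the coefficients `P`, `d` and `M` in the initial datum
with the present value `ξ` and the memory `m`. -/
noncomputable def dataValue (hT : 0 ≤ T) (m : Memory T E) (ξ : E)
    (P : C(KernelIndex T × KernelIndex T, E →L[ℝ] E)) (d : VecKernel T E) (M : ℝ) : ℝ :=
  stateValue hT m (fun _ => ξ) 0 0 P d M

theorem statePairing_self {F : Type*} [NormedAddCommGroup F] [NormedSpace ℝ F]
    (X : KernelIndex T → E →L[ℝ] F) :
    statePairing hT m w τ τ X = X present (w τ) + m.pair X := by
  simp [statePairing]

theorem stateValue_self (P : C(KernelIndex T × KernelIndex T, E →L[ℝ] E)) (d : VecKernel T E)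
    (M : ℝ) : stateValue hT m w τ τ P d M = dataValue hT m (w τ) P d M := by
  simp only [dataValue, stateValue, costate, statePairing_self]

theorem dataValue_eq (P : C(KernelIndex T × KernelIndex T, E →L[ℝ] E)) (d : VecKernel T E) (M : ℝ) :
    dataValue hT m ξ P d M
      = statePairing hT m (fun _ => ξ) 0 0
        (innerKernel T E (costate hT m (fun _ => ξ) 0 0 P d + d)) + M := rfl

variable [CompleteSpace E] [CompleteSpace U] [CompleteSpace Y]
  {P : ℝ → C(KernelIndex T × KernelIndex T, E →L[ℝ] E)} {d : ℝ → VecKernel T E}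

/-- The optimal control and its trajectory. -/
theorem exists_optimal {hN : Continuous N} {y : ℝ → Y} {M : ℝ → ℝ} (hτ : τ ≤ T)
    (hy : ContinuousOn y (Icc τ T)) (hP : SolvesRiccati hT A hN B C τ P)
    (hd : SolvesSignalKernel hT A hN B C y τ P d)
    (hM : ∀ t ∈ Icc τ T, HasDerivWithinAt M (‖(B†) (d t present)‖ ^ 2 - ‖y t‖ ^ 2) (Icc τ T) t)
    (hMT : M T = 0) (m : Memory T E) (ξ : E) :
    ∃ (u : ℝ → U) (w : ℝ → E), Continuous w ∧ ContinuousOn u (Icc τ T) ∧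
      (∀ t, u t = -(B†) (costate hT m w τ t (P t) (d t) present)) ∧
      SolvesState hT A N B m τ ξ u w ∧
      ∫ t in τ..T, (‖C (w t) - y t‖ ^ 2 + ‖u t‖ ^ 2) = dataValue hT m ξ (P τ) (d τ) (M τ) ∧
      ∀ (v : ℝ → U) (z : ℝ → E), MemLp v 2 (volume.restrict (Ioc τ T)) → Continuous z →
        SolvesState hT A N B m τ ξ v z →
        ∫ t in τ..T, (‖C (z t) - y t‖ ^ 2 + ‖v t‖ ^ 2) = dataValue hT m ξ (P τ) (d τ) (M τ)
          + ((∫ t in τ..T, ‖C (z t - w t)‖ ^ 2) + ∫ t in τ..T, ‖v t - u t‖ ^ 2) := by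
  obtain ⟨w, hw, hwτ, hw'⟩ := exists_closedLoop (A := A) (B := B) hτ hN
    hP.deriv (fun t ht => (hd.deriv t ht).continuousWithinAt) m ξ
  have hp : ∀ t ∈ Icc τ T, HasDerivWithinAt (fun t => costate hT m w τ t (P t) (d t))
      (costateField hT A hN C t (C (w t) - y t) (costate hT m w τ t (P t) (d t))) (Icc τ T) t :=
    fun t ht => hasDerivWithinAt_costate hN hw ht (hP.adjoint_apply ht) (hP.deriv t ht)
      (hd.deriv t ht) (hw' t ht)
  have hpT : costate hT m w τ T (P T) (d T) = 0 := by
    rw [hP.final, hd.final]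
    exact costate_zero
  have hu : ContinuousOn (fun t => -(B†) (costate hT m w τ t (P t) (d t) present)) (Icc τ T) :=
    ((B†).continuous.comp_continuousOn (VecKernel.continuousOn_apply
      (fun t ht => (hp t ht).continuousWithinAt) (continuousOn_const (c := present)))).neg
  have hws : SolvesState hT A N B m τ ξ
      (fun t => -(B†) (costate hT m w τ t (P t) (d t) present)) w :=
    solvesState_of_hasDerivWithinAt hN hu hw hwτ fun t ht => by
      simpa only [map_neg, ← sub_eq_add_neg] using hw' t ht
  have hcost := integral_cost_eq_stateValue hτ hy hP hd hw hM hMT hw'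
  rw [stateValue_self, hwτ] at hcost
  refine ⟨_, w, hw, hu, fun t => rfl, hws, by simpa only [norm_neg] using hcost,
    fun v z hv hz hz' => ?_⟩
  simp only [sub_neg_eq_add]
  rw [← hcost]
  exact integral_cost_eq_add hτ hN hy hp hpT hw hws hv hz hz'

end Optimality

/-! ### Solvability of the Riccati equation -/

section Existence

open scoped NNReal

variable {T : ℝ} {E U Y : Type*} [NormedAddCommGroup E] [InnerProductSpace ℝ E]
  [NormedAddCommGroup U] [InnerProductSpace ℝ U]
  [NormedAddCommGroup Y] [InnerProductSpace ℝ Y] {hT : 0 ≤ T}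

/-- The memory which consists of point masses at those of the two indices which lie in the past. -/
noncomputable def twoPoints (hT : 0 ≤ T) (k l : KernelIndex T) (e f : E) : Memory T E where
  Ω := Bool
  ν := Measure.count
  -- The location 0 assigned to the index `present` is immaterial, since the mass placed there is
  -- zero.
  κ := fun i => bif i then Sum.elim (fun _ => projIcc 0 T hT 0) id k
    else Sum.elim (fun _ => projIcc 0 T hT 0) id l
  η := fun i => bif i then (1 - presence k) • e else (1 - presence l) • f
  κ_measurable := measurable_of_finite _
  η_integrable := Integrable.of_finite

theorem integral_bool_count {F : Type*} [NormedAddCommGroup F] [NormedSpace ℝ F] [CompleteSpace F]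
    (f : Bool → F) : ∫ i, f i ∂Measure.count = f true + f false := by
  rw [integral_fintype .of_finite]
  simp

/-- The weights `presence` and 1 - `presence` send each vector either to the present component or to
a point mass in the memory, so present and past indices can be tested on the same footing. -/
theorem pair_twoPoints {F : Type*} [NormedAddCommGroup F] [NormedSpace ℝ F] [CompleteSpace F]
    (k l : KernelIndex T) (e f : E) (X : KernelIndex T → E →L[ℝ] F) :
    X present (presence k • e + presence l • f) + (twoPoints hT k l e f).pair X
      = X k e + X l f := by
  have h : (twoPoints hT k l e f).pair X
      = X (Sum.inr (Sum.elim (fun _ => projIcc 0 T hT 0) id k)) ((1 - presence k) • e)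
        + X (Sum.inr (Sum.elim (fun _ => projIcc 0 T hT 0) id l)) ((1 - presence l) • f) := by
    exact integral_bool_count fun i => X (Sum.inr ((twoPoints hT k l e f).κ i))
      ((twoPoints hT k l e f).η i)
  rw [h]
  rcases k with k | k <;> rcases l with l | l <;> simp [presence, add_comm]

theorem integral_norm_twoPoints_le {e f : E} (k l : KernelIndex T) :
    ∫ ω, ‖(twoPoints hT k l e f).η ω‖ ∂(twoPoints hT k l e f).ν ≤ ‖e‖ + ‖f‖ := by
  have h : ∫ ω, ‖(twoPoints hT k l e f).η ω‖ ∂(twoPoints hT k l e f).ν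
      = ‖(1 - presence k) • e‖ + ‖(1 - presence l) • f‖ := by
    exact integral_bool_count fun i => ‖(twoPoints hT k l e f).η i‖
  rw [h]
  have h1 : ∀ (k : KernelIndex T) (e : E), ‖(1 - presence k) • e‖ ≤ ‖e‖ := fun k e => by
    rcases k with k | k <;> simp [presence]
  exact add_le_add (h1 k e) (h1 l f)

variable [CompleteSpace E]

theorem dataValue_twoPoints (k l : KernelIndex T) (e f : E)
    (P : C(KernelIndex T × KernelIndex T, E →L[ℝ] E)) :
    dataValue hT (twoPoints hT k l e f) (presence k • e + presence l • f) P 0 0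
      = inner ℝ (P (k, k) e) e + inner ℝ (P (k, l) f) e + inner ℝ (P (l, k) e) f
        + inner ℝ (P (l, l) f) f := by
  have h : ∀ j, costate hT (twoPoints hT k l e f) (fun _ => presence k • e + presence l • f) 0 0 P 0 j
      = P (j, k) e + P (j, l) f := fun j => by
    rw [costate_apply continuous_const, statePairing_self, pair_twoPoints k l e f (fun l => P (j, l)),
      VecKernel.zero_apply, add_zero]
  rw [dataValue_eq, statePairing_self, pair_twoPoints, innerKernel_apply, innerKernel_apply]
  simp only [add_zero, realInnerCLM_apply, h, inner_add_left]
  ring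

theorem gronwallBound_mono_left {δ δ' K ε x : ℝ} (hK : 0 < K) (h : δ ≤ δ') :
    gronwallBound δ K ε x ≤ gronwallBound δ' K ε x := by
  rw [gronwallBound_of_K_ne_0 hK.ne', gronwallBound_of_K_ne_0 hK.ne']
  beta_reduce
  gcongr

variable [CompleteSpace U] [CompleteSpace Y] {A : E →L[ℝ] E} {N : ℝ → E →L[ℝ] E}
  {B : U →L[ℝ] E} {C : E →L[ℝ] Y} {P : ℝ → C(KernelIndex T × KernelIndex T, E →L[ℝ] E)} {τ : ℝ}

/-- The homogeneous quadratic form of a solution of the Riccati equation lies between `0` and the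
cost of the uncontrolled system. -/
theorem dataValue_mem_Icc {hN : Continuous N} {g : ℝ≥0} (hτ0 : 0 ≤ τ) (hτ : τ ≤ T)
    (hg : ∀ t ∈ Icc 0 T, ∀ k : KernelIndex T, ‖drift A N t k‖ ≤ g)
    (hP : SolvesRiccati hT A hN B C τ P) (m : Memory T E) {ξ : E} (hξ : ‖ξ‖ ≤ 2)
    (hm : ∫ ω, ‖m.η ω‖ ∂m.ν ≤ 2) :
    dataValue hT m ξ (P τ) 0 0
      ∈ Icc 0 (T * (‖C‖ * gronwallBound 2 (g + 1 + g) (g * 2) T) ^ 2) := by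
  -- For zero signal the signal terms and the scalar term may be taken to be zero, and the value is
  -- the pure quadratic form of P.
  have hd : SolvesSignalKernel hT A hN B C (fun _ => 0) τ P 0 := by
    refine ⟨rfl, fun t _ => ?_⟩
    have e : signalField hT A hN B C t 0 (P t) ((0 : ℝ → VecKernel T E) t) = 0 := by
      ext1 k
      simp [signalField_apply]
    rw [e]
    exact hasDerivWithinAt_const _ _ _
  obtain ⟨u, w, -, -, -, -, hcost, hmin⟩ := exists_optimal (M := fun _ => 0) hτ continuousOn_const hP
    hd (fun t _ => by simpa using hasDerivWithinAt_const t (Icc τ T) (0 : ℝ)) rfl m ξ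
  have hnn : ∀ f : ℝ → ℝ, (∀ t, 0 ≤ f t) → 0 ≤ ∫ t in τ..T, f t := fun f hf =>
    intervalIntegral.integral_nonneg hτ fun t _ => hf t
  constructor
  · exact hcost ▸ hnn _ fun t => by positivity
  have hsub : Icc τ T ⊆ Icc 0 T := Icc_subset_Icc_left hτ0
  have hG := continuous_drift (T := T) (A := A) hN
  -- The competitor is the zero control. The forcing bound g * 2 comes from a memory of total mass
  -- at most 2; the resulting bound on z does not involve P or τ.
  obtain ⟨z, hz, hzτ, hz', hzb⟩ := exists_hasDerivWithinAt_volterra (α := g) (β := g) (c := g * 2) hτ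
    (A := fun _ => A) (k := fun t s => drift A N t (past hT s)) (h := fun t => m.pair (drift A N t))
    continuousOn_const
    (hG.comp (continuous_fst.prodMk ((continuous_past hT).comp continuous_snd)))
    (m.continuous_pair hG).continuousOn (fun t ht => hg t (hsub ht) present)
    (fun r hr s _ => hg r (hsub hr) _)
    (fun t ht => (m.norm_pair_le (hg t (hsub ht))).trans (by gcongr)) ξ
  have hzs : SolvesState hT A N B m τ ξ (fun _ => 0) z :=
    solvesState_of_hasDerivWithinAt hN continuousOn_const hz hzτ fun t ht => by
      refine (hz' t ht).congr_deriv ?_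
      simp only [statePairing, map_zero, add_zero, drift, present, Sum.elim_inl]
      abel
  have h := hmin (fun _ => 0) z (memLp_const 0) hz hzs
  have h1 := hnn (fun t => ‖C (z t - w t)‖ ^ 2) fun t => by positivity
  have h2 := hnn (fun t => ‖0 - u t‖ ^ 2) fun t => by positivity
  have hz2 : ∀ t, ‖z t‖ ≤ gronwallBound 2 (g + 1 + g) (g * 2) T := fun t =>
    (hzb t).trans ((gronwallBound_mono_left (by positivity) hξ).trans
      (gronwallBound_mono (by norm_num) (by positivity) (by positivity) (by linarith)))
  have h3 : ∫ t in τ..T, (‖C (z t) - 0‖ ^ 2 + ‖(0 : U)‖ ^ 2)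
      ≤ ∫ _ in τ..T, (‖C‖ * gronwallBound 2 (g + 1 + g) (g * 2) T) ^ 2 := by
    refine intervalIntegral.integral_mono_on hτ (Continuous.intervalIntegrable (by fun_prop) _ _)
      intervalIntegrable_const fun t _ => ?_
    simp only [sub_zero, norm_zero, ne_eq, OfNat.ofNat_ne_zero, not_false_eq_true, zero_pow, add_zero]
    gcongr
    exact C.le_of_opNorm_le_of_le le_rfl (hz2 t)
  rw [intervalIntegral.integral_const, smul_eq_mul] at h3
  have h4 : (T - τ) * (‖C‖ * gronwallBound 2 (g + 1 + g) (g * 2) T) ^ 2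
      ≤ T * (‖C‖ * gronwallBound 2 (g + 1 + g) (g * 2) T) ^ 2 := by
    gcongr
    linarith
  simp only [Pi.zero_apply] at h
  linarith

/-- A form with values in [0, c] on the two-index states with vectors e, f and e, -f has its
off-diagonal entry controlled: subtracting the two values gives 4⟨P(k, l) f, e⟩ ≤ c. The unit vector
e is then chosen along P(k, l) f. -/
theorem SolvesRiccati.norm_apply_le {hN : Continuous N} {g : ℝ≥0} (hτ0 : 0 ≤ τ) (hτ : τ ≤ T)
    (hg : ∀ t ∈ Icc 0 T, ∀ k : KernelIndex T, ‖drift A N t k‖ ≤ g)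
    (hP : SolvesRiccati hT A hN B C τ P) :
    ‖P τ‖ ≤ T * (‖C‖ * gronwallBound 2 (g + 1 + g) (g * 2) T) ^ 2 := by
  set c := T * (‖C‖ * gronwallBound 2 (g + 1 + g) (g * 2) T) ^ 2 with hc
  have hc0 : 0 ≤ c := by positivity
  refine (ContinuousMap.norm_le _ hc0).2 fun q => ?_
  obtain ⟨k, l⟩ := q
  refine ContinuousLinearMap.opNorm_le_of_unit_norm hc0 fun f hf => ?_
  rcases eq_or_ne (P τ (k, l) f) 0 with h0 | h0
  · rw [h0, norm_zero]
    exact hc0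
  set e := ‖P τ (k, l) f‖⁻¹ • P τ (k, l) f with he
  have he1 : ‖e‖ = 1 := by
    rw [he, norm_smul, norm_inv, norm_norm, inv_mul_cancel₀ (norm_ne_zero_iff.2 h0)]
  have hie : inner ℝ (P τ (k, l) f) e = ‖P τ (k, l) f‖ := by
    rw [he, real_inner_smul_right, real_inner_self_eq_norm_sq, pow_two, inv_mul_cancel_left₀
      (norm_ne_zero_iff.2 h0)]
  have hs : ∀ (k : KernelIndex T) (e : E), ‖presence k • e‖ ≤ ‖e‖ := fun k e => by
    rw [norm_smul, Real.norm_eq_abs]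
    exact mul_le_of_le_one_left (norm_nonneg _) (abs_presence_le k)
  have hq : ∀ f : E, ‖f‖ = 1 →
      dataValue hT (twoPoints hT k l e f) (presence k • e + presence l • f) (P τ) 0 0 ∈ Icc 0 c :=
    fun f hf => by
      refine dataValue_mem_Icc hτ0 hτ hg hP _ ?_ ?_
      · exact (norm_add_le _ _).trans ((add_le_add (hs k e) (hs l f)).trans
          (by rw [he1, hf]; norm_num))
      · exact (integral_norm_twoPoints_le k l).trans (by rw [he1, hf]; norm_num)
  have h1 := (hq f hf).2
  have h2 := (hq (-f) (by rw [norm_neg, hf])).1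
  rw [dataValue_twoPoints] at h1 h2
  have h3 : inner ℝ (P τ (l, k) e) f = inner ℝ (P τ (k, l) f) e := by
    rw [← hP.adjoint_apply (left_mem_Icc.2 hτ) k l, ContinuousLinearMap.adjoint_inner_left,
      real_inner_comm]
  simp only [map_neg, inner_neg_left, inner_neg_right, h3, hie] at h1 h2
  have := norm_nonneg (P τ (k, l) f)
  linarith

/-- The Riccati equation has a solution on `[0, T]`. -/
theorem exists_solvesRiccati (hT : 0 ≤ T) (A : E →L[ℝ] E) (hN : Continuous N) (B : U →L[ℝ] E)
    (C : E →L[ℝ] Y) : ∃ P, SolvesRiccati hT A hN B C 0 P := by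
  obtain ⟨g', hg'⟩ := (isCompact_Icc.prod
    (isCompact_univ (X := KernelIndex T))).exists_bound_of_continuousOn
    ((continuous_drift (T := T) (A := A) hN).continuousOn (s := Icc 0 T ×ˢ univ))
  set g := g'.toNNReal with hgg
  have hg : ∀ t ∈ Icc 0 T, ∀ k : KernelIndex T, ‖drift A N t k‖ ≤ g := fun t ht k =>
    (hg' (t, k) ⟨ht, mem_univ k⟩).trans (Real.le_coe_toNNReal _)
  set R := T * (‖C‖ * gronwallBound 2 (g + 1 + g) (g * 2) T) ^ 2 with hR
  have hR0 : 0 ≤ R := by positivity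
  obtain ⟨P, hPT, hP⟩ := exists_hasDerivWithinAt_Icc_of_apriori_bound
    (K := (2 * (g + 1 + (R + 1) * ‖B ∘L B†‖)).toNNReal) hT hR0
    (F := fun t P => riccatiField hT A hN B C t P)
    (fun t ht P Q hP hQ => (norm_riccatiField_sub_le hN (hg t ht) hP hQ).trans
      (mul_le_mul_of_nonneg_right (Real.le_coe_toNNReal _) (norm_nonneg (P - Q))))
    (fun P => (continuous_riccatiField hN continuous_const continuous_id).continuousOn)
    (fun P c hc hPT hP => SolvesRiccati.norm_apply_le hc.1 hc.2 hg ⟨hPT, hP⟩)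
  exact ⟨P, hPT, hP⟩

end Existence

/-! ### The terms which depend on the signal, and the regularity of the coefficients -/

section Signal

open scoped NNReal

theorem continuous_kernel_apply {T : ℝ} {E Z : Type*} [NormedAddCommGroup E]
    [InnerProductSpace ℝ E] [TopologicalSpace Z]
    {P : Z → C(KernelIndex T × KernelIndex T, E →L[ℝ] E)} {k l : Z → KernelIndex T}
    (hP : Continuous P) (hk : Continuous k) (hl : Continuous l) :
    Continuous fun z => P z (k z, l z) :=
  (continuous_eval : Continuous fun q : C(KernelIndex T × KernelIndex T, E →L[ℝ] E)
    × (KernelIndex T × KernelIndex T) => q.1 q.2).comp (hP.prodMk (hk.prodMk hl))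

theorem continuous_vecKernel_apply {T : ℝ} {E Z : Type*} [NormedAddCommGroup E]
    [TopologicalSpace Z] {d : Z → VecKernel T E}
    {k : Z → KernelIndex T} (hd : Continuous d) (hk : Continuous k) :
    Continuous fun z => d z (k z) :=
  (continuous_eval : Continuous fun q : C(KernelIndex T, E) × KernelIndex T => q.1 q.2).comp
    (hd.prodMk hk)

theorem hasDerivWithinAt_vecKernel_apply {T : ℝ} {E : Type*} [NormedAddCommGroup E]
    [InnerProductSpace ℝ E] {d : ℝ → VecKernel T E} {d' : VecKernel T E}
    {s : Set ℝ} {t : ℝ} (h : HasDerivWithinAt d d' s t) (k : KernelIndex T) :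
    HasDerivWithinAt (fun r => d r k) (d' k) s t := by
  have h1 := HasNormDerivWithinAt.clm h (VecKernel.evalCLM k)
  exact h1

theorem HasNormDerivWithinAt.exists_norm_le {G : Type*} [NormedAddCommGroup G] [NormedSpace ℝ G]
    {f f' : ℝ → G} {a b : ℝ} (h : ∀ t ∈ Icc a b, HasNormDerivWithinAt f (f' t) (Icc a b) t) :
    ∃ R, ∀ t ∈ Icc a b, ‖f t‖ ≤ R :=
  isCompact_Icc.exists_bound_of_continuousOn fun t ht => (h t ht).continuousWithinAt

variable {T : ℝ} {E U Y : Type*} [NormedAddCommGroup E] [InnerProductSpace ℝ E] [CompleteSpace E]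
  [NormedAddCommGroup U] [InnerProductSpace ℝ U] [CompleteSpace U]
  [NormedAddCommGroup Y] [InnerProductSpace ℝ Y] [CompleteSpace Y]
  {hT : 0 ≤ T} {A : E →L[ℝ] E} {N : ℝ → E →L[ℝ] E} {B : U →L[ℝ] E} {C : E →L[ℝ] Y}

theorem continuous_signalField_apply (hN : Continuous N) {Z : Type*} [TopologicalSpace Z]
    {P : Z → C(KernelIndex T × KernelIndex T, E →L[ℝ] E)} {d : Z → VecKernel T E} {t : Z → ℝ}
    {y : Z → Y} {k : Z → KernelIndex T} (hP : Continuous P) (hd : Continuous d) (ht : Continuous t)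
    (hy : Continuous y) (hk : Continuous k) :
    Continuous fun z => signalField hT A hN B C (t z) (y z) (P z) (d z) (k z) := by
  have h0 : Continuous fun z => d z present := continuous_vecKernel_apply hd continuous_const
  have h1 : Continuous fun z => P z (k z, present) := continuous_kernel_apply hP hk continuous_const
  have h2 : Continuous fun z => d z (past hT (t z)) :=
    continuous_vecKernel_apply hd ((continuous_past hT).comp ht)
  have h3 : Continuous fun z => (drift A N (t z) (k z))† :=
    ContinuousLinearMap.adjoint.continuous.comp ((continuous_drift hN).comp (ht.prodMk hk))
  exact ((h1.clm_apply (B.continuous.comp ((B†).continuous.comp h0))).sub (h3.clm_apply h0)).sub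
    ((continuous_presence.comp hk).smul (h2.sub ((C†).continuous.comp hy)))

/-- For given P the field is affine in d, so a bound on P gives a global Lipschitz constant and no a
priori estimate is needed. -/
theorem norm_signalField_sub_le (hN : Continuous N) {t g R : ℝ}
    (hg : ∀ k : KernelIndex T, ‖drift A N t k‖ ≤ g) (y : Y)
    {P : C(KernelIndex T × KernelIndex T, E →L[ℝ] E)} (hP : ‖P‖ ≤ R) (d d' : VecKernel T E) :
    ‖signalField hT A hN B C t y P d - signalField hT A hN B C t y P d'‖
      ≤ (R * ‖B ∘L B†‖ + g + 1) * ‖d - d'‖ := by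
  have hg0 : 0 ≤ g := (norm_nonneg _).trans (hg present)
  have hR : 0 ≤ R := (norm_nonneg P).trans hP
  refine VecKernel.norm_le (by positivity) fun k => ?_
  have hd : ∀ k, ‖d k - d' k‖ ≤ ‖d - d'‖ := fun k => (d - d').norm_apply_le k
  have e : (signalField hT A hN B C t y P d - signalField hT A hN B C t y P d') k
      = P (k, present) ((B ∘L B†) (d present - d' present))
        - ((drift A N t k)†) (d present - d' present)
        - presence k • (d (past hT t) - d' (past hT t)) := by
    rw [VecKernel.sub_apply, signalField_apply, signalField_apply]
    simp only [map_sub, ContinuousLinearMap.comp_apply]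
    module
  have h1 : ‖P (k, present) ((B ∘L B†) (d present - d' present))‖
      ≤ R * (‖B ∘L B†‖ * ‖d - d'‖) :=
    (P (k, present)).le_of_opNorm_le_of_le ((P.norm_coe_le_norm _).trans hP)
      ((B ∘L B†).le_of_opNorm_le_of_le le_rfl (hd _))
  have h2 : ‖((drift A N t k)†) (d present - d' present)‖ ≤ g * ‖d - d'‖ :=
    ((drift A N t k)†).le_of_opNorm_le_of_le
      ((LinearIsometryEquiv.norm_map _ _).trans_le (hg k)) (hd _)
  have h3 : ‖presence k • (d (past hT t) - d' (past hT t))‖ ≤ ‖d - d'‖ := by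
    rw [norm_smul, Real.norm_eq_abs]
    exact (mul_le_of_le_one_left (norm_nonneg _) (abs_presence_le k)).trans (hd _)
  rw [e]
  refine (norm_sub_le _ _).trans ((add_le_add ((norm_sub_le _ _).trans (add_le_add h1 h2)) h3).trans
    (le_of_eq (by ring)))

/-- The equation for the terms which depend on the signal has a solution. -/
theorem exists_solvesSignalKernel {hN : Continuous N} {y : ℝ → Y}
    {P : ℝ → C(KernelIndex T × KernelIndex T, E →L[ℝ] E)} (hP : SolvesRiccati hT A hN B C 0 P)
    (hy : ContinuousOn y (Icc 0 T)) : ∃ d, SolvesSignalKernel hT A hN B C y 0 P d := by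
  have hPc : ContinuousOn P (Icc 0 T) := fun t ht => (hP.deriv t ht).continuousWithinAt
  have hP' : Continuous fun t => P (projIcc 0 T hT t) :=
    (continuousOn_iff_continuous_domRestrict.1 hPc).comp continuous_projIcc
  have hy' : Continuous fun t => y (projIcc 0 T hT t) :=
    (continuousOn_iff_continuous_domRestrict.1 hy).comp continuous_projIcc
  obtain ⟨g, hg⟩ := (isCompact_Icc.prod
    (isCompact_univ (X := KernelIndex T))).exists_bound_of_continuousOn
    ((continuous_drift (T := T) (A := A) hN).continuousOn (s := Icc 0 T ×ˢ univ))
  obtain ⟨R, hR⟩ := HasNormDerivWithinAt.exists_norm_le hP.deriv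
  have hcont : ∀ d : VecKernel T E, Continuous fun t =>
      signalField hT A hN B C t (y (projIcc 0 T hT t)) (P (projIcc 0 T hT t)) d := fun d => by
    refine ContinuousMap.continuous_of_continuous_uncurry _ ?_
    exact continuous_signalField_apply hN (hP'.comp continuous_fst) continuous_const continuous_fst
      (hy'.comp continuous_fst) continuous_snd
  obtain ⟨d, hdT, hd⟩ := exists_hasDerivWithinAt_Icc_of_lipschitzWith_final
    (K := (R * ‖B ∘L B†‖ + g + 1).toNNReal) hT
    (F := fun t d => signalField hT A hN B C t (y (projIcc 0 T hT t)) (P (projIcc 0 T hT t)) d)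
    (fun t ht => LipschitzWith.of_dist_le_mul fun d d' => by
      rw [dist_eq_norm, dist_eq_norm]
      refine (norm_signalField_sub_le hN (fun k => hg (t, k) ⟨ht, mem_univ k⟩) _
        (hR _ (projIcc 0 T hT t).2) d d').trans ?_
      gcongr
      exact Real.le_coe_toNNReal _)
    (fun d => (hcont d).continuousOn) 0
  refine ⟨d, hdT, fun t ht => ?_⟩
  have h := hd t ht
  rwa [projIcc_of_mem hT ht] at h

theorem SolvesRiccati.mono {hN : Continuous N} {a b : ℝ} (hab : a ≤ b)
    {P : ℝ → C(KernelIndex T × KernelIndex T, E →L[ℝ] E)} (hP : SolvesRiccati hT A hN B C a P) :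
    SolvesRiccati hT A hN B C b P := by
  refine ⟨hP.final, fun t ht => ?_⟩
  have h := hP.deriv t (Icc_subset_Icc_left hab ht)
  exact HasDerivWithinAt.mono h (Icc_subset_Icc_left hab)

theorem SolvesSignalKernel.mono {hN : Continuous N} {a b : ℝ} (hab : a ≤ b) {y : ℝ → Y}
    {P : ℝ → C(KernelIndex T × KernelIndex T, E →L[ℝ] E)} {d : ℝ → VecKernel T E}
    (hd : SolvesSignalKernel hT A hN B C y a P d) : SolvesSignalKernel hT A hN B C y b P d :=
  ⟨hd.final, fun t ht => (hd.deriv t (Icc_subset_Icc_left hab ht)).mono (Icc_subset_Icc_left hab)⟩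

theorem contDiffOn_one_Icc {F : Type*} [NormedAddCommGroup F] [NormedSpace ℝ F] {f f' : ℝ → F}
    {a b : ℝ} (hab : a < b) (hf : ∀ t ∈ Icc a b, HasDerivWithinAt f (f' t) (Icc a b) t)
    (hf' : ContinuousOn f' (Icc a b)) : ContDiffOn ℝ 1 f (Icc a b) := by
  refine (contDiffOn_one_iff_derivWithin (uniqueDiffOn_Icc hab)).2
    ⟨fun t ht => (hf t ht).differentiableWithinAt, hf'.congr fun t ht => ?_⟩
  exact (hf t ht).derivWithin (uniqueDiffOn_Icc hab t ht)

variable {P : ℝ → C(KernelIndex T × KernelIndex T, E →L[ℝ] E)}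

/-- Continuity of the blocks and of their time derivatives on the interval, the triangle and the
pyramid are all instances of joint evaluation of P and of its field. -/
theorem continuousOn_kernel_apply {hN : Continuous N} (hP : SolvesRiccati hT A hN B C 0 P)
    {Z : Type*} [TopologicalSpace Z] {s : Set Z} {t : Z → ℝ} {k l : Z → KernelIndex T}
    (ht : Continuous t) (hts : MapsTo t s (Icc 0 T)) (hk : Continuous k) (hl : Continuous l) :
    ContinuousOn (fun z => P (t z) (k z, l z)) s ∧
    ContinuousOn (fun z => riccatiField hT A hN B C (t z) (P (t z)) (k z, l z)) s := by
  have hPc : ContinuousOn P (Icc 0 T) := fun t ht => (hP.deriv t ht).continuousWithinAt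
  have hP' : Continuous fun z : s => P (t z) :=
    continuousOn_iff_continuous_domRestrict.1 (hPc.comp ht.continuousOn hts)
  have hk' := hk.comp (continuous_subtype_val (p := (· ∈ s)))
  have hl' := hl.comp (continuous_subtype_val (p := (· ∈ s)))
  have ht' := ht.comp (continuous_subtype_val (p := (· ∈ s)))
  exact ⟨continuousOn_iff_continuous_domRestrict.2 (continuous_kernel_apply hP' hk' hl'),
    continuousOn_iff_continuous_domRestrict.2 (continuous_kernel_apply
      (continuous_riccatiField hN hP' ht') hk' hl')⟩

theorem continuousOn_signal_apply {hN : Continuous N} (hP : SolvesRiccati hT A hN B C 0 P)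
    {y : ℝ → Y} (hy : ContinuousOn y (Icc 0 T)) {d : ℝ → VecKernel T E}
    (hd : SolvesSignalKernel hT A hN B C y 0 P d)
    {Z : Type*} [TopologicalSpace Z] {s : Set Z} {t : Z → ℝ} {k : Z → KernelIndex T}
    (ht : Continuous t) (hts : MapsTo t s (Icc 0 T)) (hk : Continuous k) :
    ContinuousOn (fun z => d (t z) (k z)) s ∧
    ContinuousOn (fun z => signalField hT A hN B C (t z) (y (t z)) (P (t z)) (d (t z)) (k z)) s := by
  have hPc : ContinuousOn P (Icc 0 T) := fun t ht => (hP.deriv t ht).continuousWithinAt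
  have hdc : ContinuousOn d (Icc 0 T) := fun t ht => (hd.deriv t ht).continuousWithinAt
  have hP' : Continuous fun z : s => P (t z) :=
    continuousOn_iff_continuous_domRestrict.1 (hPc.comp ht.continuousOn hts)
  have hd' : Continuous fun z : s => d (t z) :=
    continuousOn_iff_continuous_domRestrict.1 (hdc.comp ht.continuousOn hts)
  have hy' : Continuous fun z : s => y (t z) :=
    continuousOn_iff_continuous_domRestrict.1 (hy.comp ht.continuousOn hts)
  have hk' := hk.comp (continuous_subtype_val (p := (· ∈ s)))
  have ht' := ht.comp (continuous_subtype_val (p := (· ∈ s)))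
  exact ⟨continuousOn_iff_continuous_domRestrict.2 (continuous_vecKernel_apply hd' hk'),
    continuousOn_iff_continuous_domRestrict.2
      (continuous_signalField_apply hN hP' hd' ht' hy' hk')⟩

/-- A primitive which vanishes at the right end point. -/
theorem exists_hasDerivWithinAt_of_final {φ : ℝ → ℝ} (hφ : ContinuousOn φ (Icc 0 T)) :
    ∃ M : ℝ → ℝ, M T = 0 ∧ ∀ t ∈ Icc 0 T, HasDerivWithinAt M (φ t) (Icc 0 T) t :=
  ⟨fun t => (∫ s in (0 : ℝ)..t, φ s) - ∫ s in (0 : ℝ)..T, φ s, sub_self _, fun _ ht =>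
    (hasDerivWithinAt_integral_Icc hφ ht).sub_const _⟩

end Signal

/-! ### The value function of the tracking problem -/

section Translation

variable {d m p : ℕ} {T : ℝ}

/-- The extension of a function on `[0, T]` by its values at the end points. -/
noncomputable def extendKernel (hT : 0 ≤ T) (N : ℝ → Vec d →L[ℝ] Vec d) : ℝ → Vec d →L[ℝ] Vec d :=
  fun t => N (projIcc 0 T hT t)

variable {hT : 0 ≤ T} {A : Vec d →L[ℝ] Vec d} {N : ℝ → Vec d →L[ℝ] Vec d} {B : Vec m →L[ℝ] Vec d}
  {C : Vec d →L[ℝ] Vec p} {y : ℝ → Vec p} {τ : ℝ} {ξ : Vec d} {η : ℝ → Vec d}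

theorem continuous_extendKernel (hN : ContinuousOn N (Icc 0 T)) :
    Continuous (extendKernel hT N) :=
  (continuousOn_iff_continuous_domRestrict.1 hN).comp continuous_projIcc

theorem extendKernel_of_mem {t : ℝ} (ht : t ∈ Icc 0 T) : extendKernel hT N t = N t := by
  rw [extendKernel, projIcc_of_mem hT ht]

/-- In this range neither the index s nor the argument r - s is clamped, so the extension of N
leaves the original problem unchanged. -/
theorem drift_extendKernel_past {r s : ℝ} (hs : 0 ≤ s) (hsr : s ≤ r) (hr : r ≤ T) :
    drift A (extendKernel hT N) r (past hT s) = N (r - s) := by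
  simp only [drift, past, Sum.elim_inr]
  rw [projIcc_of_mem hT ⟨hs, hsr.trans hr⟩]
  exact extendKernel_of_mem ⟨by linarith, by linarith⟩

theorem IsMemory.integrable (hη : IsMemory τ η) : Integrable η (volume.restrict (Ioc 0 τ)) := by
  have h := MemLp.integrable one_le_two hη
  rwa [← restrict_Ioo_eq_restrict_Ioc]

/-- The memory which is given by a function on `(0, τ)`. -/
noncomputable def history (hT : 0 ≤ T) (hη : IsMemory τ η) : Memory T (Vec d) where
  Ω := ℝ
  ν := volume.restrict (Ioc 0 τ)
  κ := projIcc 0 T hT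
  η := η
  κ_measurable := continuous_projIcc.measurable
  η_integrable := hη.integrable

theorem pair_history {F : Type*} [NormedAddCommGroup F] [NormedSpace ℝ F] (hτ : 0 ≤ τ)
    (hη : IsMemory τ η) (X : KernelIndex T → Vec d →L[ℝ] F) :
    (history hT hη).pair X = ∫ s in (0 : ℝ)..τ, X (past hT s) (η s) := by
  rw [intervalIntegral.integral_of_le hτ]
  rfl

/-- An admissible trajectory is continuous only on [τ, T], while the abstract theory uses globally
continuous ones. The pairing sees only times in [τ, r], so agreement on [τ, T] suffices to pass
between the two. -/
theorem statePairing_drift_history (hτ : 0 ≤ τ) (hη : IsMemory τ η) {w z : ℝ → Vec d}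
    (hwz : EqOn w z (Icc τ T)) {r : ℝ} (hr : r ∈ Icc τ T) :
    statePairing hT (history hT hη) w τ r (drift A (extendKernel hT N) r)
      = A (z r) + (∫ s in τ..r, N (r - s) (z s)) + ∫ s in (0 : ℝ)..τ, N (r - s) (η s) := by
  have h1 : ∫ s in (0 : ℝ)..τ, drift A (extendKernel hT N) r (past hT s) (η s)
      = ∫ s in (0 : ℝ)..τ, N (r - s) (η s) := by
    refine intervalIntegral.integral_congr fun s hs => ?_
    rw [uIcc_of_le hτ] at hs
    simp only [drift_extendKernel_past hs.1 (hs.2.trans hr.1) hr.2]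
  have h2 : ∫ s in τ..r, drift A (extendKernel hT N) r (past hT s) (w s)
      = ∫ s in τ..r, N (r - s) (z s) := by
    refine intervalIntegral.integral_congr fun s hs => ?_
    rw [uIcc_of_le hr.1] at hs
    simp only [drift_extendKernel_past (hτ.trans hs.1) hs.2 hr.2, hwz ⟨hs.1, hs.2.trans hr.2⟩]
  rw [statePairing, pair_history hτ, h1, h2, hwz hr]
  simp only [drift, present, Sum.elim_inl]
  abel

theorem IsAdmissible.exists_solvesState (hτ : τ ∈ Icc 0 T) (hη : IsMemory τ η) {v : ℝ → Vec m}
    {z : ℝ → Vec d} (h : IsAdmissible T A N B τ ξ η v z) :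
    ∃ w : ℝ → Vec d, Continuous w ∧ EqOn w z (Icc τ T) ∧
      SolvesState hT A (extendKernel hT N) B (history hT hη) τ ξ v w := by
  refine ⟨IccExtend hτ.2 ((Icc τ T).domRestrict z),
    (continuousOn_iff_continuous_domRestrict.1 h.state_continuousOn).Icc_extend', ?_, ?_⟩
  · exact fun t ht => IccExtend_of_mem _ _ ht
  · have hwz : EqOn (IccExtend hτ.2 ((Icc τ T).domRestrict z)) z (Icc τ T) :=
      fun t ht => IccExtend_of_mem _ _ ht
    intro t ht
    rw [hwz ht, h.state_eq t ht]
    congr 1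
    refine intervalIntegral.integral_congr fun r hr => ?_
    rw [uIcc_of_le ht.1] at hr
    simp only [statePairing_drift_history hτ.1 hη hwz ⟨hr.1, hr.2.trans ht.2⟩]
    abel

theorem SolvesState.isAdmissible (hτ : 0 ≤ τ) (hη : IsMemory τ η) {v : ℝ → Vec m}
    {w : ℝ → Vec d} (hv : MemLp v 2 (volume.restrict (Ioc τ T))) (hw : Continuous w)
    (h : SolvesState hT A (extendKernel hT N) B (history hT hη) τ ξ v w) :
    IsAdmissible T A N B τ ξ η v w := by
  refine ⟨hv, hw.continuousOn, fun t ht => ?_⟩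
  rw [h t ht]
  congr 1
  refine intervalIntegral.integral_congr fun r hr => ?_
  rw [uIcc_of_le ht.1] at hr
  simp only [statePairing_drift_history hτ hη (eqOn_refl w _) ⟨hr.1, hr.2.trans ht.2⟩]
  abel

variable {hN : Continuous (extendKernel hT N)}
  {P : ℝ → C(KernelIndex T × KernelIndex T, Vec d →L[ℝ] Vec d)} {δ : ℝ → VecKernel T (Vec d)}
  {M : ℝ → ℝ}

/-- The optimal control and its feedback form. -/
theorem exists_optimal_control (hP : SolvesRiccati hT A hN B C 0 P) (hy : ContinuousOn y (Icc 0 T))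
    (hδ : SolvesSignalKernel hT A hN B C y 0 P δ)
    (hM : ∀ t ∈ Icc 0 T, HasDerivWithinAt M (‖(B†) (δ t present)‖ ^ 2 - ‖y t‖ ^ 2) (Icc 0 T) t)
    (hMT : M T = 0) (hτ : τ ∈ Icc 0 T) (hη : IsMemory τ η) (ξ : Vec d) :
    ∃ (u : ℝ → Vec m) (w : ℝ → Vec d), ContinuousOn u (Icc τ T) ∧
      IsAdmissible T A N B τ ξ η u w ∧
      cost T C y τ u w = dataValue hT (history hT hη) ξ (P τ) (δ τ) (M τ) ∧
      (∀ (v : ℝ → Vec m) (z : ℝ → Vec d), IsAdmissible T A N B τ ξ η v z →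
        cost T C y τ u w ≤ cost T C y τ v z ∧
        (cost T C y τ v z ≤ cost T C y τ u w → v =ᵐ[volume.restrict (Ioc τ T)] u)) ∧
      ∀ t ∈ Icc τ T, u t = -((B†) (P t (present, present) (w t)
        + (∫ s in (0 : ℝ)..τ, P t (present, past hT s) (η s))
        + (∫ s in τ..t, P t (present, past hT s) (w s)) + δ t present)) := by
  have hsub : Icc τ T ⊆ Icc 0 T := Icc_subset_Icc_left hτ.1
  obtain ⟨u, w, hw, hu, hu', hws, hcost, hmin⟩ := exists_optimal hτ.2 (hy.mono hsub) (hP.mono hτ.1)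
    (hδ.mono hτ.1) (fun t ht => (hM t (hsub ht)).mono hsub) hMT (history hT hη) ξ
  have huL := memLp_two_of_continuousOn hu
  refine ⟨u, w, hu, hws.isAdmissible hτ.1 hη huL hw, hcost, fun v z hvz => ?_, fun t ht => ?_⟩
  · obtain ⟨z', hz', hzz, hzs⟩ := hvz.exists_solvesState (hT := hT) hτ hη
    have h := hmin v z' hvz.control hz' hzs
    have e : cost T C y τ v z = ∫ t in τ..T, (‖C (z' t) - y t‖ ^ 2 + ‖v t‖ ^ 2) := by
      refine intervalIntegral.integral_congr fun t ht => ?_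
      rw [uIcc_of_le hτ.2] at ht
      simp only [hzz ht]
    have h1 : 0 ≤ ∫ t in τ..T, ‖C (z' t - w t)‖ ^ 2 :=
      intervalIntegral.integral_nonneg hτ.2 fun t _ => by positivity
    have h2 : 0 ≤ ∫ t in τ..T, ‖v t - u t‖ ^ 2 :=
      intervalIntegral.integral_nonneg hτ.2 fun t _ => by positivity
    have hc : cost T C y τ u w = dataValue hT (history hT hη) ξ (P τ) (δ τ) (M τ) := hcost
    refine ⟨by linarith, fun hle => ?_⟩
    -- The excess cost is a sum of two nonnegative integrals; if it is not positive, the one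
    -- measuring the controls vanishes.
    have h3 : ∫ t in Ioc τ T, ‖v t - u t‖ ^ 2 = 0 := by
      rw [← intervalIntegral.integral_of_le hτ.2]
      linarith
    have hvu : MemLp (fun t => v t - u t) 2 (volume.restrict (Ioc τ T)) := hvz.control.sub huL
    rw [integral_eq_zero_iff_of_nonneg (fun t => by positivity)
      ((memLp_two_iff_integrable_sq_norm hvu.1).1 hvu)] at h3
    filter_upwards [h3] with t ht
    simpa [sub_eq_zero] using ht
  · rw [hu', costate_apply hw, statePairing, pair_history hτ.1]

/-- Expanding the pairing of the kernel with the state yields the blocks; the two mixed blocks are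
transposes of each other, which accounts for the factor 2 before the P₁ term. -/
theorem quadraticForm_eq_dataValue (hP : SolvesRiccati hT A hN B C 0 P) (hτ : τ ∈ Icc 0 T)
    (hη : IsMemory τ η) (ξ : Vec d) :
    quadraticForm (fun τ => P τ (present, present)) (fun s τ => P τ (present, past hT s))
      (fun s ν τ => P τ (past hT s, past hT ν)) (fun τ => δ τ present)
      (fun s τ => δ τ (past hT s)) M τ ξ η
      = dataValue hT (history hT hη) ξ (P τ) (δ τ) (M τ) := by
  set μ := history hT hη with hμ
  have hsymm := hP.adjoint_apply hτ
  have hrow := continuous_row (P τ)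
  have hc1 : Continuous fun k => realInnerCLM (Vec d) (P τ (k, present) ξ) :=
    (realInnerCLM (Vec d)).continuous.comp
      ((continuous_column (P τ) present).clm_apply continuous_const)
  have hc2 : Continuous fun k => realInnerCLM (Vec d) (μ.pair fun l => P τ (k, l)) :=
    (realInnerCLM (Vec d)).continuous.comp (μ.continuous_pair (P τ).continuous)
  have hc3 : Continuous fun k => (2 : ℝ) • realInnerCLM (Vec d) (δ τ k) :=
    ((realInnerCLM (Vec d)).continuous.comp (δ τ).continuous).const_smul (2 : ℝ)
  have hX : (innerKernel T (Vec d) (costate hT μ (fun _ => ξ) 0 0 (P τ) (δ τ) + δ τ) :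
      KernelIndex T → Vec d →L[ℝ] ℝ)
      = fun k => (realInnerCLM (Vec d) (P τ (k, present) ξ)
        + realInnerCLM (Vec d) (μ.pair fun l => P τ (k, l)))
        + (2 : ℝ) • realInnerCLM (Vec d) (δ τ k) := by
    funext k
    rw [innerKernel_apply, VecKernel.add_apply, costate_apply continuous_const, statePairing_self]
    simp only [map_add]
    module
  have hc12 : Continuous fun k => realInnerCLM (Vec d) (P τ (k, present) ξ)
      + realInnerCLM (Vec d) (μ.pair fun l => P τ (k, l)) := hc1.add hc2
  rw [dataValue_eq, statePairing_self, hX, μ.pair_add hc12 hc3, μ.pair_add hc1 hc2, μ.pair_smul]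
  have e1 : μ.pair (fun k => realInnerCLM (Vec d) (P τ (k, present) ξ))
      = inner ℝ ξ (∫ s in (0 : ℝ)..τ, P τ (present, past hT s) (η s)) := by
    rw [← pair_history hτ.1 hη (fun l => P τ (present, l)), ← realInnerCLM_apply]
    simp only [Memory.pair]
    rw [← (realInnerCLM (Vec d) ξ).integral_comp_comm (μ.integrable_pair (hrow present))]
    refine integral_congr_ae (ae_of_all _ fun s => ?_)
    simp only [realInnerCLM_apply]
    rw [← hsymm present, ContinuousLinearMap.adjoint_inner_left]
  have e2 : μ.pair (fun k => realInnerCLM (Vec d) (μ.pair fun l => P τ (k, l)))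
      = ∫ s in (0 : ℝ)..τ, ∫ ν in (0 : ℝ)..τ, inner ℝ (η s) (P τ (past hT s, past hT ν) (η ν)) := by
    rw [pair_history hτ.1]
    refine intervalIntegral.integral_congr fun s _ => ?_
    have h := (realInnerCLM (Vec d) (η s)).integral_comp_comm
      (μ.integrable_pair (hrow (past hT s)))
    simp only [realInnerCLM_apply] at h ⊢
    rw [real_inner_comm, intervalIntegral.integral_of_le hτ.1]
    exact h.symm
  have e3 : μ.pair (fun k => realInnerCLM (Vec d) (δ τ k))
      = ∫ s in (0 : ℝ)..τ, inner ℝ (η s) (δ τ (past hT s)) := by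
    rw [pair_history hτ.1]
    refine intervalIntegral.integral_congr fun s _ => ?_
    simp only [realInnerCLM_apply]
    exact real_inner_comm _ _
  rw [e1, e2, e3]
  beta_reduce
  rw [hμ, pair_history hτ.1, quadraticForm]
  simp only [add_apply, smul_apply, realInnerCLM_apply, smul_eq_mul]
  rw [real_inner_comm ξ, real_inner_comm ξ, real_inner_comm ξ]
  ring

theorem isValueRepresentation (hP : SolvesRiccati hT A hN B C 0 P) (hy : ContinuousOn y (Icc 0 T))
    (hδ : SolvesSignalKernel hT A hN B C y 0 P δ)
    (hM : ∀ t ∈ Icc 0 T, HasDerivWithinAt M (‖(B†) (δ t present)‖ ^ 2 - ‖y t‖ ^ 2) (Icc 0 T) t)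
    (hMT : M T = 0) :
    IsValueRepresentation T A N B C y (fun τ => P τ (present, present))
      (fun s τ => P τ (present, past hT s)) (fun s ν τ => P τ (past hT s, past hT ν))
      (fun τ => δ τ present) (fun s τ => δ τ (past hT s)) M where
  P₀_continuousOn := (continuousOn_kernel_apply hP continuous_id (mapsTo_id _) continuous_const
    continuous_const).1
  P₁_continuousOn := (continuousOn_kernel_apply hP continuous_snd
    (fun q hq => ⟨hq.1.trans hq.2.1, hq.2.2⟩) continuous_const
    ((continuous_past hT).comp continuous_fst)).1
  P₂_continuousOn := (continuousOn_kernel_apply hP (continuous_snd.comp continuous_snd)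
    (fun q hq => ⟨hq.1.trans hq.2.1, hq.2.2.2.2⟩) ((continuous_past hT).comp continuous_fst)
    ((continuous_past hT).comp (continuous_fst.comp continuous_snd))).1
  d₁_continuousOn := (continuousOn_signal_apply hP hy hδ continuous_id (mapsTo_id _)
    continuous_const).1
  d₂_continuousOn := (continuousOn_signal_apply hP hy hδ continuous_snd
    (fun q hq => ⟨hq.1.trans hq.2.1, hq.2.2⟩) ((continuous_past hT).comp continuous_fst)).1
  M_continuousOn := fun t ht => (hM t ht).continuousWithinAt
  P₀_symm := fun τ hτ => hP.adjoint_apply hτ present present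
  P₂_symm := fun s ν τ h => hP.adjoint_apply ⟨h.1.trans h.2.1, h.2.2.2.2⟩ _ _
  value_eq := fun τ hτ ξ η hη => by
    obtain ⟨u, w, -, huw, hcost, hmin, -⟩ := exists_optimal_control hP hy hδ hM hMT hτ hη ξ
    rw [quadraticForm_eq_dataValue hP hτ hη, ← hcost]
    refine ⟨⟨u, w, huw, rfl⟩, ?_⟩
    rintro c ⟨v, z, hvz, rfl⟩
    exact (hmin v z hvz).1

end Translation

/-! ### Uniqueness of the coefficients of the value function -/

section Uniqueness

variable {d m p : ℕ} {T : ℝ}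

theorem eq_zero_of_integral_norm_sq {F : Type*} [NormedAddCommGroup F] {f : ℝ → F} {a b : ℝ}
    (hab : a < b) (hf : ContinuousOn f (Icc a b)) (h : ∫ t in a..b, ‖f t‖ ^ 2 = 0) {s : ℝ}
    (hs : s ∈ Icc a b) : f s = 0 := by
  by_contra hne
  refine (intervalIntegral.integral_pos hab (hf.norm.pow 2) (fun t _ => sq_nonneg _)
    ⟨s, hs, pow_pos (norm_pos_iff.2 hne) 2⟩).ne' h

/-- At t = 0 the memory interval is degenerate and integrals carry no information; the corner of the
triangle is reached by continuity along s = 0. -/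
theorem eq_of_eq_of_pos {F : Type*} [NormedAddCommGroup F] (hT : 0 < T) {f g : ℝ → ℝ → F}
    (hf : ContinuousOn (fun q : ℝ × ℝ => f q.1 q.2) (triangle T))
    (hg : ContinuousOn (fun q : ℝ × ℝ => g q.1 q.2) (triangle T))
    (h : ∀ t ∈ Ioc 0 T, ∀ s ∈ Icc 0 t, f s t = g s t) {s t : ℝ} (hst : (s, t) ∈ triangle T) :
    f s t = g s t := by
  obtain ⟨h0, h1, h2⟩ := hst
  rcases (h0.trans h1).eq_or_lt with ht | ht
  · simp only at h0 h1 h2 ht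
    obtain rfl : s = 0 := le_antisymm (h1.trans ht.ge) h0
    have hpath : ∀ {f : ℝ → ℝ → F}, ContinuousOn (fun q : ℝ × ℝ => f q.1 q.2) (triangle T) →
        ContinuousOn (fun r => f 0 r) (Icc 0 T) := fun hf =>
      hf.comp (continuousOn_const.prodMk continuousOn_id) fun r hr => ⟨le_rfl, hr.1, hr.2⟩
    exact EqOn.of_subset_closure (s := Ioc 0 T) (t := Icc 0 T)
      (fun r hr => h r hr 0 ⟨le_rfl, hr.1.le⟩) (hpath hf) (hpath hg) Ioc_subset_Icc_self
      (by rw [closure_Ioc hT.ne]) ⟨h1, h2⟩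
  · exact h t ⟨ht, h2⟩ s ⟨h0, h1⟩

theorem isMemory_of_continuousOn {τ : ℝ} {η : ℝ → Vec d} (hη : ContinuousOn η (Icc 0 τ)) :
    IsMemory τ η :=
  (memLp_two_of_continuousOn hη).mono_measure (Measure.restrict_mono Ioo_subset_Ioc_self le_rfl)

/-- A minimum is unique, so the two polynomials agree on continuous memories. Zero data give M, the
odd part in ξ gives d₁, the quadratic part in ξ with polarization gives P₀, the mixed part gives P₁,
and the odd part in η gives d₂. -/
theorem IsValueRepresentation.unique (hT : 0 < T) {A : Vec d →L[ℝ] Vec d} {N : ℝ → Vec d →L[ℝ] Vec d}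
    {B : Vec m →L[ℝ] Vec d} {C : Vec d →L[ℝ] Vec p} {y : ℝ → Vec p}
    {P₀ P₀' : ℝ → Vec d →L[ℝ] Vec d} {P₁ P₁' : ℝ → ℝ → Vec d →L[ℝ] Vec d}
    {P₂ P₂' : ℝ → ℝ → ℝ → Vec d →L[ℝ] Vec d} {d₁ d₁' : ℝ → Vec d} {d₂ d₂' : ℝ → ℝ → Vec d}
    {M M' : ℝ → ℝ} (h : IsValueRepresentation T A N B C y P₀ P₁ P₂ d₁ d₂ M)
    (h' : IsValueRepresentation T A N B C y P₀' P₁' P₂' d₁' d₂' M') :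
    (∀ t ∈ Icc 0 T, P₀ t = P₀' t ∧ d₁ t = d₁' t ∧ M t = M' t) ∧
      ∀ s t, (s, t) ∈ triangle T → P₁ s t = P₁' s t ∧ d₂ s t = d₂' s t := by
  have hq : ∀ τ ∈ Icc 0 T, ∀ (ξ : Vec d) (η : ℝ → Vec d), ContinuousOn η (Icc 0 τ) →
      quadraticForm P₀ P₁ P₂ d₁ d₂ M τ ξ η = quadraticForm P₀' P₁' P₂' d₁' d₂' M' τ ξ η :=
    fun τ hτ ξ η hη => (h.value_eq τ hτ ξ η (isMemory_of_continuousOn hη)).unique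
      (h'.value_eq τ hτ ξ η (isMemory_of_continuousOn hη))
  have hM : ∀ τ ∈ Icc 0 T, M τ = M' τ := fun τ hτ => by
    simpa [quadraticForm] using hq τ hτ 0 (fun _ => 0) continuousOn_const
  have hq0 : ∀ τ ∈ Icc 0 T, ∀ ξ : Vec d, inner ℝ ξ (P₀ τ ξ) + 2 * inner ℝ ξ (d₁ τ)
      = inner ℝ ξ (P₀' τ ξ) + 2 * inner ℝ ξ (d₁' τ) := fun τ hτ ξ => by
    simpa [quadraticForm, hM τ hτ] using hq τ hτ ξ (fun _ => 0) continuousOn_const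
  have hd₁ : ∀ τ ∈ Icc 0 T, d₁ τ = d₁' τ := fun τ hτ => by
    refine ext_inner_left ℝ fun ξ => ?_
    have h1 := hq0 τ hτ ξ
    have h2 := hq0 τ hτ (-ξ)
    simp only [map_neg, inner_neg_left, inner_neg_right] at h2
    linarith
  have hP₀ : ∀ τ ∈ Icc 0 T, P₀ τ = P₀' τ := fun τ hτ => by
    have h1 : ∀ ξ : Vec d, inner ℝ ξ (P₀ τ ξ) = inner ℝ ξ (P₀' τ ξ) := fun ξ => by
      have := hq0 τ hτ ξ
      rw [hd₁ τ hτ] at this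
      linarith
    have hs : ∀ {Q : Vec d →L[ℝ] Vec d}, Q† = Q → ∀ a b : Vec d, inner ℝ a (Q b) = inner ℝ b (Q a) :=
      fun {Q} hQ a b => by
        rw [← ContinuousLinearMap.adjoint_inner_left, hQ, real_inner_comm]
    ext1 b
    refine ext_inner_left ℝ fun a => ?_
    have h2 := h1 (a + b)
    simp only [map_add, inner_add_left, inner_add_right, h1 a, h1 b] at h2
    rw [hs (h.P₀_symm τ hτ) b a, hs (h'.P₀_symm τ hτ) b a] at h2
    linarith
  have hcross : ∀ τ ∈ Icc 0 T, ∀ η : ℝ → Vec d, ContinuousOn η (Icc 0 τ) →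
      ∀ ξ : Vec d, inner ℝ ξ (∫ s in (0 : ℝ)..τ, P₁ s τ (η s))
        = inner ℝ ξ (∫ s in (0 : ℝ)..τ, P₁' s τ (η s)) := fun τ hτ η hη ξ => by
    have h1 := hq τ hτ ξ η hη
    have h2 := hq τ hτ 0 η hη
    simp only [quadraticForm, inner_zero_left, hP₀ τ hτ, hd₁ τ hτ] at h1 h2
    linarith
  have hd₂int : ∀ τ ∈ Icc 0 T, ∀ η : ℝ → Vec d, ContinuousOn η (Icc 0 τ) →
      ∫ s in (0 : ℝ)..τ, inner ℝ (η s) (d₂ s τ) = ∫ s in (0 : ℝ)..τ, inner ℝ (η s) (d₂' s τ) :=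
    fun τ hτ η hη => by
      have h1 := hq τ hτ 0 η hη
      have h2 := hq τ hτ 0 (fun s => -η s) hη.neg
      simp only [quadraticForm, inner_zero_left, map_neg, inner_neg_left, inner_neg_right, neg_neg,
        intervalIntegral.integral_neg, hM τ hτ] at h1 h2
      linarith
  have hslice : ∀ {F : Type} [NormedAddCommGroup F] {f : ℝ → ℝ → F} {t : ℝ}, t ∈ Ioc 0 T →
      ContinuousOn (fun q : ℝ × ℝ => f q.1 q.2) (triangle T) →
      ContinuousOn (fun s => f s t) (Icc 0 t) := fun ht hf =>
    hf.comp (continuousOn_id.prodMk continuousOn_const) fun s hs => ⟨hs.1, hs.2, ht.2⟩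
  refine ⟨fun t ht => ⟨hP₀ t ht, hd₁ t ht, hM t ht⟩, fun s t hst => ⟨?_, ?_⟩⟩
  · refine eq_of_eq_of_pos hT h.P₁_continuousOn h'.P₁_continuousOn (fun t ht s hs => ?_) hst
    have c1 := hslice ht h.P₁_continuousOn
    have c2 := hslice ht h'.P₁_continuousOn
    -- The memory is chosen as the transposed difference applied to e, so the mixed term with ξ = e
    -- becomes the integral of its squared norm.
    have hadj : ∀ e : Vec d, ((P₁ s t - P₁' s t)†) e = 0 := fun e => by
      have hη : ContinuousOn (fun s => ((P₁ s t - P₁' s t)†) e) (Icc 0 t) :=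
        (ContinuousLinearMap.adjoint.continuous.comp_continuousOn (c1.sub c2)).clm_apply
          continuousOn_const
      refine eq_zero_of_integral_norm_sq ht.1 hη ?_ hs
      have i1 := (c1.clm_apply hη).intervalIntegrable_of_Icc (μ := volume) ht.1.le
      have i2 := (c2.clm_apply hη).intervalIntegrable_of_Icc (μ := volume) ht.1.le
      have h1 := hcross t ⟨ht.1.le, ht.2⟩ _ hη e
      rw [← sub_eq_zero, ← inner_sub_right, ← intervalIntegral.integral_sub i1 i2,
        ← realInnerCLM_apply, ← ContinuousLinearMap.intervalIntegral_comp_comm _ (i1.sub i2)] at h1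
      refine Eq.trans (intervalIntegral.integral_congr fun r _ => ?_) h1
      simp only [realInnerCLM_apply]
      rw [← sub_apply, ← ContinuousLinearMap.adjoint_inner_left, real_inner_self_eq_norm_sq]
    have h2 : (P₁ s t - P₁' s t)† = 0 := ContinuousLinearMap.ext hadj
    rw [← sub_eq_zero, ← ContinuousLinearMap.adjoint_adjoint (P₁ s t - P₁' s t), h2, map_zero]
  · refine eq_of_eq_of_pos hT h.d₂_continuousOn h'.d₂_continuousOn (fun t ht s hs => ?_) hst
    have c1 := hslice ht h.d₂_continuousOn
    have c2 := hslice ht h'.d₂_continuousOn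
    rw [← sub_eq_zero]
    refine eq_zero_of_integral_norm_sq ht.1 (c1.sub c2) ?_ hs
    have hη : ContinuousOn (fun s => d₂ s t - d₂' s t) (Icc 0 t) := c1.sub c2
    have i1 := (hη.inner (𝕜 := ℝ) c1).intervalIntegrable_of_Icc (μ := volume) ht.1.le
    have i2 := (hη.inner (𝕜 := ℝ) c2).intervalIntegrable_of_Icc (μ := volume) ht.1.le
    -- The difference of the two candidates is itself the test memory.
    have h1 := hd₂int t ⟨ht.1.le, ht.2⟩ _ hη
    rw [← sub_eq_zero, ← intervalIntegral.integral_sub i1 i2] at h1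
    refine Eq.trans (intervalIntegral.integral_congr fun r _ => ?_) h1
    simp only [← inner_sub_right, real_inner_self_eq_norm_sq]
    rfl

end Uniqueness

/-! ### The feedback law and the equations for the coefficients -/

section Coefficients

variable {d m p : ℕ} {T : ℝ} {hT : 0 ≤ T} {A : Vec d →L[ℝ] Vec d} {N : ℝ → Vec d →L[ℝ] Vec d}
  {B : Vec m →L[ℝ] Vec d} {C : Vec d →L[ℝ] Vec p} {y : ℝ → Vec p}
  {hN : Continuous (extendKernel hT N)}
  {P : ℝ → C(KernelIndex T × KernelIndex T, Vec d →L[ℝ] Vec d)} {δ : ℝ → VecKernel T (Vec d)}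
  {M : ℝ → ℝ} {P₀ : ℝ → Vec d →L[ℝ] Vec d} {P₁ : ℝ → ℝ → Vec d →L[ℝ] Vec d} {d₁ : ℝ → Vec d}
  {d₂ : ℝ → ℝ → Vec d}

theorem isOptimalFeedback (hP : SolvesRiccati hT A hN B C 0 P) (hy : ContinuousOn y (Icc 0 T))
    (hδ : SolvesSignalKernel hT A hN B C y 0 P δ)
    (hM : ∀ t ∈ Icc 0 T, HasDerivWithinAt M (‖(B†) (δ t present)‖ ^ 2 - ‖y t‖ ^ 2) (Icc 0 T) t)
    (hMT : M T = 0) (hP₀ : ∀ t ∈ Icc 0 T, P₀ t = P t (present, present))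
    (hd₁ : ∀ t ∈ Icc 0 T, d₁ t = δ t present)
    (hP₁ : ∀ s t, (s, t) ∈ triangle T → P₁ s t = P t (present, past hT s)) :
    IsOptimalFeedback T A N B C y P₀ P₁ d₁ := fun τ hτ ξ η hη => by
  obtain ⟨u, w, hu, huw, -, hmin, hfb⟩ :=
    exists_optimal_control hP hy hδ hM hMT ⟨hτ.1, hτ.2.le⟩ hη ξ
  refine ⟨u, w, hu, huw, ⟨⟨u, w, huw, rfl⟩, ?_⟩, fun v z hvz hleast => ?_, fun t ht => ?_⟩
  · rintro c ⟨v, z, hvz, rfl⟩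
    exact (hmin v z hvz).1
  · exact (hmin v z hvz).2 (hleast.2 ⟨u, w, huw, rfl⟩)
  · have ht0 : t ∈ Icc 0 T := ⟨hτ.1.trans ht.1, ht.2⟩
    have e : ∀ (a b : ℝ) (f : ℝ → Vec d), 0 ≤ a → a ≤ b → b ≤ t →
        ∫ s in a..b, P₁ s t (f s) = ∫ s in a..b, P t (present, past hT s) (f s) :=
      fun a b f ha hab hbt => intervalIntegral.integral_congr fun s hs => by
        rw [uIcc_of_le hab] at hs
        simp only [hP₁ s t ⟨ha.trans hs.1, hs.2.trans hbt, ht.2⟩]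
    rw [hfb t ht, hP₀ t ht0, hd₁ t ht0, e 0 τ η le_rfl hτ.1 ht.1, e τ t w hτ.1 ht.1 le_rfl]

theorem hasDerivWithinAt_kernel_apply (hP : SolvesRiccati hT A hN B C 0 P) {t : ℝ}
    (ht : t ∈ Icc 0 T) (k l : KernelIndex T) :
    HasDerivWithinAt (fun r => P r (k, l)) (riccatiField hT A hN B C t (P t) (k, l)) (Icc 0 T) t := by
  have h := (hP.deriv t ht).eval (k, l)
  exact h

/-- These are the components of the kernel equation for d at the index `present` and at the past
index s. The latter is restricted to [s, T], where the given coefficients are known to agree with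
the constructed ones. -/
theorem solvesSignalSystem (hP : SolvesRiccati hT A hN B C 0 P)
    (hδ : SolvesSignalKernel hT A hN B C y 0 P δ)
    (hP₀ : ∀ t ∈ Icc 0 T, P₀ t = P t (present, present))
    (hd₁ : ∀ t ∈ Icc 0 T, d₁ t = δ t present)
    (hP₁ : ∀ s t, (s, t) ∈ triangle T → P₁ s t = P t (present, past hT s))
    (hd₂ : ∀ s t, (s, t) ∈ triangle T → d₂ s t = δ t (past hT s)) :
    SolvesSignalSystem T A N B C y P₀ P₁ d₁ d₂ where
  d₁_eq τ hτ := by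
    refine ⟨_, (hasDerivWithinAt_vecKernel_apply (hδ.deriv τ hτ) present).congr_of_mem hd₁ hτ, ?_⟩
    rw [signalField_apply, hP₀ τ hτ, hd₁ τ hτ, hd₂ τ τ ⟨hτ.1, le_rfl, hτ.2⟩]
    simp only [drift, presence, present, Sum.elim_inl, sub_apply, ContinuousLinearMap.comp_apply]
    module
  d₁_final := by
    rw [hd₁ T (right_mem_Icc.2 hT), hδ.final, VecKernel.zero_apply]
  d₂_eq s τ h := by
    have hτ : τ ∈ Icc 0 T := ⟨h.1.trans h.2.1, h.2.2⟩
    have hsub : Icc s T ⊆ Icc 0 T := Icc_subset_Icc_left h.1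
    refine ⟨_, ((hasDerivWithinAt_vecKernel_apply (hδ.deriv τ hτ) (past hT s)).mono hsub).congr_of_mem
      (fun r hr => hd₂ s r ⟨h.1, hr.1, hr.2⟩) h.2, ?_⟩
    rw [signalField_apply, hd₁ τ hτ, hP₁ s τ h, hP.adjoint_apply hτ,
      drift_extendKernel_past h.1 h.2.1 h.2.2]
    simp only [presence, past, Sum.elim_inr, ContinuousLinearMap.comp_apply]
    module
  d₂_final s hs := by
    rw [hd₂ s T ⟨hs.1, hs.2, le_rfl⟩, hδ.final, VecKernel.zero_apply]

end Coefficients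

end MemoryTracking

theorem mainTheorem2 {d m p : ℕ} (T : ℝ) (hT : 0 < T)
    (A : Vec d →L[ℝ] Vec d) (N : ℝ → Vec d →L[ℝ] Vec d) (hN : ContinuousOn N (Set.Icc 0 T))
    (B : Vec m →L[ℝ] Vec d) (C : Vec d →L[ℝ] Vec p) :
    -- the value function has such coefficients; `P₀, P₁, P₂` do not depend on the signal
    (∃ (P₀ : ℝ → Vec d →L[ℝ] Vec d) (P₁ : ℝ → ℝ → Vec d →L[ℝ] Vec d)
        (P₂ : ℝ → ℝ → ℝ → Vec d →L[ℝ] Vec d),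
      ContDiffOn ℝ 1 P₀ (Set.Icc 0 T) ∧
      MemoryTracking.HasContTimeDeriv T P₁ ∧
      MemoryTracking.HasContTimeDeriv₂ T P₂ ∧
      ∀ y : ℝ → Vec p, ContinuousOn y (Set.Icc 0 T) →
        ∃ (d₁ : ℝ → Vec d) (d₂ : ℝ → ℝ → Vec d) (M : ℝ → ℝ),
          ContDiffOn ℝ 1 d₁ (Set.Icc 0 T) ∧
          MemoryTracking.HasContTimeDeriv T d₂ ∧
          ContDiffOn ℝ 1 M (Set.Icc 0 T) ∧
          MemoryTracking.IsValueRepresentation T A N B C y P₀ P₁ P₂ d₁ d₂ M) ∧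
    -- the coefficients of the value function give the optimal control and solve the equations
    (∀ y : ℝ → Vec p, ContinuousOn y (Set.Icc 0 T) →
      ∀ (P₀ : ℝ → Vec d →L[ℝ] Vec d) (P₁ : ℝ → ℝ → Vec d →L[ℝ] Vec d)
        (P₂ : ℝ → ℝ → ℝ → Vec d →L[ℝ] Vec d)
        (d₁ : ℝ → Vec d) (d₂ : ℝ → ℝ → Vec d) (M : ℝ → ℝ),
        MemoryTracking.IsValueRepresentation T A N B C y P₀ P₁ P₂ d₁ d₂ M →
          MemoryTracking.IsOptimalFeedback T A N B C y P₀ P₁ d₁ ∧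
          MemoryTracking.SolvesSignalSystem T A N B C y P₀ P₁ d₁ d₂ ∧
          MemoryTracking.SolvesScalarEquation T B y d₁ M) := by
  have hT0 : 0 ≤ T := hT.le
  have hNc : Continuous (MemoryTracking.extendKernel hT0 N) :=
    MemoryTracking.continuous_extendKernel hN
  -- The kernel is fixed before any signal is introduced, which makes P₀, P₁, P₂ independent of y.
  obtain ⟨P, hP⟩ := MemoryTracking.exists_solvesRiccati hT0 A hNc B C
  have hpast := MemoryTracking.continuous_past hT0
  have key : ∀ y : ℝ → Vec p, ContinuousOn y (Set.Icc 0 T) →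
      ∃ (δ : ℝ → MemoryTracking.VecKernel T (Vec d)) (M : ℝ → ℝ),
        MemoryTracking.SolvesSignalKernel hT0 A hNc B C y 0 P δ ∧ M T = 0 ∧
        ContinuousOn (fun t => ‖(B†) (δ t MemoryTracking.present)‖ ^ 2 - ‖y t‖ ^ 2) (Icc 0 T) ∧
        ∀ t ∈ Icc 0 T, HasDerivWithinAt M
          (‖(B†) (δ t MemoryTracking.present)‖ ^ 2 - ‖y t‖ ^ 2) (Icc 0 T) t := fun y hy => by
    obtain ⟨δ, hδ⟩ := MemoryTracking.exists_solvesSignalKernel hP hy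
    have hφ : ContinuousOn (fun t => ‖(B†) (δ t MemoryTracking.present)‖ ^ 2 - ‖y t‖ ^ 2)
        (Icc 0 T) :=
      (((B†).continuous.comp_continuousOn (MemoryTracking.continuousOn_signal_apply hP hy hδ
        continuous_id (mapsTo_id _) continuous_const).1).norm.pow 2).sub (hy.norm.pow 2)
    obtain ⟨M, hMT, hM⟩ := MemoryTracking.exists_hasDerivWithinAt_of_final hφ
    exact ⟨δ, M, hδ, hMT, hφ, hM⟩
  refine ⟨⟨fun τ => P τ (MemoryTracking.present, MemoryTracking.present),
    fun s τ => P τ (MemoryTracking.present, MemoryTracking.past hT0 s),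
    fun s ν τ => P τ (MemoryTracking.past hT0 s, MemoryTracking.past hT0 ν), ?_, ?_, ?_,
    fun y hy => ?_⟩, fun y hy P₀ P₁ P₂ d₁ d₂ M h => ?_⟩
  · exact MemoryTracking.contDiffOn_one_Icc hT
      (fun t ht => MemoryTracking.hasDerivWithinAt_kernel_apply hP ht _ _)
      (MemoryTracking.continuousOn_kernel_apply hP continuous_id (mapsTo_id _) continuous_const
        continuous_const).2
  · refine ⟨fun s t => MemoryTracking.riccatiField hT0 A hNc B C t (P t)
        (MemoryTracking.present, MemoryTracking.past hT0 s),
      (MemoryTracking.continuousOn_kernel_apply hP (s := MemoryTracking.triangle T)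
      continuous_snd (fun q hq => ⟨hq.1.trans hq.2.1, hq.2.2⟩) continuous_const
      (hpast.comp continuous_fst)).2, fun s t hst => ?_⟩
    exact (MemoryTracking.hasDerivWithinAt_kernel_apply hP ⟨hst.1.trans hst.2.1, hst.2.2⟩ _ _).mono
      (Icc_subset_Icc_left hst.1)
  · refine ⟨fun s ν t => MemoryTracking.riccatiField hT0 A hNc B C t (P t)
        (MemoryTracking.past hT0 s, MemoryTracking.past hT0 ν),
      (MemoryTracking.continuousOn_kernel_apply hP (s := MemoryTracking.pyramid T)
      (continuous_snd.comp continuous_snd) (fun q hq => ⟨hq.1.trans hq.2.1, hq.2.2.2.2⟩)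
      (hpast.comp continuous_fst) (hpast.comp (continuous_fst.comp continuous_snd))).2,
      fun s ν t h => ?_⟩
    exact (MemoryTracking.hasDerivWithinAt_kernel_apply hP ⟨h.1.trans h.2.1, h.2.2.2.2⟩ _ _).mono
      (Icc_subset_Icc_left (h.1.trans (le_max_left _ _)))
  · obtain ⟨δ, M, hδ, hMT, hφ, hM⟩ := key y hy
    refine ⟨fun τ => δ τ MemoryTracking.present, fun s τ => δ τ (MemoryTracking.past hT0 s), M, ?_,
      ?_, MemoryTracking.contDiffOn_one_Icc hT hM hφ,
      MemoryTracking.isValueRepresentation hP hy hδ hM hMT⟩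
    · exact MemoryTracking.contDiffOn_one_Icc hT (fun t ht =>
        MemoryTracking.hasDerivWithinAt_vecKernel_apply (hδ.deriv t ht) _)
        (MemoryTracking.continuousOn_signal_apply hP hy hδ continuous_id (mapsTo_id _)
          continuous_const).2
    · refine ⟨fun s t => MemoryTracking.signalField hT0 A hNc B C t (y t) (P t) (δ t)
        (MemoryTracking.past hT0 s),
      (MemoryTracking.continuousOn_signal_apply hP hy hδ
        (s := MemoryTracking.triangle T) continuous_snd
        (fun q hq => ⟨hq.1.trans hq.2.1, hq.2.2⟩) (hpast.comp continuous_fst)).2,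
        fun s t hst => ?_⟩
      exact (MemoryTracking.hasDerivWithinAt_vecKernel_apply
        (hδ.deriv t ⟨hst.1.trans hst.2.1, hst.2.2⟩) _).mono (Icc_subset_Icc_left hst.1)
  · obtain ⟨δ, M', hδ, hMT, -, hM⟩ := key y hy
    -- P₂ need not be identified, as it enters neither the feedback law nor the equations for d₁, d₂
    -- and M.
    obtain ⟨h1, h2⟩ := h.unique hT (MemoryTracking.isValueRepresentation hP hy hδ hM hMT)
    have hP₀ := fun t ht => (h1 t ht).1
    have hd₁ := fun t ht => (h1 t ht).2.1
    have hM' := fun t ht => (h1 t ht).2.2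
    have hP₁ := fun s t hst => (h2 s t hst).1
    have hd₂ := fun s t hst => (h2 s t hst).2
    refine ⟨MemoryTracking.isOptimalFeedback hP hy hδ hM hMT hP₀ hd₁ hP₁,
      MemoryTracking.solvesSignalSystem hP hδ hP₀ hd₁ hP₁ hd₂, fun τ hτ => ?_, ?_⟩
    · rw [hd₁ τ hτ]
      exact (hM τ hτ).congr_of_mem hM' hτ
    · rw [hM' T (right_mem_Icc.2 hT0), hMT]
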